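/- Let $R$ be a two-dimensional regular local ring with algebraically closed residue field, let $\mathfrak a\subseteq R$ be a complete (integrally closed) ideal of finite colength, and let $\pi:X\to\operatorname{Spec}R$ be a minimal principalization of $\mathfrak a$, i.e. a minimal composition of blowups of closed points $x_1,\dots,x_N$ such that $\mathfrak a\mathcal O_X=\mathcal O_X(-D)$ is invertible. Let $E_\mu$ and $E_\mu^*$ be the strict and the total transform on $X$ of the exceptional curve of the blowup of $x_\mu$; let $K=\sum_\mu E_\mu^*=\sum_\mu k_\mu E_\mu$ be the canonical divisor and $D=\sum_\mu d_\mu E_\mu$. Let $\Gamma$ be the dual graph: its vertices are the indices $\mu$ of the curves $E_\mu$, and $\mu\sim\nu$ means that $\mu\ne\nu$ and $E_\mu\cap E_\nu\neq\emptyset$. Put $w(\gamma)=-E_\gamma^2$, $\widehat d_\gamma=-D\cdot E_\gamma$, and $$\lambda(a,\gamma)=\frac{a+k_\gamma+1}{d_\gamma}\qquad(a\in\mathbb Z,\ \gamma\in|\Gamma|).$$ Let $\gamma$ be a vertex and $a_\gamma$ a nonnegative integer. If $N>1$, then there are nonnegative integers $a_\eta$, one for every $\eta\sim\gamma$, such that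 $$w(\gamma)a_\gamma=\sum_{\eta\sim\gamma}a_\eta\qquad(*)$$ and $\lambda(a_\eta,\eta)\ge\lambda(a_\gamma,\gamma)$ for every $\eta\sim\gamma$ except at most one. More precisely, let $\{\eta\mid\eta\sim\gamma\}=\{\eta_1,\dots,\eta_m\}$ with pairwise distinct $\eta_j$ and $m>1$. Then the following hold. 1) Let $a_{\eta_1}$ be a nonnegative integer with $\lambda(a_{\eta_1},\eta_1)=\lambda(a_\gamma,\gamma)$. Then there are nonnegative integers $a_{\eta_2},\dots,a_{\eta_m}$ such that $(*)$ holds, $\lambda(a_{\eta_j},\eta_j)\ge\lambda(a_\gamma,\gamma)$ for all $1<j\le m$, and this inequality is strict for all $1<j\le m$ except at most one. If, moreover, $c$ is a nonnegative integer with $\lambda(c,\eta_2)=\lambda(a_\gamma,\gamma)$, then there are nonnegative integers $a_{\eta_2},\dots,a_{\eta_m}$ such that $(*)$ holds, $\lambda(a_{\eta_2},\eta_2)\ge\lambda(a_\gamma,\gamma)$, and $\lambda(a_{\eta_j},\eta_j)>\lambda(a_\gamma,\gamma)$ for all $2<j\le m$; here one can take $a_{\eta_2}=c$, except possibly when $m=2$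 and $\widehat d_\gamma>0$. 2) Let $a_{\eta_1}$ be a nonnegative integer with $\lambda(a_{\eta_1},\eta_1)<\lambda(a_\gamma,\gamma)$ or, in the case $\widehat d_\gamma>0$, with $\lambda(a_{\eta_1},\eta_1)=\lambda(a_\gamma,\gamma)$. Then there are nonnegative integers $a_{\eta_2},\dots,a_{\eta_m}$ such that $(*)$ holds and $\lambda(a_{\eta_j},\eta_j)>\lambda(a_\gamma,\gamma)$ for every $1<j\le m$. -/

import Mathlib

/-!
Throughout, `R` is a local ring with fraction field `K`. A closed point `x` of a regular surface
obtained from `Spec R` by blowing up points is represented by its local ring, a local subring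
of `K`. A generic point of an exceptional curve is represented by its valuation ring.
-/

namespace ExcTree

open IsLocalRing

/-- A complete (that is, integrally closed) ideal: it contains every `r` satisfying an equation
`r ^ n + c₁ r ^ (n - 1) + ⋯ + cₙ = 0` with `n ≥ 1` and `cᵢ ∈ 𝔞 ^ i`. -/
def IsCompleteIdeal {R : Type*} [CommRing R] (𝔞 : Ideal R) : Prop :=
  ∀ r : R, (∃ n : ℕ, 1 ≤ n ∧ ∃ c : ℕ → R, (∀ i ∈ Finset.Icc 1 n, c i ∈ 𝔞 ^ i) ∧
    r ^ n + ∑ i ∈ Finset.Icc 1 n, c i * r ^ (n - i) = 0) → r ∈ 𝔞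

section LocalRings

variable {K : Type*} [Field K]

/-- The affine chart `S[𝔪/x]` of the blowup of `Spec S` at its closed point, `x ∈ 𝔪`. -/
def blowupChart (S : LocalSubring K) (x : S.toSubring) : Subring K :=
  Subring.closure ((S.toSubring : Set K) ∪
    {z | ∃ y ∈ maximalIdeal S.toSubring, z = (y : K) / (x : K)})

/-- `T` is the local ring of a closed point of the exceptional fibre of the blowup of `Spec S` at
its closed point: a localization of a chart `S[𝔪/x]` at a maximal ideal that contains `x`. -/
def IsQuadraticTransform (S T : LocalSubring K) : Prop :=
  ∃ x ∈ maximalIdeal S.toSubring, x ≠ 0 ∧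
    ∃ (𝔫 : Ideal (blowupChart S x)) (_ : 𝔫.IsMaximal),
      (∃ z ∈ 𝔫, (z : K) = (x : K)) ∧ T = LocalSubring.ofPrime (blowupChart S x) 𝔫

/-- `T` is infinitely near to `S` (equality allowed): it is reached from `S` by finitely many
point blowups. -/
def IsInfNear (S T : LocalSubring K) : Prop :=
  Relation.ReflTransGen IsQuadraticTransform S T

/-- `T` is infinitely near to `S`, and at least one blowup is needed to reach it. -/
def IsStrictlyInfNear (S T : LocalSubring K) : Prop :=
  Relation.TransGen IsQuadraticTransform S T

/-- The valuation ring of the `𝔪`-adic order valuation of `S`: all fractions `a / b` with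
`ord b ≤ n ≤ ord a` for some `n`. It is the local ring of the generic point of the exceptional
curve of the blowup of `S`. -/
def orderRing (S : LocalSubring K) : Set K :=
  {z | ∃ (n : ℕ) (a b : S.toSubring), a ∈ maximalIdeal S.toSubring ^ n ∧
    b ∉ maximalIdeal S.toSubring ^ (n + 1) ∧ z = (a : K) / (b : K)}

/-- The point `T` lies over the point `S`, on the strict transform of the exceptional curve of
the blowup of `S`: its local ring is contained in the local ring of the generic point of
that curve. -/
def LiesOnStrictTransform (T S : LocalSubring K) : Prop :=
  IsStrictlyInfNear S T ∧ (T.toSubring : Set K) ⊆ orderRing S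

end LocalRings

section Principalization

variable {R : Type*} [CommRing R] [IsLocalRing R]
variable {K : Type*} [Field K] [Algebra R K]

/-- The closed point of `Spec R`, as a local subring of `K`. -/
def root (R : Type*) [CommRing R] [IsLocalRing R] (K : Type*) [Field K] [Algebra R K] :
    LocalSubring K :=
  LocalSubring.range (algebraMap R K)

/-- The extension `𝔞 T` of the ideal `𝔞` to a local ring `T` containing the image of `R`. -/
def extend (𝔞 : Ideal R) (T : LocalSubring K) : Ideal T.toSubring :=
  Ideal.span {t | ∃ a ∈ 𝔞, algebraMap R K a = (t : K)}

/-- A finite set `C` of points infinitely near to `Spec R` that contains with a point all the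
points below it. Such sets correspond to the finite compositions of point blowups
`X_C → ⋯ → Spec R`: the members of `C` are the points that are blown up. -/
def IsCluster (R : Type*) [CommRing R] [IsLocalRing R] {K : Type*} [Field K] [Algebra R K]
    (C : Finset (LocalSubring K)) : Prop :=
  ∀ T ∈ C, IsInfNear (root R K) T ∧
    ∀ S, IsInfNear (root R K) S → IsStrictlyInfNear S T → S ∈ C

/-- The closed points of the surface `X_C`: the infinitely near points that are not blown up
while all the points below them are. -/
def closedPoints (R : Type*) [CommRing R] [IsLocalRing R] {K : Type*} [Field K] [Algebra R K]
    (C : Finset (LocalSubring K)) : Set (LocalSubring K) :=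
  {T | IsInfNear (root R K) T ∧ T ∉ C ∧
    ∀ S, IsInfNear (root R K) S → IsStrictlyInfNear S T → S ∈ C}

/-- `X_C → Spec R` is a principalization of `𝔞`: the ideal sheaf generated by `𝔞` on `X_C` is
locally principal. -/
def IsPrincipalization (𝔞 : Ideal R) (C : Finset (LocalSubring K)) : Prop :=
  IsCluster R C ∧ ∀ T ∈ closedPoints R C, (extend 𝔞 T).IsPrincipal

/-- `X_C → Spec R` is a minimal principalization of `𝔞`. -/
def IsMinimalPrincipalization (𝔞 : Ideal R) (C : Finset (LocalSubring K)) : Prop :=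
  Minimal (IsPrincipalization 𝔞) C

/-- The dual graph of `X_C`. Its vertices are the exceptional curves `E_μ`, one for each point
`μ ∈ C`; two different vertices are adjacent if the curves have a common closed point. -/
def dualGraph (R : Type*) [CommRing R] [IsLocalRing R] {K : Type*} [Field K] [Algebra R K]
    (C : Finset (LocalSubring K)) : SimpleGraph C where
  Adj μ ν := μ ≠ ν ∧ ∃ T ∈ closedPoints R C,
    LiesOnStrictTransform T μ.1 ∧ LiesOnStrictTransform T ν.1
  symm := ⟨fun _ _ ⟨h, T, hT, h₁, h₂⟩ => ⟨h.symm, T, hT, h₂, h₁⟩⟩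
  loopless := ⟨fun _ h => h.1 rfl⟩

open Classical in
/-- The vertices adjacent to `γ`. -/
noncomputable def neighbors (R : Type*) [CommRing R] [IsLocalRing R] {K : Type*} [Field K]
    [Algebra R K] (C : Finset (LocalSubring K)) (γ : C) : Finset C :=
  Finset.univ.filter fun η => (dualGraph R C).Adj γ η

/-- The coefficient `d_γ = v_γ(𝔞)` of the divisor `D` with `𝔞 𝒪_X = 𝒪_X(-D)`, where `v_γ` is the
order valuation of the local ring `γ`. -/
noncomputable def dCoeff (𝔞 : Ideal R) {C : Finset (LocalSubring K)} (γ : C) : ℕ :=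
  sSup {n : ℕ | extend 𝔞 γ.1 ≤ maximalIdeal γ.1.toSubring ^ n}

end Principalization

section Numerical

variable {K : Type*} [Field K] (C : Finset (LocalSubring K))

open Classical in
/-- The proximity matrix: `1` on the diagonal, `-1` at `(μ, ν)` if `μ` is proximate to `ν`. Thus
`E_ν = ∑ μ, P μ ν • E*_μ` expresses the strict transforms in the total transforms. -/
noncomputable def proximityMatrix : Matrix C C ℤ :=
  fun μ ν => if μ = ν then 1 else if LiesOnStrictTransform μ.1 ν.1 then -1 else 0

/-- The matrix of intersection numbers `E_μ · E_ν`, computed from `E*_μ · E*_ν = -δ_{μν}`. -/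
noncomputable def intersectionMatrix : Matrix C C ℤ :=
  -((proximityMatrix C).transpose * proximityMatrix C)

/-- The weight `w(γ) = -E_γ²` of a vertex. -/
noncomputable def weight (γ : C) : ℤ := -intersectionMatrix C γ γ

open Classical in
/-- The coefficient `k_γ` at `E_γ` of the canonical divisor `K = ∑ μ, E*_μ`, where
`E*_μ = ∑ γ, Q γ μ • E_γ` with `Q = P⁻¹`. -/
noncomputable def kCoeff (γ : C) : ℤ := ∑ μ, (proximityMatrix C)⁻¹ γ μ

end Numerical

section Lambda

variable {R : Type*} [CommRing R] [IsLocalRing R]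
variable {K : Type*} [Field K] [Algebra R K]

/-- The number `d̂_γ = -D · E_γ`. -/
noncomputable def dHat (𝔞 : Ideal R) {C : Finset (LocalSubring K)} (γ : C) : ℤ :=
  -∑ ν, (dCoeff 𝔞 ν : ℤ) * intersectionMatrix C ν γ

/-- `λ(a, γ) = (a + k_γ + 1) / d_γ`. -/
noncomputable def lam (𝔞 : Ideal R) {C : Finset (LocalSubring K)} (a : ℤ) (γ : C) : ℚ :=
  ((a : ℚ) + (kCoeff C γ : ℚ) + 1) / (dCoeff 𝔞 γ : ℚ)

end Lambda

end ExcTree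

open ExcTree

/-! ### Local subrings of `K`, powers of their maximal ideals, and regular parameters. -/

namespace ExcTree

open IsLocalRing Polynomial

variable {K : Type*} [Field K]

/-! Put l = λ(a_γ, γ) and ρ_η = l d_η − k_η − 1. Then λ(c, η) ≥ l means c ≥ ρ_η, and likewise for
strict inequalities. Summing over the m neighbours of γ, adjunction Σ k_η = w k_γ + w − 2
(`sum_neighbors_kCoeff`) and d̂_γ = w d_γ − Σ d_η (`dHat_eq`) give Σ ρ_η = w a_γ + 2 − m − l d̂_γ.
The theorem is now a rounding problem. Replacing ρ_η by ⌊ρ_η⌋ + 1 costs at most 1 per neighbour, and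
2 − m pays for this at all neighbours but one or two; integrality absorbs the last unit and any
surplus goes to a single neighbour (`exists_extend_of_lt`, `exists_extend_of_eq_of_eq`,
`exists_extend_of_eq`, `exists_distribution`). The integers so obtained are nonnegative because ρ_η
> −1.

Geometry thus enters through two inequalities: d̂_γ ≥ 0, and k_η d_γ < (k_γ + 1) d_η for adjacent
curves, which is what ρ_η > −1 needs. Both concern the multiplicities r_T, that is, d_T minus the
sum of the d_σ over the points σ to which T is proximate (`excess`). Minimality makes every r_T
positive (`IsMinimalPrincipalization.excess_pos`). Since d̂_γ is r_γ minus the sum of the r_T over T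
proximate to γ, its nonnegativity is the proximity inequality. It is proved for one element by
intersecting its divisor with E_γ: Noether's formula telescopes along E_γ, and the degree of a
leading form bounds what is left (`sum_above_excess_le`, `sum_mult_le`). An element of minimal order
at γ carries it over to the ideal (`dHat_nonneg`). The second inequality
(`IsCluster.mul_lt_mul_of_prox`) follows by induction from k_T = 1 + Σ k_σ and d_T = r_T + Σ d_σ,
together with k_p r_η ≤ d_p for η over p (`IsCluster.mul_excess_le`).

The local input is that, over an algebraically closed residue field, each quadratic transform of S
is S[y/x] localized at (x, y/x) for suitable parameters (`exists_isQT_of_isQuadraticTransform`).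
Equations of exceptional curves can then be followed explicitly. At most two curves pass through a
point, with equations forming a system of parameters, and the matrix computed from proximity agrees
with the dual graph (`intersectionMatrix_of_ne`). -/

/-- The maximal ideal of a local subring of `K`, as a subset of `K`. -/
def mx (S : LocalSubring K) : Set K :=
  {z | ∃ h : z ∈ S.toSubring, (⟨z, h⟩ : S.toSubring) ∈ maximalIdeal S.toSubring}

/-- The `n`-th power of the maximal ideal of a local subring of `K`, as a subset of `K`. -/
def mpow (S : LocalSubring K) (n : ℕ) : Set K :=
  {z | ∃ h : z ∈ S.toSubring, (⟨z, h⟩ : S.toSubring) ∈ maximalIdeal S.toSubring ^ n}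

section Basic

variable {S T : LocalSubring K} {x y z a b : K}

lemma coe_mem_mx {s : S.toSubring} : (s : K) ∈ mx S ↔ s ∈ maximalIdeal S.toSubring :=
  ⟨fun h => h.2, fun h => ⟨s.2, h⟩⟩

lemma coe_mem_mpow {s : S.toSubring} {n : ℕ} :
    (s : K) ∈ mpow S n ↔ s ∈ maximalIdeal S.toSubring ^ n :=
  ⟨fun h => h.2, fun h => ⟨s.2, h⟩⟩

lemma add_mem_mx (ha : a ∈ mx S) (hb : b ∈ mx S) : a + b ∈ mx S :=
  ⟨add_mem ha.1 hb.1, Ideal.add_mem _ ha.2 hb.2⟩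

lemma sub_mem_mx (ha : a ∈ mx S) (hb : b ∈ mx S) : a - b ∈ mx S :=
  ⟨sub_mem ha.1 hb.1, Ideal.sub_mem _ ha.2 hb.2⟩

lemma mul_mem_mx (ha : a ∈ S.toSubring) (hb : b ∈ mx S) : a * b ∈ mx S :=
  ⟨mul_mem ha hb.1, Ideal.mul_mem_left _ ⟨a, ha⟩ hb.2⟩

lemma mul_mem_mx' (ha : a ∈ mx S) (hb : b ∈ S.toSubring) : a * b ∈ mx S := by
  rw [mul_comm]; exact mul_mem_mx hb ha

lemma zero_mem_mx : (0 : K) ∈ mx S := ⟨zero_mem _, Ideal.zero_mem _⟩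

lemma one_notMem_mx : (1 : K) ∉ mx S := fun h =>
  (Ideal.ne_top_iff_one _).1 (Ideal.IsPrime.ne_top inferInstance) h.2

lemma notMem_mx_iff (hz : z ∈ S.toSubring) : z ∉ mx S ↔ z ≠ 0 ∧ z⁻¹ ∈ S.toSubring := by
  constructor
  · intro h
    have hu : IsUnit (⟨z, hz⟩ : S.toSubring) := by
      by_contra hu
      exact h ⟨hz, hu⟩
    obtain ⟨b, hb⟩ := hu.exists_right_inv
    have hb' : z * (b : K) = 1 := congrArg Subtype.val hb
    have h0 : z ≠ 0 := left_ne_zero_of_mul_eq_one hb'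
    exact ⟨h0, by rw [inv_eq_of_mul_eq_one_right hb']; exact b.2⟩
  · rintro ⟨h0, hi⟩ h
    apply one_notMem_mx (S := S)
    rw [← inv_mul_cancel₀ h0]
    exact mul_mem_mx hi h

lemma ne_zero_of_notMem_mx (h : z ∉ mx S) : z ≠ 0 := by
  rintro rfl; exact h zero_mem_mx

lemma inv_mem_of_notMem_mx (hz : z ∈ S.toSubring) (h : z ∉ mx S) : z⁻¹ ∈ S.toSubring :=
  ((notMem_mx_iff hz).1 h).2

lemma mul_notMem_mx (ha : a ∈ S.toSubring) (hb : b ∈ S.toSubring) (ha' : a ∉ mx S)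
    (hb' : b ∉ mx S) : a * b ∉ mx S := by
  rw [notMem_mx_iff (mul_mem ha hb), mul_inv]
  exact ⟨mul_ne_zero (ne_zero_of_notMem_mx ha') (ne_zero_of_notMem_mx hb'),
    mul_mem (inv_mem_of_notMem_mx ha ha') (inv_mem_of_notMem_mx hb hb')⟩

lemma pow_notMem_mx (ha : a ∈ S.toSubring) (ha' : a ∉ mx S) (n : ℕ) : a ^ n ∉ mx S := by
  induction n with
  | zero => simpa using one_notMem_mx
  | succ n ih => rw [pow_succ]; exact mul_notMem_mx (pow_mem ha n) ha ih ha'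

lemma pow_mem_mx_of_pos (ha : a ∈ mx S) {n : ℕ} (hn : 0 < n) : a ^ n ∈ mx S := by
  obtain ⟨m, rfl⟩ := Nat.exists_eq_succ_of_ne_zero hn.ne'
  rw [pow_succ]
  exact mul_mem_mx (pow_mem ha.1 m) ha

lemma le_iff_mx : S ≤ T ↔ (∀ z ∈ S.toSubring, z ∈ T.toSubring) ∧ ∀ z ∈ mx S, z ∈ mx T := by
  rw [LocalSubring.le_def]
  constructor
  · rintro ⟨h, hl⟩
    refine ⟨h, fun z hz => ?_⟩
    by_contra hn
    obtain ⟨h0, hi⟩ := (notMem_mx_iff (h hz.1)).1 hn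
    have hu : IsUnit (Subring.inclusion h ⟨z, hz.1⟩) :=
      IsUnit.of_mul_eq_one ⟨z⁻¹, hi⟩ (Subtype.ext (mul_inv_cancel₀ h0))
    exact hz.2 (hl.map_nonunit _ hu)
  · rintro ⟨h, hm⟩
    refine ⟨h, ⟨fun s hs => ?_⟩⟩
    by_contra hn
    exact (hm s ⟨s.2, hn⟩).2 hs

lemma mem_of_le (h : S ≤ T) (hz : z ∈ S.toSubring) : z ∈ T.toSubring := h.1 hz

lemma mx_of_le (h : S ≤ T) (hz : z ∈ mx S) : z ∈ mx T := (le_iff_mx.1 h).2 z hz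

lemma notMem_mx_of_le (h : S ≤ T) (hz : z ∈ S.toSubring) (hz' : z ∉ mx S) : z ∉ mx T := by
  rw [notMem_mx_iff (mem_of_le h hz)]
  exact ⟨ne_zero_of_notMem_mx hz', mem_of_le h (inv_mem_of_notMem_mx hz hz')⟩

lemma mem_mx_of_le (h : S ≤ T) (hz : z ∈ S.toSubring) (hz' : z ∈ mx T) : z ∈ mx S := by
  by_contra hn; exact notMem_mx_of_le h hz hn hz'

lemma mpow_zero : mpow S 0 = (S.toSubring : Set K) := by
  ext z; simp [mpow]

lemma mpow_one : mpow S 1 = mx S := by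
  ext z; simp [mpow, mx]

lemma mpow_anti {m n : ℕ} (h : m ≤ n) (hz : z ∈ mpow S n) : z ∈ mpow S m :=
  ⟨hz.1, Ideal.pow_le_pow_right h hz.2⟩

lemma mul_mem_mpow {m n : ℕ} (ha : a ∈ mpow S m) (hb : b ∈ mpow S n) : a * b ∈ mpow S (m + n) :=
  ⟨mul_mem ha.1 hb.1, by rw [pow_add]; exact Ideal.mul_mem_mul ha.2 hb.2⟩

lemma smul_mem_mpow {n : ℕ} (ha : a ∈ S.toSubring) (hb : b ∈ mpow S n) : a * b ∈ mpow S n :=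
  ⟨mul_mem ha hb.1, Ideal.mul_mem_left _ ⟨a, ha⟩ hb.2⟩

lemma add_mem_mpow {n : ℕ} (ha : a ∈ mpow S n) (hb : b ∈ mpow S n) : a + b ∈ mpow S n :=
  ⟨add_mem ha.1 hb.1, Ideal.add_mem _ ha.2 hb.2⟩

lemma pow_mem_mpow (n : ℕ) (ha : a ∈ mx S) : a ^ n ∈ mpow S n := by
  induction n with
  | zero => rw [mpow_zero]; simp
  | succ n ih => rw [pow_succ]; exact mul_mem_mpow ih (by rwa [mpow_one])

lemma sum_mem_mpow {ι : Type*} {n : ℕ} (s : Finset ι) (f : ι → K)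
    (h : ∀ i ∈ s, f i ∈ mpow S n) : ∑ i ∈ s, f i ∈ mpow S n := by
  classical
  induction s using Finset.induction_on with
  | empty => simpa using ⟨zero_mem _, Ideal.zero_mem _⟩
  | insert i s hi ih =>
    rw [Finset.sum_insert hi]
    exact add_mem_mpow (h i (Finset.mem_insert_self _ _))
      (ih fun j hj => h j (Finset.mem_insert_of_mem hj))

lemma exists_notMem_mpow [IsNoetherianRing S.toSubring] (hz : z ∈ S.toSubring) (h0 : z ≠ 0) :
    ∃ n, z ∈ mpow S n ∧ z ∉ mpow S (n + 1) := by
  classical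
  have hex : ∃ n, z ∉ mpow S n := by
    by_contra! hc
    have : (⟨z, hz⟩ : S.toSubring) ∈ (⨅ n, maximalIdeal S.toSubring ^ n) := by
      rw [Ideal.mem_iInf]
      exact fun n => (hc n).2
    rw [Ideal.iInf_pow_eq_bot_of_isLocalRing _ (Ideal.IsPrime.ne_top inferInstance)] at this
    exact h0 (congrArg Subtype.val this)
  have h1 := Nat.find_spec hex
  have hpos : Nat.find hex ≠ 0 := by
    intro h; rw [h, mpow_zero] at h1; exact h1 hz
  obtain ⟨m, hm⟩ := Nat.exists_eq_succ_of_ne_zero hpos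
  refine ⟨m, ?_, by rw [hm] at h1; exact h1⟩
  have := Nat.find_min hex (m := m) (by omega)
  simpa using this

end Basic

/-- An element of the local ring that is not divisible by `x` is a unit times a power of `y`,
modulo `x`. -/
lemma exists_eq_add_pow_mul_of_span {S : LocalSubring K} {x y z : K}
    [IsNoetherianRing S.toSubring] (hx : x ∈ mx S) (hy : y ∈ mx S)
    (hspan : ∀ z ∈ mx S, ∃ a ∈ S.toSubring, ∃ b ∈ S.toSubring, z = a * x + b * y)
    (hz : z ∈ S.toSubring) (hn : ¬ ∃ w ∈ S.toSubring, z = x * w) :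
    ∃ (m : ℕ), ∃ c ∈ S.toSubring, ∃ w ∈ S.toSubring, w ∉ mx S ∧ z = x * c + y ^ m * w := by
  classical
  -- If such an expression existed for every m, the class of z modulo x would lie in all powers of
  -- the maximal ideal, hence vanish by Krull's intersection theorem. At the last exponent that
  -- works, w is a unit, since otherwise another factor y could be split off.
  have hex : ∃ m : ℕ, ¬ ∃ c ∈ S.toSubring, ∃ w ∈ S.toSubring, z = x * c + y ^ m * w := by
    by_contra! hc
    apply hn
    set X : S.toSubring := ⟨x, hx.1⟩
    set Y : S.toSubring := ⟨y, hy.1⟩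
    set I : Ideal S.toSubring := Ideal.span {X}
    have hI : I ≤ maximalIdeal S.toSubring := by
      rw [Ideal.span_singleton_le_iff_mem]; exact hx.2
    have hIt : I ≠ ⊤ := fun e => (Ideal.IsPrime.ne_top (inferInstance :
      (maximalIdeal S.toSubring).IsPrime)) (top_le_iff.1 (e ▸ hI))
    have : Nontrivial (S.toSubring ⧸ I) := Ideal.Quotient.nontrivial_iff.2 hIt
    have : IsLocalRing (S.toSubring ⧸ I) :=
      IsLocalRing.of_surjective' (Ideal.Quotient.mk I) Ideal.Quotient.mk_surjective
    set J : Ideal (S.toSubring ⧸ I) := (maximalIdeal S.toSubring).map (Ideal.Quotient.mk I)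
    have hJ : J ≠ ⊤ := by
      intro e
      have := congrArg (Ideal.comap (Ideal.Quotient.mk I)) e
      rw [Ideal.comap_map_of_surjective _ Ideal.Quotient.mk_surjective, Ideal.comap_top,
        ← RingHom.ker_eq_comap_bot, Ideal.mk_ker, sup_eq_left.2 hI] at this
      exact Ideal.IsPrime.ne_top inferInstance this
    have hmem : Ideal.Quotient.mk I ⟨z, hz⟩ ∈ (⨅ n, J ^ n) := by
      rw [Ideal.mem_iInf]
      intro m
      obtain ⟨c, hc, w, hw, e⟩ := hc m
      have e' : (⟨z, hz⟩ : S.toSubring) = X * ⟨c, hc⟩ + Y ^ m * ⟨w, hw⟩ := Subtype.ext e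
      have hX : Ideal.Quotient.mk I X = 0 :=
        Ideal.Quotient.eq_zero_iff_mem.2 (Ideal.mem_span_singleton_self X)
      rw [e', map_add, map_mul, hX, zero_mul, zero_add, map_mul, map_pow]
      exact Ideal.mul_mem_right _ _ (Ideal.pow_mem_pow
        (Ideal.mem_map_of_mem _ (hy.2 : Y ∈ maximalIdeal S.toSubring)) _)
    rw [Ideal.iInf_pow_eq_bot_of_isLocalRing _ hJ, Ideal.mem_bot,
      Ideal.Quotient.eq_zero_iff_mem, Ideal.mem_span_singleton] at hmem
    obtain ⟨w, hw⟩ := hmem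
    exact ⟨w, w.2, congrArg Subtype.val hw⟩
  have h1 := Nat.find_spec hex
  have hpos : Nat.find hex ≠ 0 := by
    intro h0; rw [h0] at h1; exact h1 ⟨0, zero_mem _, z, hz, by ring⟩
  obtain ⟨m, hm⟩ := Nat.exists_eq_succ_of_ne_zero hpos
  have h2 := Nat.find_min hex (m := m) (by omega)
  rw [hm] at h1
  push Not at h2
  obtain ⟨c, hc, w, hw, e⟩ := h2
  refine ⟨m, c, hc, w, hw, fun hwm => h1 ?_, e⟩
  obtain ⟨a, ha, b, hb, rfl⟩ := hspan w hwm
  exact ⟨c + y ^ m * a, add_mem hc (mul_mem (pow_mem hy.1 m) ha), b, hb, by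
    rw [e, Nat.succ_eq_add_one, pow_succ]; ring⟩

/-- `x, y` is a regular system of parameters of the two-dimensional local ring `S ⊆ K`. -/
structure IsParams (S : LocalSubring K) (x y : K) : Prop where
  ne_zero_left : x ≠ 0
  ne_zero_right : y ≠ 0
  mem_left : x ∈ mx S
  mem_right : y ∈ mx S
  span : ∀ z ∈ mx S, ∃ a ∈ S.toSubring, ∃ b ∈ S.toSubring, z = a * x + b * y
  reg : ∀ a ∈ S.toSubring, ∀ b ∈ S.toSubring, a * x = b * y → ∃ c ∈ S.toSubring, b = c * x

namespace IsParams

variable {S T : LocalSubring K} {x y z : K}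

lemma symm (h : IsParams S x y) : IsParams S y x where
  ne_zero_left := h.ne_zero_right
  ne_zero_right := h.ne_zero_left
  mem_left := h.mem_right
  mem_right := h.mem_left
  span z hz := by
    obtain ⟨a, ha, b, hb, e⟩ := h.span z hz
    exact ⟨b, hb, a, ha, by rw [e, add_comm]⟩
  reg a ha b hb e := by
    obtain ⟨c, hc, rfl⟩ := h.reg b hb a ha e.symm
    exact ⟨c, hc, mul_right_cancel₀ h.ne_zero_left (by rw [← e]; ring)⟩

/-- Replacing the first parameter by a combination with unit coefficient. -/
lemma change_left (h : IsParams S x y) {α β : K} (hα : α ∈ S.toSubring) (hα' : α ∉ mx S)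
    (hβ : β ∈ S.toSubring) : IsParams S (α * x + β * y) y := by
  have hαi := inv_mem_of_notMem_mx hα hα'
  have hα0 := ne_zero_of_notMem_mx hα'
  have hreg : ∀ a ∈ S.toSubring, ∀ b ∈ S.toSubring, a * (α * x + β * y) = b * y →
      ∃ c ∈ S.toSubring, b = c * (α * x + β * y) := by
    intro a ha b hb e
    obtain ⟨c, hc, hc'⟩ := h.reg (a * α) (mul_mem ha hα) (b - a * β)
      (sub_mem hb (mul_mem ha hβ)) (by linear_combination e)
    refine ⟨c * α⁻¹, mul_mem hc hαi, ?_⟩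
    have h1 : a * α = c * y := by
      apply mul_right_cancel₀ h.ne_zero_left
      linear_combination e + y * hc'
    have h2 : a = c * α⁻¹ * y := by
      field_simp
      linear_combination h1
    rw [h2] at hc'
    field_simp at hc' ⊢
    linear_combination hc'
  refine ⟨?_, h.ne_zero_right, add_mem_mx (mul_mem_mx hα h.mem_left) (mul_mem_mx hβ h.mem_right),
    h.mem_right, ?_, hreg⟩
  · intro h0
    obtain ⟨c, hc, hc'⟩ := h.reg α hα (-β) (neg_mem hβ) (by linear_combination h0)
    have h1 : α = c * y := by
      apply mul_right_cancel₀ h.ne_zero_left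
      linear_combination h0 + y * hc'
    exact hα' (h1 ▸ mul_mem_mx hc h.mem_right)
  · intro z hz
    obtain ⟨a, ha, b, hb, e⟩ := h.span z hz
    refine ⟨a * α⁻¹, mul_mem ha hαi, b - a * α⁻¹ * β,
      sub_mem hb (mul_mem (mul_mem ha hαi) hβ), ?_⟩
    rw [e]; field_simp; ring

lemma change_right (h : IsParams S x y) {α β : K} (hα : α ∈ S.toSubring)
    (hβ : β ∈ S.toSubring) (hβ' : β ∉ mx S) : IsParams S x (α * x + β * y) := by
  rw [add_comm]
  exact (h.symm.change_left hβ hβ' hα).symm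

/-- The first parameter divides no product of an element with a power of the second parameter,
unless it divides the element. -/
lemma dvd_of_dvd_pow_mul (h : IsParams S x y) (n : ℕ) (hz : z ∈ S.toSubring)
    (hd : ∃ w ∈ S.toSubring, y ^ n * z = x * w) : ∃ w ∈ S.toSubring, z = x * w := by
  induction n with
  | zero => simpa using hd
  | succ n ih =>
    obtain ⟨w, hw, e⟩ := hd
    obtain ⟨c, hc, e'⟩ := h.reg w hw (y ^ n * z)
      (mul_mem (pow_mem h.mem_right.1 n) hz) (by rw [mul_comm w, ← e]; ring)
    exact ih ⟨c, hc, by rw [e', mul_comm]⟩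

lemma pow_mul_unit_ne (h : IsParams S x y) (n : ℕ) {w c : K} (hw : w ∈ S.toSubring)
    (hw' : w ∉ mx S) (hc : c ∈ S.toSubring) : y ^ n * w ≠ x * c := by
  intro e
  obtain ⟨d, hd, rfl⟩ := h.dvd_of_dvd_pow_mul n hw ⟨c, hc, e⟩
  exact hw' (mul_mem_mx' h.mem_left hd)

lemma exists_eq_add_pow_mul [IsNoetherianRing S.toSubring] (h : IsParams S x y)
    (hz : z ∈ S.toSubring) (hn : ¬ ∃ w ∈ S.toSubring, z = x * w) :
    ∃ (m : ℕ), ∃ c ∈ S.toSubring, ∃ w ∈ S.toSubring, w ∉ mx S ∧ z = x * c + y ^ m * w :=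
  exists_eq_add_pow_mul_of_span h.mem_left h.mem_right h.span hz hn

end IsParams

/-! ### Leading forms and additivity of the order. -/

section Homogeneous

variable {S : LocalSubring K} {x y z : K}

lemma pow_mul_aeval {t : K} (hx : x ≠ 0) {n : ℕ} (p : S.toSubring[X]) (hp : p.natDegree ≤ n)
    (ht : t = y / x) :
    x ^ n * aeval t p = ∑ i ∈ Finset.range (n + 1), (p.coeff i : K) * (x ^ (n - i) * y ^ i) := by
  rw [aeval_eq_sum_range' (Nat.lt_succ_of_le hp), Finset.mul_sum]
  refine Finset.sum_congr rfl fun i hi => ?_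
  have hi' : i ≤ n := by simpa [Nat.lt_succ_iff] using hi
  rw [Algebra.smul_def, ht, div_pow]
  have : x ^ n = x ^ (n - i) * x ^ i := by rw [← pow_add]; congr 1; omega
  rw [this]
  change _ * ((p.coeff i : K) * _) = _
  field_simp

lemma map_residue_eq_zero_iff {p : S.toSubring[X]} :
    p.map (residue S.toSubring) = 0 ↔ ∀ i, (p.coeff i : K) ∈ mx S := by
  simp only [Polynomial.ext_iff, coeff_map, coeff_zero, residue_eq_zero_iff, coe_mem_mx]

namespace IsParams

lemma pow_mul_aeval_mem (h : IsParams S x y) {n : ℕ} (p : S.toSubring[X]) (hp : p.natDegree ≤ n) :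
    x ^ n * aeval (y / x) p ∈ mpow S n := by
  rw [pow_mul_aeval h.ne_zero_left p hp rfl]
  refine sum_mem_mpow _ _ fun i hi => smul_mem_mpow (p.coeff i).2 ?_
  have hi' : i ≤ n := by simpa [Nat.lt_succ_iff] using hi
  have := mul_mem_mpow (pow_mem_mpow (n - i) h.mem_left) (pow_mem_mpow i h.mem_right)
  rwa [Nat.sub_add_cancel hi'] at this

lemma pow_mul_aeval_mem_succ (h : IsParams S x y) {n : ℕ} (p : S.toSubring[X])
    (hp : p.natDegree ≤ n) (h0 : p.map (residue S.toSubring) = 0) :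
    x ^ n * aeval (y / x) p ∈ mpow S (n + 1) := by
  rw [pow_mul_aeval h.ne_zero_left p hp rfl]
  refine sum_mem_mpow _ _ fun i hi => ?_
  have hi' : i ≤ n := by simpa [Nat.lt_succ_iff] using hi
  have h1 := mul_mem_mpow (pow_mem_mpow (n - i) h.mem_left) (pow_mem_mpow i h.mem_right)
  rw [Nat.sub_add_cancel hi'] at h1
  have h2 : (p.coeff i : K) ∈ mpow S 1 := by
    rw [mpow_one]; exact map_residue_eq_zero_iff.1 h0 i
  rw [add_comm n]
  exact mul_mem_mpow h2 h1

/-- The exceptional fibre is a whole projective line: y/x satisfies no polynomial relation having a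
unit coefficient. Clearing denominators shows that x divides the top coefficient, which allows
induction on the degree. -/
lemma map_residue_eq_zero_of_aeval_eq_zero (h : IsParams S x y) (n : ℕ) (p : S.toSubring[X])
    (hp : p.natDegree ≤ n) (h0 : aeval (y / x) p = 0) : p.map (residue S.toSubring) = 0 := by
  induction n generalizing p with
  | zero =>
    rw [eq_C_of_natDegree_le_zero hp] at h0 ⊢
    rw [aeval_C] at h0
    have : p.coeff 0 = 0 := Subtype.ext h0
    rw [this]; simp
  | succ n ih =>
    have hsum := pow_mul_aeval h.ne_zero_left p hp (t := y / x) rfl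
    rw [h0, mul_zero, Finset.sum_range_succ] at hsum
    have hq : ∃ w ∈ S.toSubring, y ^ (n + 1) * (p.coeff (n + 1) : K) = x * w := by
      refine ⟨-∑ i ∈ Finset.range (n + 1), (p.coeff i : K) * (x ^ (n - i) * y ^ i), neg_mem
        (sum_mem fun i _ => mul_mem (p.coeff i).2 (mul_mem (pow_mem h.mem_left.1 _)
          (pow_mem h.mem_right.1 _))), ?_⟩
      have : ∑ i ∈ Finset.range (n + 1), (p.coeff i : K) * (x ^ (n + 1 - i) * y ^ i) =
          x * ∑ i ∈ Finset.range (n + 1), (p.coeff i : K) * (x ^ (n - i) * y ^ i) := by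
        rw [Finset.mul_sum]
        refine Finset.sum_congr rfl fun i hi => ?_
        have hi' : i ≤ n := by simpa [Nat.lt_succ_iff] using hi
        rw [Nat.succ_sub hi', pow_succ]; ring
      rw [this, Nat.sub_self, pow_zero, one_mul] at hsum
      linear_combination -hsum
    obtain ⟨e, he, hpe⟩ := h.dvd_of_dvd_pow_mul _ (p.coeff (n + 1)).2 hq
    set X' : S.toSubring := ⟨x, h.mem_left.1⟩ with hX'
    set Y' : S.toSubring := ⟨y, h.mem_right.1⟩ with hY'
    set E : S.toSubring := ⟨e, he⟩ with hE
    have hpE : p.coeff (n + 1) = X' * E := Subtype.ext hpe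
    -- xX − y vanishes at y/x and has coefficients in the maximal ideal. Subtracting this multiple
    -- removes the top term without changing the reduction.
    set q : S.toSubring[X] := C E * X ^ n * (C X' * X - C Y') with hq'
    have hq0 : aeval (y / x) q = 0 := by
      have : aeval (y / x) (C X' * X - C Y') = 0 := by
        rw [map_sub, map_mul, aeval_C, aeval_C, aeval_X]
        change x * (y / x) - y = 0
        rw [mul_div_cancel₀ _ h.ne_zero_left, sub_self]
      rw [hq', map_mul, this, mul_zero]
    have hqr : q.map (residue S.toSubring) = 0 := by
      have hxr : residue S.toSubring X' = 0 := (residue_eq_zero_iff _).2 h.mem_left.2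
      have hyr : residue S.toSubring Y' = 0 := (residue_eq_zero_iff _).2 h.mem_right.2
      simp [hq', hxr, hyr]
    have hqe : q = C (E * X') * X ^ (n + 1) - C (E * Y') * X ^ n := by
      rw [hq', C_mul, C_mul]; ring
    have hdeg : (p - q).natDegree ≤ n := by
      rw [natDegree_le_iff_coeff_eq_zero]
      intro N hN
      rw [coeff_sub, hqe, coeff_sub, coeff_C_mul, coeff_C_mul, coeff_X_pow, coeff_X_pow]
      rcases eq_or_ne N (n + 1) with rfl | hne
      · rw [hpE]; simp [mul_comm]
      · rw [coeff_eq_zero_of_natDegree_lt (by omega)]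
        simp [hne, show N ≠ n by omega]
    have := ih (p - q) hdeg (by rw [map_sub, h0, hq0, sub_zero])
    rw [Polynomial.map_sub, hqr, sub_zero] at this
    exact this

lemma map_residue_eq_zero_of_aeval_eq (h : IsParams S x y) {p q : S.toSubring[X]}
    (h0 : aeval (y / x) p = x * aeval (y / x) q) : p.map (residue S.toSubring) = 0 := by
  have h1 := h.map_residue_eq_zero_of_aeval_eq_zero _ (p - C ⟨x, h.mem_left.1⟩ * q) le_rfl (by
    rw [map_sub, map_mul, aeval_C, h0]
    exact sub_self _)
  rw [Polynomial.map_sub, Polynomial.map_mul, map_C,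
    (residue_eq_zero_iff _).2 h.mem_left.2] at h1
  simpa using h1

lemma mem_mpow_iff (h : IsParams S x y) {n : ℕ} :
    z ∈ mpow S n ↔ ∃ p : S.toSubring[X], p.natDegree ≤ n ∧ z = x ^ n * aeval (y / x) p := by
  refine ⟨?_, fun ⟨p, hp, e⟩ => e ▸ h.pow_mul_aeval_mem p hp⟩
  induction n generalizing z with
  | zero =>
    rintro ⟨hz, -⟩
    exact ⟨C ⟨z, hz⟩, by simp, by rw [aeval_C, pow_zero, one_mul]; rfl⟩
  | succ n ih =>
    rintro ⟨hz, hm⟩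
    rw [pow_succ] at hm
    have key : ∀ s : S.toSubring, s ∈ maximalIdeal S.toSubring ^ n * maximalIdeal S.toSubring →
        ∃ p : S.toSubring[X], p.natDegree ≤ n + 1 ∧ (s : K) = x ^ (n + 1) * aeval (y / x) p := by
      intro s hs
      induction hs using Submodule.mul_induction_on' with
      | mem_mul_mem a ha b hb =>
        obtain ⟨p, hp, e⟩ := ih (z := (a : K)) ⟨a.2, ha⟩
        obtain ⟨α, hα, β, hβ, e'⟩ := h.span b ⟨b.2, hb⟩
        refine ⟨p * (C ⟨α, hα⟩ + C ⟨β, hβ⟩ * X), ?_, ?_⟩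
        · refine natDegree_mul_le.trans (add_le_add hp ?_)
          refine (natDegree_add_le _ _).trans ?_
          simp only [natDegree_C, Nat.zero_le, sup_of_le_right]
          exact (natDegree_C_mul_le _ _).trans natDegree_X_le
        · have hx0 := h.ne_zero_left
          rw [map_mul, map_add, map_mul, aeval_C, aeval_C, aeval_X]
          change (a : K) * b = _ * (_ * (α + β * (y / x)))
          rw [e, e', pow_succ]; field_simp
      | add a _ b _ iha ihb =>
        obtain ⟨p, hp, e⟩ := iha
        obtain ⟨q, hq, e'⟩ := ihb
        exact ⟨p + q, (natDegree_add_le _ _).trans (max_le hp hq), by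
          rw [map_add, mul_add, ← e, ← e']; rfl⟩
    exact key _ hm

/-- The form of degree `n` of an element of `𝔪 ^ n`, dehomogenized. -/
lemma exists_leading (h : IsParams S x y) {n : ℕ} (hz : z ∈ mpow S n) (hz' : z ∉ mpow S (n + 1)) :
    ∃ p : S.toSubring[X], p.natDegree ≤ n ∧ z = x ^ n * aeval (y / x) p ∧
      p.map (residue S.toSubring) ≠ 0 := by
  obtain ⟨p, hp, e⟩ := h.mem_mpow_iff.1 hz
  exact ⟨p, hp, e, fun h0 => hz' (e ▸ h.pow_mul_aeval_mem_succ p hp h0)⟩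

/-- The leading forms reduce to nonzero polynomials over the residue field, and their product is
again nonzero. -/
lemma mul_notMem_mpow (h : IsParams S x y) {m n : ℕ} {a b : K} (ha : a ∈ mpow S m)
    (ha' : a ∉ mpow S (m + 1)) (hb : b ∈ mpow S n) (hb' : b ∉ mpow S (n + 1)) :
    a * b ∉ mpow S (m + n + 1) := by
  obtain ⟨p, hp, rfl, hp'⟩ := h.exists_leading ha ha'
  obtain ⟨q, hq, rfl, hq'⟩ := h.exists_leading hb hb'
  intro hc
  obtain ⟨r, hr, e⟩ := h.mem_mpow_iff.1 hc
  have hx0 := h.ne_zero_left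
  have : aeval (y / x) (p * q) = x * aeval (y / x) r := by
    rw [map_mul]
    apply mul_left_cancel₀ (pow_ne_zero (m + n) hx0)
    linear_combination e
  have h1 := h.map_residue_eq_zero_of_aeval_eq this
  rw [Polynomial.map_mul] at h1
  exact (mul_ne_zero hp' hq') h1

lemma left_notMem_mpow (h : IsParams S x y) : x ∉ mpow S 2 := by
  intro hc
  obtain ⟨r, hr, e⟩ := h.mem_mpow_iff.1 hc
  have : aeval (y / x) (1 : S.toSubring[X]) = x * aeval (y / x) r := by
    rw [map_one]
    apply mul_left_cancel₀ h.ne_zero_left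
    linear_combination e
  have h1 := h.map_residue_eq_zero_of_aeval_eq this
  simp at h1

end IsParams

end Homogeneous

end ExcTree

/-! ### Quadratic transforms as localizations of S[y/x]. -/

namespace ExcTree

open IsLocalRing Polynomial

variable {K : Type*} [Field K]

/-- `T` is the local ring `S[y/x]` localized at `(x, y/x)`. -/
structure IsQT (S T : LocalSubring K) (x y : K) : Prop where
  mem_iff : ∀ z, z ∈ T.toSubring ↔ ∃ p q : S.toSubring[X], (q.coeff 0 : K) ∉ mx S ∧
    z = aeval (y / x) p / aeval (y / x) q

lemma mem_ofPrime {A : Subring K} {P : Ideal A} [P.IsPrime] {z : K} :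
    z ∈ (LocalSubring.ofPrime A P).toSubring ↔ ∃ a b : A, b ∉ P ∧ z = (a : K) / b := by
  constructor
  · intro hz
    obtain ⟨⟨a, s⟩, e⟩ := IsLocalization.surj P.primeCompl
      (⟨z, hz⟩ : (LocalSubring.ofPrime A P).toSubring)
    have e' : z * (s : A) = a := congrArg Subtype.val e
    refine ⟨a, s, s.2, ?_⟩
    have hs : ((s : A) : K) ≠ 0 := by
      intro h0
      exact s.2 ((Subtype.ext h0 : (s : A) = 0) ▸ P.zero_mem)
    rw [← e', mul_div_cancel_right₀ _ hs]
  · rintro ⟨a, b, hb, rfl⟩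
    rw [div_eq_mul_inv]
    have ha := LocalSubring.le_ofPrime A P a.2
    have hb' := LocalSubring.le_ofPrime A P b.2
    refine mul_mem ha (inv_mem_of_notMem_mx hb' ?_)
    have hu : IsUnit (algebraMap A (LocalSubring.ofPrime A P).toSubring b) :=
      IsLocalization.map_units _ (⟨b, hb⟩ : P.primeCompl)
    intro hm
    exact hm.2 hu

lemma mem_blowupChart {S : LocalSubring K} {x y z : K} (h : IsParams S x y) :
    z ∈ blowupChart S ⟨x, h.mem_left.1⟩ ↔ ∃ p : S.toSubring[X], z = aeval (y / x) p := by
  have hx0 := h.ne_zero_left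
  constructor
  · intro hz
    induction hz using Subring.closure_induction with
    | mem w hw =>
      rcases hw with hw | ⟨v, hv, rfl⟩
      · exact ⟨C ⟨w, hw⟩, by rw [aeval_C]; rfl⟩
      · obtain ⟨a, ha, b, hb, e⟩ := h.span v ⟨v.2, hv⟩
        refine ⟨C ⟨a, ha⟩ + C ⟨b, hb⟩ * X, ?_⟩
        rw [map_add, map_mul, aeval_C, aeval_C, aeval_X]
        change _ / x = a + b * (y / x)
        rw [e]; field_simp
    | zero => exact ⟨0, by simp⟩
    | one => exact ⟨1, by simp⟩
    | add a b _ _ iha ihb =>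
      obtain ⟨p, rfl⟩ := iha
      obtain ⟨q, rfl⟩ := ihb
      exact ⟨p + q, by simp⟩
    | neg a _ iha =>
      obtain ⟨p, rfl⟩ := iha
      exact ⟨-p, by simp⟩
    | mul a b _ _ iha ihb =>
      obtain ⟨p, rfl⟩ := iha
      obtain ⟨q, rfl⟩ := ihb
      exact ⟨p * q, by simp⟩
  · rintro ⟨p, rfl⟩
    rw [aeval_eq_sum_range]
    refine sum_mem fun i _ => ?_
    rw [Algebra.smul_def]
    refine mul_mem (Subring.subset_closure (Or.inl (p.coeff i).2)) (pow_mem ?_ _)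
    exact Subring.subset_closure (Or.inr ⟨⟨y, h.mem_right.1⟩, h.mem_right.2, rfl⟩)

lemma aeval_eq_coeff_zero_add {S : LocalSubring K} (t : K) (p : S.toSubring[X]) :
    aeval t p = t * aeval t p.divX + p.coeff 0 := by
  conv_lhs => rw [← divX_mul_X_add p]
  rw [map_add, map_mul, aeval_X, aeval_C, mul_comm]; rfl

/-- A prime of the chart containing x contains the maximal ideal of S. If it also contains y/x,
membership of a polynomial in y/x depends only on the constant coefficient. -/
lemma IsParams.isQT_ofPrime {S : LocalSubring K} {x y : K} (h : IsParams S x y)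
    (𝔫 : Ideal (blowupChart S ⟨x, h.mem_left.1⟩)) [h𝔫 : 𝔫.IsPrime]
    (hx : ∃ z ∈ 𝔫, (z : K) = x) (ht : ∃ z ∈ 𝔫, (z : K) = y / x) :
    IsQT S (LocalSubring.ofPrime _ 𝔫) x y := by
  obtain ⟨X', hX', eX⟩ := hx
  obtain ⟨t, ht, et⟩ := ht
  have hS : ∀ s ∈ S.toSubring, s ∈ blowupChart S ⟨x, h.mem_left.1⟩ :=
    fun s hs => Subring.subset_closure (Or.inl hs)
  have hm : ∀ s (hs : s ∈ mx S), (⟨s, hS s hs.1⟩ : blowupChart S ⟨x, h.mem_left.1⟩) ∈ 𝔫 := by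
    intro s hs
    obtain ⟨a, ha, b, hb, e⟩ := h.span s hs
    have : (⟨s, hS s hs.1⟩ : blowupChart S ⟨x, h.mem_left.1⟩) =
        (⟨a, hS a ha⟩ + ⟨b, hS b hb⟩ * t) * X' := by
      apply Subtype.ext
      change s = (a + b * (t : K)) * X'
      have := h.ne_zero_left
      rw [e, et, eX]; field_simp
    rw [this]
    exact 𝔫.mul_mem_left _ hX'
  have key : ∀ (b : blowupChart S ⟨x, h.mem_left.1⟩) (q : S.toSubring[X]),
      (b : K) = aeval (y / x) q → (b ∈ 𝔫 ↔ (q.coeff 0 : K) ∈ mx S) := by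
    intro b q e
    have hd : aeval (y / x) q.divX ∈ blowupChart S ⟨x, h.mem_left.1⟩ :=
      (mem_blowupChart h).2 ⟨_, rfl⟩
    have e1 : b = t * ⟨_, hd⟩ + ⟨q.coeff 0, hS _ (q.coeff 0).2⟩ := by
      apply Subtype.ext
      change (b : K) = t * aeval (y / x) q.divX + q.coeff 0
      rw [e, aeval_eq_coeff_zero_add, et]
    rw [e1, Ideal.add_mem_iff_right _ (𝔫.mul_mem_right _ ht)]
    refine ⟨fun hq => ?_, fun hq => hm _ hq⟩
    by_contra hn
    have hi := inv_mem_of_notMem_mx (q.coeff 0).2 hn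
    apply h𝔫.ne_top
    rw [Ideal.eq_top_iff_one]
    have : (1 : blowupChart S ⟨x, h.mem_left.1⟩) = ⟨_, hS _ hi⟩ * ⟨q.coeff 0, hS _ (q.coeff 0).2⟩ :=
      Subtype.ext (inv_mul_cancel₀ (ne_zero_of_notMem_mx hn)).symm
    rw [this]
    exact 𝔫.mul_mem_left _ hq
  constructor
  intro z
  rw [mem_ofPrime]
  constructor
  · rintro ⟨a, b, hb, rfl⟩
    obtain ⟨p, hp⟩ := (mem_blowupChart h).1 a.2
    obtain ⟨q, hq⟩ := (mem_blowupChart h).1 b.2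
    exact ⟨p, q, fun hc => hb ((key b q hq).2 hc), by rw [hp, hq]⟩
  · rintro ⟨p, q, hq, rfl⟩
    exact ⟨⟨_, (mem_blowupChart h).2 ⟨p, rfl⟩⟩, ⟨_, (mem_blowupChart h).2 ⟨q, rfl⟩⟩,
      fun hc => hq ((key _ q rfl).1 hc), rfl⟩

lemma isNoetherianRing_ofPrime {S : LocalSubring K} {x y : K} (h : IsParams S x y)
    [IsNoetherianRing S.toSubring]
    (𝔫 : Ideal (blowupChart S ⟨x, h.mem_left.1⟩)) [h𝔫 : 𝔫.IsPrime] :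
    IsNoetherianRing (LocalSubring.ofPrime _ 𝔫).toSubring := by
  let f : S.toSubring[X] →+* blowupChart S ⟨x, h.mem_left.1⟩ :=
    ((aeval (y / x) : S.toSubring[X] →ₐ[S.toSubring] K) : S.toSubring[X] →+* K).codRestrict _
      fun p => (mem_blowupChart h).2 ⟨p, rfl⟩
  have hf : Function.Surjective f := by
    rintro ⟨z, hz⟩
    obtain ⟨p, rfl⟩ := (mem_blowupChart h).1 hz
    exact ⟨p, rfl⟩
  have := isNoetherianRing_of_surjective _ _ f hf
  exact IsLocalization.isNoetherianRing 𝔫.primeCompl _ this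

lemma IsParams.aeval_ne_zero {S : LocalSubring K} {x y : K} (h : IsParams S x y)
    {q : S.toSubring[X]} (hq : (q.coeff 0 : K) ∉ mx S) : aeval (y / x) q ≠ 0 := by
  intro h0
  exact hq (map_residue_eq_zero_iff.1
    (h.map_residue_eq_zero_of_aeval_eq_zero _ q le_rfl h0) 0)

/-- The values at y/x of polynomials with nonunit constant term form a maximal ideal. It is proper
because no polynomial with unit constant term vanishes at y/x. -/
lemma IsParams.exists_isQT {S : LocalSubring K} {x y : K} (h : IsParams S x y)
    [IsNoetherianRing S.toSubring] :
    ∃ T, IsQuadraticTransform S T ∧ IsQT S T x y ∧ IsNoetherianRing T.toSubring := by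
  set A := blowupChart S ⟨x, h.mem_left.1⟩ with hA
  have hch : ∀ p : S.toSubring[X], aeval (y / x) p ∈ A :=
    fun p => (mem_blowupChart h).2 ⟨p, rfl⟩
  let 𝔫 : Ideal A :=
    { carrier := {z | ∃ p : S.toSubring[X], (p.coeff 0 : K) ∈ mx S ∧ (z : K) = aeval (y / x) p}
      add_mem' := by
        rintro a b ⟨p, hp, e⟩ ⟨q, hq, e'⟩
        exact ⟨p + q, by rw [coeff_add]; exact add_mem_mx hp hq, by
          rw [map_add, ← e, ← e']; rfl⟩
      zero_mem' := ⟨0, by simpa using zero_mem_mx, by simp⟩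
      smul_mem' := by
        rintro a b ⟨q, hq, e'⟩
        obtain ⟨p, hp⟩ := (mem_blowupChart h).1 a.2
        exact ⟨p * q, by rw [mul_coeff_zero]; exact mul_mem_mx (p.coeff 0).2 hq, by
          rw [map_mul, ← e', ← hp]; rfl⟩ }
  have h1 : (1 : A) ∉ 𝔫 := by
    rintro ⟨p, hp, e⟩
    have : aeval (y / x) (1 - p) = 0 := by
      rw [map_sub, ← e, map_one]; simp
    refine h.aeval_ne_zero (q := 1 - p) ?_ this
    intro hc
    apply one_notMem_mx (S := S)
    have := add_mem_mx hc hp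
    rw [coeff_sub, coeff_one_zero] at this
    simpa using this
  have hmax : 𝔫.IsMaximal := by
    rw [Ideal.isMaximal_iff]
    refine ⟨h1, fun J z hJ hz hzJ => ?_⟩
    obtain ⟨p, hp⟩ := (mem_blowupChart h).1 z.2
    have hp0 : (p.coeff 0 : K) ∉ mx S := fun hc => hz ⟨p, hc, hp⟩
    have hi := inv_mem_of_notMem_mx (p.coeff 0).2 hp0
    have hmem : (⟨_, hch (C ⟨_, hi⟩)⟩ * z - 1 : A) ∈ 𝔫 := by
      refine ⟨C ⟨_, hi⟩ * p - 1, ?_, ?_⟩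
      · rw [coeff_sub, coeff_C_mul, coeff_one_zero]
        have : (⟨_, hi⟩ * p.coeff 0 - 1 : S.toSubring) = 0 :=
          Subtype.ext (sub_eq_zero.2 (inv_mul_cancel₀ (ne_zero_of_notMem_mx hp0)))
        rw [this]; exact zero_mem_mx
      · rw [map_sub, map_mul, map_one, ← hp]; rfl
    have := J.sub_mem (J.mul_mem_left ⟨_, hch (C ⟨_, hi⟩)⟩ hzJ) (hJ hmem)
    simpa using this
  have hx : ∃ z ∈ 𝔫, (z : K) = x :=
    ⟨⟨_, hch (C ⟨x, h.mem_left.1⟩)⟩, ⟨_, by simpa using h.mem_left, rfl⟩, by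
      simp only [aeval_C]; rfl⟩
  have ht : ∃ z ∈ 𝔫, (z : K) = y / x :=
    ⟨⟨_, hch X⟩, ⟨_, by simpa using zero_mem_mx, rfl⟩, by simp⟩
  exact ⟨LocalSubring.ofPrime A 𝔫, ⟨⟨x, h.mem_left.1⟩, h.mem_left.2, fun h0 =>
    h.ne_zero_left (congrArg Subtype.val h0), 𝔫, hmax, hx, rfl⟩, h.isQT_ofPrime 𝔫 hx ht,
    isNoetherianRing_ofPrime h 𝔫⟩

lemma IsQT.unique {S T T' : LocalSubring K} {x y : K} (h : IsQT S T x y) (h' : IsQT S T' x y) :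
    T = T' := by
  apply LocalSubring.toSubring_injective
  ext z
  rw [h.mem_iff, h'.mem_iff]

/-- A two-dimensional regular local subring of `K` with algebraically closed residue field. -/
structure IsPoint (S : LocalSubring K) : Prop where
  noeth : IsNoetherianRing S.toSubring
  algClosed : IsAlgClosed (ResidueField S.toSubring)
  params : ∃ x y, IsParams S x y

/-- A maximal ideal of a polynomial ring over an algebraically closed field contains some
`X - c`. -/
lemma exists_X_sub_C_mem {k : Type*} [Field k] [IsAlgClosed k] (I : Ideal k[X])
    (hI : I.IsMaximal) : ∃ c : k, X - C c ∈ I := by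
  obtain ⟨f, hf⟩ := IsPrincipalIdealRing.principal I
  rw [Ideal.submodule_span_eq] at hf
  have hne : I ≠ ⊥ := Ring.ne_bot_of_isMaximal_of_not_isField hI (Polynomial.not_isField k)
  have hf0 : f ≠ 0 := by
    rintro rfl
    exact hne (by rw [hf]; simp)
  have hfd : f.degree ≠ 0 := by
    intro h0
    apply hI.ne_top
    rw [hf, Ideal.span_singleton_eq_top]
    exact isUnit_iff_degree_eq_zero.2 h0
  obtain ⟨c, hc⟩ := IsAlgClosed.exists_root f hfd
  refine ⟨c, ?_⟩
  have hle : I ≤ Ideal.span {X - C c} := by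
    rw [hf, Ideal.span_singleton_le_span_singleton]
    exact dvd_iff_isRoot.2 hc
  have hnt : Ideal.span {X - C c} ≠ ⊤ := by
    rw [Ne, Ideal.span_singleton_eq_top]
    exact not_isUnit_X_sub_C c
  rw [hI.eq_of_le hnt hle]
  exact Ideal.mem_span_singleton_self _

/-- If x had both coefficients α, β in the maximal ideal, 1 would be x times an element of the
chart, and no proper ideal could contain x. So x is part of a system of parameters. -/
lemma exists_isParams_left_of_isMaximal {S : LocalSubring K} (hS : IsPoint S) (x : S.toSubring)
    (hx : x ∈ maximalIdeal S.toSubring) (hx0 : x ≠ 0)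
    (𝔫 : Ideal (blowupChart S x)) (h𝔫 : 𝔫.IsMaximal) (hxn : ∃ z ∈ 𝔫, (z : K) = (x : K)) :
    ∃ y, IsParams S x y := by
  obtain ⟨u, v, huv⟩ := hS.params
  obtain ⟨α, hα, β, hβ, e⟩ := huv.span x ⟨x.2, hx⟩
  have hx0' : (x : K) ≠ 0 := fun h => hx0 (Subtype.ext h)
  by_cases hα' : α ∈ mx S
  · by_cases hβ' : β ∈ mx S
    · exfalso
      obtain ⟨z, hz, ez⟩ := hxn
      have hd : ∀ s ∈ mx S, s / (x : K) ∈ blowupChart S x := fun s hs =>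
        Subring.subset_closure (Or.inr ⟨⟨s, hs.1⟩, hs.2, rfl⟩)
      apply h𝔫.ne_top
      rw [Ideal.eq_top_iff_one]
      have : (1 : blowupChart S x) = (⟨_, hd _ hα'⟩ * ⟨_, hd _ huv.mem_left⟩ +
          ⟨_, hd _ hβ'⟩ * ⟨_, hd _ huv.mem_right⟩) * z := by
        apply Subtype.ext
        change (1 : K) = (α / x * (u / x) + β / x * (v / x)) * z
        rw [ez]; field_simp; exact e
      rw [this]
      exact 𝔫.mul_mem_left _ hz
    · refine ⟨u, ?_⟩
      rw [e, add_comm]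
      exact huv.symm.change_left hβ hβ' hα
  · refine ⟨v, ?_⟩
    rw [e]
    exact huv.change_left hα hα' hβ

/-- The maximal ideal 𝔫 corresponds to a maximal ideal of polynomials over the residue field, which
contains X − c for some c because that field is algebraically closed. Replacing y by y − cx moves
the point to the origin of the chart. -/
lemma exists_isQT_of_isQuadraticTransform {S T : LocalSubring K} (hS : IsPoint S)
    (h : IsQuadraticTransform S T) : ∃ x y, IsParams S x y ∧ IsQT S T x y := by
  obtain ⟨x, hx, hx0, 𝔫, h𝔫, hxn, rfl⟩ := h
  obtain ⟨y, hy⟩ := exists_isParams_left_of_isMaximal hS x hx hx0 𝔫 h𝔫 hxn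
  have := hS.algClosed
  let f : S.toSubring[X] →+* blowupChart S x :=
    ((aeval (y / (x : K)) : S.toSubring[X] →ₐ[S.toSubring] K) :
      S.toSubring[X] →+* K).codRestrict _ fun p => (mem_blowupChart hy).2 ⟨p, rfl⟩
  have hf : Function.Surjective f := by
    rintro ⟨z, hz⟩
    obtain ⟨p, rfl⟩ := (mem_blowupChart hy).1 hz
    exact ⟨p, rfl⟩
  set M : Ideal S.toSubring[X] := 𝔫.comap f
  have hM : M.IsMaximal := Ideal.comap_isMaximal_of_surjective f hf
  have hres : Function.Surjective (mapRingHom (residue S.toSubring)) :=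
    map_surjective _ residue_surjective
  have hker : ∀ p : S.toSubring[X], p.map (residue S.toSubring) = 0 → p ∈ M := by
    intro p hp
    rw [← sum_monomial_eq p, Polynomial.sum]
    refine sum_mem fun i _ => ?_
    rw [← C_mul_X_pow_eq_monomial]
    refine M.mul_mem_right _ ?_
    obtain ⟨a, ha, b, hb, e⟩ := hy.span _ (map_residue_eq_zero_iff.1 hp i)
    obtain ⟨z, hz, ez⟩ := hxn
    have : f (C (p.coeff i)) =
        f (C (⟨a, ha⟩ : S.toSubring) + C (⟨b, hb⟩ : S.toSubring) * X) * z := by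
      apply Subtype.ext
      change aeval (y / (x : K)) (C (p.coeff i)) =
        aeval (y / (x : K)) (C (⟨a, ha⟩ : S.toSubring) + C (⟨b, hb⟩ : S.toSubring) * X) * z
      rw [map_add, map_mul, aeval_C, aeval_C, aeval_C, aeval_X]
      change (p.coeff i : K) = (a + b * (y / x)) * z
      have := hy.ne_zero_left
      rw [e, ez]; field_simp
    rw [Ideal.mem_comap, this]
    exact 𝔫.mul_mem_left _ hz
  have hmap : ∀ p : S.toSubring[X], p.map (residue S.toSubring) ∈
      M.map (mapRingHom (residue S.toSubring)) → p ∈ M := by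
    intro p hp
    obtain ⟨m, hm, e⟩ := (Ideal.mem_map_iff_of_surjective _ hres).1 hp
    have := hker (p - m) (by
      rw [Polynomial.map_sub, sub_eq_zero]; exact e.symm)
    have := M.add_mem this hm
    simpa using this
  have hI : (M.map (mapRingHom (residue S.toSubring))).IsMaximal := by
    rcases Ideal.map_eq_top_or_isMaximal_of_surjective _ hres hM with ht | hm
    · exfalso
      apply hM.ne_top
      rw [Ideal.eq_top_iff_one]
      exact hmap 1 (by rw [ht]; trivial)
    · exact hm
  obtain ⟨c', hc'⟩ := exists_X_sub_C_mem _ hI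
  obtain ⟨c, rfl⟩ := residue_surjective c'
  have hc : X - C c ∈ M := hmap _ (by simpa using hc')
  have hpar : IsParams S x (-(c : K) * x + 1 * y) :=
    hy.change_right (neg_mem c.2) (one_mem _) one_notMem_mx
  refine ⟨x, _, hpar, hpar.isQT_ofPrime 𝔫 hxn ⟨f (X - C c), hc, ?_⟩⟩
  change aeval (y / (x : K)) (X - C c) = _
  rw [map_sub, aeval_X, aeval_C]
  have := hpar.ne_zero_left
  change y / (x : K) - c = _
  field_simp; ring

end ExcTree

/-! ### Local rings of quadratic transforms and their order valuations. -/

namespace ExcTree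

open IsLocalRing Polynomial

variable {K : Type*} [Field K]

/-- The localization of `T` at the prime ideal generated by `u`, as a subset of `K`. -/
def locAt (T : LocalSubring K) (u : K) : Set K :=
  {z | ∃ a ∈ T.toSubring, ∃ b ∈ T.toSubring, (¬ ∃ w ∈ T.toSubring, b = u * w) ∧ z = a / b}

lemma IsParams.exists_eq_mul_aeval {S : LocalSubring K} {x y : K} (h : IsParams S x y)
    {p : S.toSubring[X]} (hp : p.map (residue S.toSubring) = 0) :
    ∃ r : S.toSubring[X], aeval (y / x) p = x * aeval (y / x) r := by
  have hx0 := h.ne_zero_left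
  have hcoef := map_residue_eq_zero_iff.1 hp
  choose a ha b hb e using fun i => h.span _ (hcoef i)
  refine ⟨∑ i ∈ Finset.range (p.natDegree + 1),
    (C (⟨a i, ha i⟩ : S.toSubring) + C (⟨b i, hb i⟩ : S.toSubring) * X) * X ^ i, ?_⟩
  rw [aeval_eq_sum_range, map_sum, Finset.mul_sum]
  refine Finset.sum_congr rfl fun i _ => ?_
  rw [Algebra.smul_def, map_mul, map_add, map_mul, map_pow, aeval_C, aeval_C, aeval_X]
  change (p.coeff i : K) * _ = x * ((a i + b i * (y / x)) * _)
  rw [e i]; field_simp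

namespace IsQT

variable {S T : LocalSubring K} {x y z : K}

lemma aeval_mem (hT : IsQT S T x y) (p : S.toSubring[X]) : aeval (y / x) p ∈ T.toSubring :=
  (hT.mem_iff _).2 ⟨p, 1, by simpa using one_notMem_mx, by simp⟩

lemma mem_base (hT : IsQT S T x y) (hz : z ∈ S.toSubring) : z ∈ T.toSubring := by
  have := hT.aeval_mem (C ⟨z, hz⟩)
  rw [aeval_C] at this
  exact this

lemma div_mem (hT : IsQT S T x y) : y / x ∈ T.toSubring := by
  have := hT.aeval_mem X
  rwa [aeval_X] at this

lemma inv_aeval_mem (hT : IsQT S T x y) {q : S.toSubring[X]} (hq : (q.coeff 0 : K) ∉ mx S) :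
    (aeval (y / x) q)⁻¹ ∈ T.toSubring :=
  (hT.mem_iff _).2 ⟨1, q, hq, by simp⟩

lemma aeval_notMem_mx (h : IsParams S x y) (hT : IsQT S T x y) {q : S.toSubring[X]}
    (hq : (q.coeff 0 : K) ∉ mx S) : aeval (y / x) q ∉ mx T := by
  rw [notMem_mx_iff (hT.aeval_mem q)]
  exact ⟨h.aeval_ne_zero hq, hT.inv_aeval_mem hq⟩

lemma mem_mx_iff (h : IsParams S x y) (hT : IsQT S T x y) {p : S.toSubring[X]} :
    aeval (y / x) p ∈ mx T ↔ (p.coeff 0 : K) ∈ mx S := by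
  constructor
  · intro hp
    by_contra hn
    exact hT.aeval_notMem_mx h hn hp
  · intro hp
    by_contra hn
    obtain ⟨h0, hi⟩ := (notMem_mx_iff (hT.aeval_mem p)).1 hn
    obtain ⟨p', q', hq', e⟩ := (hT.mem_iff _).1 hi
    have hq0 := h.aeval_ne_zero hq'
    have : aeval (y / x) (q' - p * p') = 0 := by
      rw [map_sub, map_mul]
      field_simp at e
      linear_combination e
    refine h.aeval_ne_zero ?_ this
    intro hc
    apply hq'
    have h2 := add_mem_mx hc (mul_mem_mx' hp (p'.coeff 0).2)
    rw [coeff_sub, mul_coeff_zero] at h2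
    simpa using h2

lemma div_mem_mx (h : IsParams S x y) (hT : IsQT S T x y) : y / x ∈ mx T := by
  have := (hT.mem_mx_iff h (p := X)).2 (by simpa using zero_mem_mx)
  rwa [aeval_X] at this

lemma mem_mx_base (h : IsParams S x y) (hT : IsQT S T x y) (hz : z ∈ mx S) : z ∈ mx T := by
  have := (hT.mem_mx_iff h (p := C ⟨z, hz.1⟩)).2 (by simpa using hz)
  rw [aeval_C] at this
  exact this

lemma le (h : IsParams S x y) (hT : IsQT S T x y) : S ≤ T :=
  le_iff_mx.2 ⟨fun _ hz => hT.mem_base hz, fun _ hz => hT.mem_mx_base h hz⟩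

/-- The quotient of the constant coefficients serves as s. Consequently the residue field does not
grow and remains algebraically closed. -/
lemma exists_sub_mem_mx (h : IsParams S x y) (hT : IsQT S T x y) (hz : z ∈ T.toSubring) :
    ∃ s ∈ S.toSubring, z - s ∈ mx T := by
  obtain ⟨p, q, hq, rfl⟩ := (hT.mem_iff _).1 hz
  have hi := inv_mem_of_notMem_mx (q.coeff 0).2 hq
  refine ⟨p.coeff 0 * (q.coeff 0 : K)⁻¹, mul_mem (p.coeff 0).2 hi, ?_⟩
  have hq0 := h.aeval_ne_zero hq
  have e : aeval (y / x) p / aeval (y / x) q - p.coeff 0 * (q.coeff 0 : K)⁻¹ =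
      (aeval (y / x) q)⁻¹ * aeval (y / x) (p - C (p.coeff 0 * ⟨_, hi⟩) * q) := by
    rw [map_sub, map_mul, aeval_C]
    change _ = _ * (_ - (p.coeff 0 : K) * (q.coeff 0 : K)⁻¹ * _)
    field_simp
  rw [e]
  refine mul_mem_mx (hT.inv_aeval_mem hq) ((hT.mem_mx_iff h).2 ?_)
  rw [coeff_sub, coeff_C_mul]
  have : (p.coeff 0 - p.coeff 0 * ⟨_, hi⟩ * q.coeff 0 : S.toSubring) = 0 := by
    apply Subtype.ext
    change (p.coeff 0 : K) - p.coeff 0 * (q.coeff 0 : K)⁻¹ * q.coeff 0 = 0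
    rw [inv_mul_cancel_right₀ (ne_zero_of_notMem_mx hq), sub_self]
  rw [this]; exact zero_mem_mx

lemma map_residue_eq_zero_of_dvd (h : IsParams S x y) (hT : IsQT S T x y) {p : S.toSubring[X]}
    (hd : ∃ w ∈ T.toSubring, aeval (y / x) p = x * w) : p.map (residue S.toSubring) = 0 := by
  obtain ⟨w, hw, e⟩ := hd
  obtain ⟨a, q, hq, rfl⟩ := (hT.mem_iff _).1 hw
  have hq0 := h.aeval_ne_zero hq
  have : aeval (y / x) (p * q) = x * aeval (y / x) a := by
    rw [map_mul, e]; field_simp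
  have h1 := h.map_residue_eq_zero_of_aeval_eq this
  rw [Polynomial.map_mul] at h1
  refine (mul_eq_zero.1 h1).resolve_right fun hc => hq ?_
  exact map_residue_eq_zero_iff.1 hc 0

lemma isParams (h : IsParams S x y) (hT : IsQT S T x y) : IsParams T x (y / x) where
  ne_zero_left := h.ne_zero_left
  ne_zero_right := div_ne_zero h.ne_zero_right h.ne_zero_left
  mem_left := hT.mem_mx_base h h.mem_left
  mem_right := hT.div_mem_mx h
  span z hz := by
    have hx0 := h.ne_zero_left
    obtain ⟨p, q, hq, rfl⟩ := (hT.mem_iff _).1 hz.1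
    have hq0 := h.aeval_ne_zero hq
    have hqi := hT.inv_aeval_mem hq
    have hp : aeval (y / x) p ∈ mx T := by
      have := mul_mem_mx (hT.aeval_mem q) hz
      rwa [mul_div_cancel₀ _ hq0] at this
    obtain ⟨α, hα, β, hβ, e⟩ := h.span _ ((hT.mem_mx_iff h).1 hp)
    refine ⟨(α + β * (y / x)) * (aeval (y / x) q)⁻¹, mul_mem (add_mem (hT.mem_base hα)
      (mul_mem (hT.mem_base hβ) hT.div_mem)) hqi, aeval (y / x) p.divX * (aeval (y / x) q)⁻¹,
      mul_mem (hT.aeval_mem _) hqi, ?_⟩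
    rw [aeval_eq_coeff_zero_add _ p, e]
    field_simp
    ring
  reg a ha b hb e := by
    obtain ⟨p₁, q₁, hq₁, rfl⟩ := (hT.mem_iff _).1 ha
    obtain ⟨p₂, q₂, hq₂, rfl⟩ := (hT.mem_iff _).1 hb
    have hq₁0 := h.aeval_ne_zero hq₁
    have hq₂0 := h.aeval_ne_zero hq₂
    have h1 : aeval (y / x) (X * p₂ * q₁) = x * aeval (y / x) (p₁ * q₂) := by
      rw [map_mul, map_mul, map_mul, aeval_X]
      rw [div_mul_eq_mul_div, div_mul_eq_mul_div, div_eq_div_iff hq₁0 hq₂0] at e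
      linear_combination -e
    have h2 := h.map_residue_eq_zero_of_aeval_eq h1
    rw [Polynomial.map_mul, Polynomial.map_mul, map_X] at h2
    have h3 : p₂.map (residue S.toSubring) = 0 := by
      rcases mul_eq_zero.1 h2 with h3 | h3
      · exact (mul_eq_zero.1 h3).resolve_left X_ne_zero
      · exact absurd (map_residue_eq_zero_iff.1 h3 0) hq₁
    obtain ⟨r, hr⟩ := h.exists_eq_mul_aeval h3
    exact ⟨aeval (y / x) r * (aeval (y / x) q₂)⁻¹, mul_mem (hT.aeval_mem r)
      (hT.inv_aeval_mem hq₂), by rw [hr]; ring⟩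

lemma isPoint (h : IsParams S x y) (hT : IsQT S T x y) (hS : IsPoint S) : IsPoint T where
  noeth := by
    have := hS.noeth
    obtain ⟨T', -, hT', hn⟩ := h.exists_isQT
    rwa [hT.unique hT']
  algClosed := by
    have hle := hT.le h
    have := hS.algClosed
    have hloc := hle.2
    let f := ResidueField.map (Subring.inclusion hle.1)
    have hf : Function.Bijective f := by
      refine ⟨f.injective, fun r => ?_⟩
      obtain ⟨z, rfl⟩ := residue_surjective r
      obtain ⟨s, hs, hzs⟩ := hT.exists_sub_mem_mx h z.2
      refine ⟨residue _ ⟨s, hs⟩, ?_⟩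
      rw [ResidueField.map_residue, eq_comm, ← sub_eq_zero, ← map_sub, residue_eq_zero_iff]
      exact hzs.2
    exact IsAlgClosed.of_ringEquiv _ _ (RingEquiv.ofBijective f hf)
  params := ⟨_, _, hT.isParams h⟩

lemma dvd_of_mem_mpow (h : IsParams S x y) (hT : IsQT S T x y) {n : ℕ} (hz : z ∈ mpow S n) :
    ∃ w ∈ T.toSubring, z = x ^ n * w := by
  obtain ⟨p, -, e⟩ := h.mem_mpow_iff.1 hz
  exact ⟨_, hT.aeval_mem p, e⟩

lemma mem_mpow_of_dvd (h : IsParams S x y) (hT : IsQT S T x y) {n : ℕ} (hz : z ∈ S.toSubring)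
    (hd : ∃ w ∈ T.toSubring, z = x ^ n * w) :
    z ∈ mpow S n := by
  obtain ⟨w, hw, e⟩ := hd
  suffices ∀ l ≤ n, z ∈ mpow S l from this n le_rfl
  intro l hl
  induction l with
  | zero => rw [mpow_zero]; exact hz
  | succ l ih =>
    by_contra hn
    obtain ⟨p, hp, e', hp0⟩ := h.exists_leading (ih (by omega)) hn
    apply hp0
    refine hT.map_residue_eq_zero_of_dvd h ⟨x ^ (n - l - 1) * w,
      mul_mem (pow_mem (hT.mem_base h.mem_left.1) _) hw, ?_⟩
    apply mul_left_cancel₀ (pow_ne_zero l h.ne_zero_left)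
    rw [← e', e]
    have : x ^ n = x ^ l * (x * x ^ (n - l - 1)) := by
      rw [← pow_succ', ← pow_add]; congr 1; omega
    rw [this]; ring

/-- The order at S is the x-adic order in T: an element of exact order l is x ^ l times an element
not divisible by x. Conversely, a fraction in T becomes a quotient of elements of S after
multiplying numerator and denominator by a common power of x. -/
lemma orderRing_eq (h : IsParams S x y) (hT : IsQT S T x y) (hS : IsPoint S) :
    orderRing S = locAt T x := by
  have := hS.noeth
  have hx0 := h.ne_zero_left
  ext z
  constructor
  · rintro ⟨n, a, b, ha, hb, rfl⟩
    have hb0 : (b : K) ≠ 0 := by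
      intro h0
      rw [show b = 0 from Subtype.ext h0] at hb
      exact hb (Ideal.zero_mem _)
    obtain ⟨l, hl, hl'⟩ := exists_notMem_mpow b.2 hb0
    have hln : l ≤ n := by
      by_contra hc
      exact hb (coe_mem_mpow.1 (mpow_anti (by omega) hl))
    obtain ⟨p, hp, e, hp0⟩ := h.exists_leading hl hl'
    obtain ⟨w, hw, e'⟩ := hT.dvd_of_mem_mpow h (mpow_anti hln (coe_mem_mpow.2 ha))
    refine ⟨w, hw, _, hT.aeval_mem p, fun hd => hp0 (hT.map_residue_eq_zero_of_dvd h hd), ?_⟩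
    rw [e, e', mul_div_mul_left _ _ (pow_ne_zero l hx0)]
  · rintro ⟨a, ha, b, hb, hnb, rfl⟩
    obtain ⟨p₁, q₁, hq₁, rfl⟩ := (hT.mem_iff _).1 ha
    obtain ⟨p₂, q₂, hq₂, rfl⟩ := (hT.mem_iff _).1 hb
    have hq₁0 := h.aeval_ne_zero hq₁
    have hq₂0 := h.aeval_ne_zero hq₂
    set N := max (p₁ * q₂).natDegree (p₂ * q₁).natDegree
    have h1 := h.pow_mul_aeval_mem (p₁ * q₂) (le_max_left _ _ : _ ≤ N)
    have h2 := h.pow_mul_aeval_mem (p₂ * q₁) (le_max_right _ _ : _ ≤ N)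
    refine ⟨N, ⟨_, h1.1⟩, ⟨_, h2.1⟩, h1.2, fun hc => hnb ?_, ?_⟩
    · obtain ⟨w, hw, e⟩ := hT.dvd_of_mem_mpow h (coe_mem_mpow.2 hc)
      change x ^ N * aeval (y / x) (p₂ * q₁) = _ at e
      have h3 := hT.map_residue_eq_zero_of_dvd h ⟨w, hw, mul_left_cancel₀ (pow_ne_zero N hx0)
        (e.trans (by rw [pow_succ, mul_assoc]))⟩
      rw [Polynomial.map_mul] at h3
      have h4 := (mul_eq_zero.1 h3).resolve_right fun hc =>
        hq₁ (map_residue_eq_zero_iff.1 hc 0)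
      obtain ⟨r, hr⟩ := h.exists_eq_mul_aeval h4
      exact ⟨aeval (y / x) r * (aeval (y / x) q₂)⁻¹, mul_mem (hT.aeval_mem r)
        (hT.inv_aeval_mem hq₂), by rw [hr]; ring⟩
    · change _ = x ^ N * aeval (y / x) (p₁ * q₂) / (x ^ N * aeval (y / x) (p₂ * q₁))
      rw [mul_div_mul_left _ _ (pow_ne_zero N hx0), map_mul, map_mul, div_div_div_eq,
        mul_comm (aeval (y / x) q₁)]

/-- A local ring dominating `S` and containing `y / x` in its maximal ideal dominates
`S[y/x]` localized at `(x, y/x)`. -/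
lemma le_of_div_mem_mx (h : IsParams S x y) (hT : IsQT S T x y) {U : LocalSubring K} (hSU : S ≤ U)
    (hd : y / x ∈ mx U) : T ≤ U := by
  have hal : ∀ p : S.toSubring[X], aeval (y / x) p ∈ U.toSubring := by
    intro p
    rw [aeval_eq_sum_range]
    refine sum_mem fun i _ => ?_
    rw [Algebra.smul_def]
    exact mul_mem (mem_of_le hSU (p.coeff i).2) (pow_mem hd.1 _)
  have hmx : ∀ p : S.toSubring[X], aeval (y / x) p ∈ mx U ↔ (p.coeff 0 : K) ∈ mx S := by
    intro p
    have e := aeval_eq_coeff_zero_add (y / x) p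
    constructor
    · intro hp
      refine mem_mx_of_le hSU (p.coeff 0).2 ?_
      have := sub_mem_mx hp (mul_mem_mx' hd (hal p.divX))
      rwa [e, add_sub_cancel_left] at this
    · intro hp
      rw [e]
      exact add_mem_mx (mul_mem_mx' hd (hal _)) (mx_of_le hSU hp)
  rw [le_iff_mx]
  refine ⟨fun z hz => ?_, fun z hz => ?_⟩
  · obtain ⟨p, q, hq, rfl⟩ := (hT.mem_iff _).1 hz
    rw [div_eq_mul_inv]
    exact mul_mem (hal p) (inv_mem_of_notMem_mx (hal q) fun hc => hq ((hmx q).1 hc))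
  · obtain ⟨p, q, hq, e⟩ := (hT.mem_iff _).1 hz.1
    have hq0 := h.aeval_ne_zero hq
    have hp : aeval (y / x) p ∈ mx T := by
      have := mul_mem_mx (hT.aeval_mem q) hz
      rwa [e, mul_div_cancel₀ _ hq0] at this
    rw [e, div_eq_mul_inv]
    exact mul_mem_mx' ((hmx p).2 ((hT.mem_mx_iff h).1 hp))
      (inv_mem_of_notMem_mx (hal q) fun hc => hq ((hmx q).1 hc))

/-- A local ring dominates at most one quadratic transform of `S`. -/
lemma le_of_le {x' y' : K} {T' U : LocalSubring K} (h : IsParams S x y) (hT : IsQT S T x y)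
    (h' : IsParams S x' y') (hT' : IsQT S T' x' y') (hU : T ≤ U) (hU' : T' ≤ U) : T' ≤ T := by
  have hx0 := h.ne_zero_left
  have hx0' := h'.ne_zero_left
  have hdiv : ∀ s ∈ mx S, s / x ∈ T.toSubring := by
    intro s hs
    obtain ⟨a, ha, b, hb, e⟩ := h.span s hs
    have : s / x = a + b * (y / x) := by rw [e]; field_simp
    rw [this]
    exact add_mem (hT.mem_base ha) (mul_mem (hT.mem_base hb) hT.div_mem)
  have hdiv' : ∀ s ∈ mx S, s / x' ∈ T'.toSubring := by
    intro s hs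
    obtain ⟨a, ha, b, hb, e⟩ := h'.span s hs
    have : s / x' = a + b * (y' / x') := by rw [e]; field_simp
    rw [this]
    exact add_mem (hT'.mem_base ha) (mul_mem (hT'.mem_base hb) hT'.div_mem)
  -- x/x' lies in T', hence in U, so x'/x cannot be a nonunit there.
  have hu : x' / x ∉ mx T := by
    intro hc
    have := mul_mem_mx' (mx_of_le hU hc) (mem_of_le hU' (hdiv' x h.mem_left))
    rw [div_mul_div_cancel₀ hx0, div_self hx0'] at this
    exact one_notMem_mx this
  have hinv := inv_mem_of_notMem_mx (hdiv x' h'.mem_left) hu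
  refine hT'.le_of_div_mem_mx h' (hT.le h) (mem_mx_of_le hU ?_
    (mx_of_le hU' (hT'.div_mem_mx h')))
  have : y' / x' = y' / x * (x' / x)⁻¹ := by field_simp
  rw [this]
  exact mul_mem (hdiv y' h'.mem_right) hinv

end IsQT

/-! ### The tree of infinitely near points. -/

section Quadratic

variable {S T T' U : LocalSubring K}

lemma IsQuadraticTransform.isPoint (hS : IsPoint S) (h : IsQuadraticTransform S T) :
    IsPoint T := by
  obtain ⟨x, y, hp, hq⟩ := exists_isQT_of_isQuadraticTransform hS h
  exact hq.isPoint hp hS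

lemma IsQuadraticTransform.le (hS : IsPoint S) (h : IsQuadraticTransform S T) : S ≤ T := by
  obtain ⟨x, y, hp, hq⟩ := exists_isQT_of_isQuadraticTransform hS h
  exact hq.le hp

lemma IsQuadraticTransform.ne (hS : IsPoint S) (h : IsQuadraticTransform S T) : S ≠ T := by
  rintro rfl
  obtain ⟨x, y, hp, hq⟩ := exists_isQT_of_isQuadraticTransform hS h
  have h1 := hp.pow_mul_unit_ne 1 (one_mem _) one_notMem_mx hq.div_mem
  apply h1
  rw [pow_one, mul_one, mul_div_cancel₀ _ hp.ne_zero_left]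

lemma IsQuadraticTransform.eq_of_le (hS : IsPoint S) (h : IsQuadraticTransform S T)
    (h' : IsQuadraticTransform S T') (hU : T ≤ U) (hU' : T' ≤ U) : T = T' := by
  obtain ⟨x, y, hp, hq⟩ := exists_isQT_of_isQuadraticTransform hS h
  obtain ⟨x', y', hp', hq'⟩ := exists_isQT_of_isQuadraticTransform hS h'
  exact le_antisymm (hq'.le_of_le hp' hp hq hU' hU) (hq.le_of_le hp hp' hq' hU hU')

lemma IsInfNear.isPoint_and_le (hS : IsPoint S) (h : IsInfNear S T) : IsPoint T ∧ S ≤ T := by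
  induction h with
  | refl => exact ⟨hS, le_rfl⟩
  | tail _ h ih => exact ⟨h.isPoint ih.1, ih.2.trans (h.le ih.1)⟩

lemma IsInfNear.isPoint (hS : IsPoint S) (h : IsInfNear S T) : IsPoint T :=
  (h.isPoint_and_le hS).1

lemma IsInfNear.le (hS : IsPoint S) (h : IsInfNear S T) : S ≤ T := (h.isPoint_and_le hS).2

lemma IsStrictlyInfNear.lt (hS : IsPoint S) (h : IsStrictlyInfNear S T) : S < T := by
  obtain ⟨U, hSU, hUT⟩ := Relation.TransGen.head'_iff.1 h
  have h1 := lt_of_le_of_ne (hSU.le hS) (hSU.ne hS)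
  exact h1.trans_le (IsInfNear.le (hSU.isPoint hS) hUT)

lemma IsInfNear.eq_or (h : IsInfNear S T) : S = T ∨ IsStrictlyInfNear S T := by
  rcases Relation.reflTransGen_iff_eq_or_transGen.1 h with h | h
  · exact Or.inl h.symm
  · exact Or.inr h

/-- The points below a given point form a chain. -/
lemma IsInfNear.total (hS : IsPoint S) (h : IsInfNear S T) (h' : IsInfNear S T')
    (hU : T ≤ U) (hU' : T' ≤ U) : IsInfNear T T' ∨ IsInfNear T' T := by
  induction h using Relation.ReflTransGen.head_induction_on with
  | refl => exact Or.inl h'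
  | head hab hbT ih =>
    rcases Relation.ReflTransGen.cases_head h' with rfl | ⟨c, hac, hcT⟩
    · exact Or.inr (Relation.ReflTransGen.head hab hbT)
    · have hb := hab.isPoint hS
      have hc := hac.isPoint hS
      obtain rfl := hab.eq_of_le hS hac ((IsInfNear.le hb hbT).trans hU)
        ((IsInfNear.le hc hcT).trans hU')
      exact ih hb hcT

/-- The points strictly below a quadratic transform of `T` are those below `T`. -/
lemma IsStrictlyInfNear.isInfNear_of_isQuadraticTransform {R₀ : LocalSubring K} (hR : IsPoint R₀)
    (hS : IsInfNear R₀ S) (hT : IsInfNear R₀ T) (h : IsStrictlyInfNear S U)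
    (hTU : IsQuadraticTransform T U) : IsInfNear S T := by
  have hSp := hS.isPoint hR
  have hTp := hT.isPoint hR
  rcases hS.total hR hT (h.lt hSp).le (hTU.le hTp) with h1 | h1
  · exact h1
  · rcases h1.eq_or with rfl | h2
    · exact Relation.ReflTransGen.refl
    · exfalso
      -- If S were strictly over T, the first point V on the way to S would be dominated by U, hence
      -- equal to U, although S is strictly below U.
      obtain ⟨V, hTV, hVS⟩ := Relation.TransGen.head'_iff.1 h2
      have hVp := hTV.isPoint hTp
      have hVS' := IsInfNear.le hVp hVS
      obtain rfl := hTV.eq_of_le hTp hTU (hVS'.trans (h.lt hSp).le) le_rfl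
      exact absurd (h.lt hSp) (not_lt_of_ge hVS')

end Quadratic

end ExcTree

/-! ### Equations of exceptional curves and proximity. -/

namespace ExcTree

open IsLocalRing Polynomial

variable {K : Type*} [Field K]

lemma IsParams.left_mem_locAt {T : LocalSubring K} {u v z : K} (h : IsParams T u v)
    (hz : z ∈ T.toSubring) : z ∈ locAt T u :=
  ⟨z, hz, 1, one_mem _, fun ⟨w, hw, e⟩ =>
    h.pow_mul_unit_ne 0 (one_mem _) one_notMem_mx hw (by simpa using e), by simp⟩

lemma IsParams.div_notMem_locAt {T : LocalSubring K} {u v : K} (h : IsParams T u v) :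
    v / u ∉ locAt T u := by
  rintro ⟨a, ha, b, hb, hn, e⟩
  have hb0 : b ≠ 0 := by
    rintro rfl
    exact hn ⟨0, zero_mem _, by simp⟩
  have hu0 := h.ne_zero_left
  obtain ⟨c, hc, e'⟩ := h.reg a ha b hb (by
    rw [div_eq_div_iff hu0 hb0] at e
    linear_combination -e)
  exact hn ⟨c, hc, by rw [e', mul_comm]⟩

lemma IsParams.inv_notMem_locAt {T : LocalSubring K} {u v : K} (h : IsParams T u v) :
    u⁻¹ ∉ locAt T u := by
  rintro ⟨a, ha, b, hb, hn, e⟩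
  have hb0 : b ≠ 0 := by
    rintro rfl
    exact hn ⟨0, zero_mem _, by simp⟩
  have hu0 := h.ne_zero_left
  refine hn ⟨a, ha, ?_⟩
  field_simp at e
  exact e

/-- Two parameters that define the same curve differ by a unit factor. -/
lemma IsParams.dvd_of_locAt_eq {T : LocalSubring K} {u v u' : K} (h : IsParams T u v)
    (e : locAt T u = locAt T u') : ∃ w ∈ T.toSubring, u = u' * w := by
  by_contra hn
  apply h.inv_notMem_locAt
  rw [e]
  exact ⟨1, one_mem _, u, h.mem_left.1, hn, by simp⟩

section Next

variable {T T' : LocalSubring K} {u v z : K}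

/-- Modulo u, z is v ^ m times a unit. This shape survives modulo u/v in T', where v is still a
parameter. -/
lemma IsQT.not_dvd (hTp : IsPoint T) (h : IsParams T u v) (hT : IsQT T T' v u)
    (hz : z ∈ T.toSubring) (hn : ¬ ∃ w ∈ T.toSubring, z = u * w) :
    ¬ ∃ w ∈ T'.toSubring, z = u / v * w := by
  have := hTp.noeth
  rintro ⟨w', hw', e'⟩
  obtain ⟨m, c, hc, w, hw, hwm, e⟩ := h.exists_eq_add_pow_mul hz hn
  have hv0 := h.ne_zero_right
  have hle := hT.le h.symm
  refine (hT.isParams h.symm).symm.pow_mul_unit_ne m (mem_of_le hle hw)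
    (notMem_mx_of_le hle hw hwm) (c := w' - v * c)
    (sub_mem hw' (mul_mem (mem_of_le hle h.mem_right.1) (mem_of_le hle hc))) ?_
  rw [mul_sub, ← e', e]
  field_simp
  ring

/-- Blowing up a point of a curve leaves its generic point alone. A common power of v clears the
denominators, and u/v, being prime to v, does not notice it. -/
lemma IsQT.locAt_eq (hTp : IsPoint T) (h : IsParams T u v) (hT : IsQT T T' v u) :
    locAt T' (u / v) = locAt T u := by
  have hle := hT.le h.symm
  have hv0 := h.ne_zero_right
  have hpar := (hT.isParams h.symm).symm
  ext z
  constructor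
  · rintro ⟨a, ha, b, hb, hn, rfl⟩
    obtain ⟨p₁, q₁, hq₁, rfl⟩ := (hT.mem_iff _).1 ha
    obtain ⟨p₂, q₂, hq₂, rfl⟩ := (hT.mem_iff _).1 hb
    have hq₁0 := h.symm.aeval_ne_zero hq₁
    have hq₂0 := h.symm.aeval_ne_zero hq₂
    set N := max (p₁ * q₂).natDegree (p₂ * q₁).natDegree with hN
    have h1 := (h.symm.pow_mul_aeval_mem (p₁ * q₂) (le_max_left _ _ : _ ≤ N)).1
    have h2 := (h.symm.pow_mul_aeval_mem (p₂ * q₁) (le_max_right _ _ : _ ≤ N)).1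
    refine ⟨_, h1, _, h2, ?_, ?_⟩
    · rintro ⟨w, hw, e⟩
      apply hn
      obtain ⟨w', hw', e'⟩ := hpar.dvd_of_dvd_pow_mul N (hT.aeval_mem (p₂ * q₁))
        ⟨v * w, mul_mem (mem_of_le hle h.mem_right.1) (mem_of_le hle hw), by
          rw [e]; field_simp⟩
      refine ⟨w' * ((aeval (u / v) q₁)⁻¹ * (aeval (u / v) q₂)⁻¹), mul_mem hw' (mul_mem
        (hT.inv_aeval_mem hq₁) (hT.inv_aeval_mem hq₂)), ?_⟩
      rw [← mul_assoc, ← e', map_mul]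
      field_simp
    · rw [mul_div_mul_left _ _ (pow_ne_zero N hv0), map_mul, map_mul, div_div_div_eq,
        mul_comm (aeval (u / v) q₁)]
  · rintro ⟨a, ha, b, hb, hn, rfl⟩
    exact ⟨a, mem_of_le hle ha, b, mem_of_le hle hb, hT.not_dvd hTp h hb hn, rfl⟩

/-- In T' the quotients u/x and v/x have constant parts α and α'. If α were a unit, v/u would lie in
the ring of the generic point of u = 0, which it does not. Then α' is a unit, as u and v generate x,
so u/v vanishes at T'. -/
lemma isQT_of_subset_locAt (hTp : IsPoint T) (h : IsParams T u v)
    (hq : IsQuadraticTransform T T') (hsub : (T'.toSubring : Set K) ⊆ locAt T u) :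
    IsQT T T' v u := by
  have := hTp.noeth
  obtain ⟨x, y, hxy, hT'⟩ := exists_isQT_of_isQuadraticTransform hTp hq
  have hx0 := hxy.ne_zero_left
  have hu0 := h.ne_zero_left
  have hv0 := h.ne_zero_right
  have hle := hT'.le hxy
  obtain ⟨α, hα, β, hβ, eu⟩ := hxy.span u h.mem_left
  obtain ⟨α', hα', β', hβ', ev⟩ := hxy.span v h.mem_right
  have hu : u / x = α + β * (y / x) := by rw [eu]; field_simp
  have hv : v / x = α' + β' * (y / x) := by rw [ev]; field_simp
  have hyx := hT'.div_mem_mx hxy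
  have hβy := mul_mem_mx (mem_of_le hle hβ) hyx
  have hβy' := mul_mem_mx (mem_of_le hle hβ') hyx
  have hux : u / x ∈ T'.toSubring := hu ▸ add_mem (mem_of_le hle hα) hβy.1
  have hvx : v / x ∈ T'.toSubring := hv ▸ add_mem (mem_of_le hle hα') hβy'.1
  have hαm : α ∈ mx T := by
    by_contra hαm
    have hun : u / x ∉ mx T' := by
      intro hc
      apply notMem_mx_of_le hle hα hαm
      have := sub_mem_mx hc hβy
      rwa [hu, add_sub_cancel_right] at this
    have hi := inv_mem_of_notMem_mx hux hun
    apply h.div_notMem_locAt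
    apply hsub
    have : v / u = v / x * (u / x)⁻¹ := by field_simp
    rw [this]
    exact mul_mem hvx hi
  have hαm' : α' ∉ mx T := by
    intro hαm'
    obtain ⟨a, ha, b, hb, e⟩ := h.span x hxy.mem_left
    have hmem : a * α + b * α' ∈ mx T := add_mem_mx (mul_mem_mx ha hαm) (mul_mem_mx hb hαm')
    refine hxy.symm.pow_mul_unit_ne 1 (w := 1 - (a * α + b * α')) (c := a * β + b * β')
      (sub_mem (one_mem _) hmem.1) ?_ (add_mem (mul_mem ha hβ) (mul_mem hb hβ')) ?_
    · intro hc
      apply one_notMem_mx (S := T)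
      have := add_mem_mx hc hmem
      rwa [sub_add_cancel] at this
    · rw [eu, ev] at e
      linear_combination e
  have hvn : v / x ∉ mx T' := by
    intro hc
    apply notMem_mx_of_le hle hα' hαm'
    have := sub_mem_mx hc hβy'
    rwa [hv, add_sub_cancel_right] at this
  have hum : u / x ∈ mx T' := hu ▸ add_mem_mx (mx_of_le hle hαm) hβy
  have huv : u / v ∈ mx T' := by
    have : u / v = u / x * (v / x)⁻¹ := by field_simp
    rw [this]
    exact mul_mem_mx' hum (inv_mem_of_notMem_mx hvx hvn)
  obtain ⟨T₀, hq₀, hT₀, -⟩ := h.symm.exists_isQT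
  obtain rfl := hq₀.eq_of_le hTp hq (hT₀.le_of_div_mem_mx h.symm hle huv) le_rfl
  exact hT₀

end Next

/-- `T` lies on the exceptional curve of the blowup of `γ`, and `u` is a local equation of this
curve at `T`, part of the system of parameters `u, v`. -/
structure OnCurve (γ T : LocalSubring K) (u v : K) : Prop where
  params : IsParams T u v
  le : γ ≤ T
  orderRing_eq : orderRing γ = locAt T u
  mem_mpow_iff : ∀ (n : ℕ), ∀ z ∈ γ.toSubring, z ∈ mpow γ n ↔ ∃ w ∈ T.toSubring, z = u ^ n * w

namespace OnCurve

variable {γ T T' : LocalSubring K} {u v x y : K}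

lemma of_isQT (hγ : IsPoint γ) (h : IsParams γ x y) (hT : IsQT γ T x y) :
    OnCurve γ T x (y / x) where
  params := hT.isParams h
  le := hT.le h
  orderRing_eq := hT.orderRing_eq h hγ
  mem_mpow_iff _ _ hz := ⟨hT.dvd_of_mem_mpow h, hT.mem_mpow_of_dvd h hz⟩

lemma subset (h : OnCurve γ T u v) : (T.toSubring : Set K) ⊆ orderRing γ := by
  rw [h.orderRing_eq]
  exact fun z hz => h.params.left_mem_locAt hz

lemma next (hTp : IsPoint T) (h : OnCurve γ T u v) (hT : IsQT T T' v u) :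
    OnCurve γ T' (u / v) v where
  params := (hT.isParams h.params.symm).symm
  le := h.le.trans (hT.le h.params.symm)
  orderRing_eq := by rw [h.orderRing_eq, hT.locAt_eq hTp h.params]
  mem_mpow_iff n z hz := by
    have hv0 := h.params.ne_zero_right
    have hu0 := h.params.ne_zero_left
    have hle := hT.le h.params.symm
    have hvT := mem_of_le hle h.params.mem_right.1
    rw [h.mem_mpow_iff n z hz]
    constructor
    · rintro ⟨w, hw, rfl⟩
      exact ⟨v ^ n * w, mul_mem (pow_mem hvT n) (mem_of_le hle hw), by
        rw [div_pow]; field_simp⟩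
    · rintro ⟨w', hw', e⟩
      -- The factors u are split off one at a time: if u does not divide w in T, then u/v does not
      -- divide w in T'.
      suffices ∀ l ≤ n, ∃ w ∈ T.toSubring, z = u ^ l * w from this n le_rfl
      intro l hl
      induction l with
      | zero => exact ⟨z, mem_of_le h.le hz, by simp⟩
      | succ l ih =>
        obtain ⟨w, hw, ew⟩ := ih (by omega)
        by_contra hn
        have hnw : ¬ ∃ w₁ ∈ T.toSubring, w = u * w₁ := by
          rintro ⟨w₁, hw₁, rfl⟩
          exact hn ⟨w₁, hw₁, by rw [ew, pow_succ, mul_assoc]⟩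
        refine hT.not_dvd hTp h.params hw hnw ?_
        refine (hT.isParams h.params.symm).symm.dvd_of_dvd_pow_mul l (mem_of_le hle hw)
          ⟨(u / v) ^ (n - l - 1) * w', mul_mem (pow_mem hT.div_mem _) hw', ?_⟩
        have e1 : (u / v) ^ n = (u / v) ^ l * (u / v * (u / v) ^ (n - l - 1)) := by
          rw [← pow_succ', ← pow_add]; congr 1; omega
        rw [ew, e1] at e
        apply mul_left_cancel₀ (pow_ne_zero l (div_ne_zero hu0 hv0))
        rw [← mul_assoc, ← mul_pow, div_mul_cancel₀ _ hv0, e]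
        ring

lemma exists_next (hTp : IsPoint T) (h : OnCurve γ T u v) :
    ∃ T', IsQuadraticTransform T T' ∧ IsQT T T' v u := by
  have := hTp.noeth
  obtain ⟨T', hq, hT', -⟩ := h.params.symm.exists_isQT
  exact ⟨T', hq, hT'⟩

lemma isQT (hTp : IsPoint T) (h : OnCurve γ T u v) (hq : IsQuadraticTransform T T')
    (hsub : (T'.toSubring : Set K) ⊆ orderRing γ) : IsQT T T' v u :=
  isQT_of_subset_locAt hTp h.params hq (h.orderRing_eq ▸ hsub)

end OnCurve

section Proximity

variable {R₀ γ μ ν T T' : LocalSubring K}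

/-- Containment in the valuation ring is inherited by every intermediate point, and at each blowup
it forces the next point to be the one on the strict transform. The equation is followed along this
chain. -/
lemma LiesOnStrictTransform.exists_onCurve (hγ : IsPoint γ) (h : LiesOnStrictTransform T γ) :
    ∃ u v, OnCurve γ T u v := by
  obtain ⟨h, hsub⟩ := h
  induction h with
  | single h =>
    obtain ⟨x, y, hp, hq⟩ := exists_isQT_of_isQuadraticTransform hγ h
    exact ⟨_, _, OnCurve.of_isQT hγ hp hq⟩
  | @tail b c hb hbc ih =>
    have hbp := IsInfNear.isPoint hγ hb.to_reflTransGen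
    obtain ⟨u, v, huv⟩ := ih (fun z hz => hsub (mem_of_le (hbc.le hbp) hz))
    exact ⟨_, _, huv.next hbp (huv.isQT hbp hbc hsub)⟩

lemma IsQuadraticTransform.liesOnStrictTransform (hγ : IsPoint γ)
    (h : IsQuadraticTransform γ T) : LiesOnStrictTransform T γ := by
  obtain ⟨x, y, hp, hq⟩ := exists_isQT_of_isQuadraticTransform hγ h
  exact ⟨Relation.TransGen.single h, (OnCurve.of_isQT hγ hp hq).subset⟩

/-- The point following `T` on an exceptional curve through `T`. -/
lemma LiesOnStrictTransform.exists_next (hγ : IsPoint γ) (h : LiesOnStrictTransform T γ) :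
    ∃ T', IsQuadraticTransform T T' ∧ LiesOnStrictTransform T' γ := by
  obtain ⟨u, v, huv⟩ := h.exists_onCurve hγ
  have hTp := IsInfNear.isPoint hγ h.1.to_reflTransGen
  obtain ⟨T', hq, hT'⟩ := huv.exists_next hTp
  exact ⟨T', hq, Relation.TransGen.tail h.1 hq, (huv.next hTp hT').subset⟩

lemma LiesOnStrictTransform.next_unique (hγ : IsPoint γ) (h : LiesOnStrictTransform T γ)
    {T₁ T₂ : LocalSubring K} (h₁ : IsQuadraticTransform T T₁) (h₂ : IsQuadraticTransform T T₂)
    (h₁' : (T₁.toSubring : Set K) ⊆ orderRing γ) (h₂' : (T₂.toSubring : Set K) ⊆ orderRing γ) :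
    T₁ = T₂ := by
  obtain ⟨u, v, huv⟩ := h.exists_onCurve hγ
  have hTp := IsInfNear.isPoint hγ h.1.to_reflTransGen
  exact (huv.isQT hTp h₁ h₁').unique (huv.isQT hTp h₂ h₂')

lemma LiesOnStrictTransform.of_le (h : LiesOnStrictTransform T γ)
    (hγμ : IsStrictlyInfNear γ μ) (hle : μ ≤ T) : LiesOnStrictTransform μ γ :=
  ⟨hγμ, fun _ hz => h.2 (mem_of_le hle hz)⟩

/-- At the point following `μ` on the exceptional curve of `ν`, there are parameters that define
the two exceptional curves of `ν` and `μ`. -/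
lemma LiesOnStrictTransform.exists_onCurve_onCurve (hν : IsPoint ν)
    (hμν : LiesOnStrictTransform μ ν) (hq : IsQuadraticTransform μ T)
    (hT : (T.toSubring : Set K) ⊆ orderRing ν) :
    ∃ u v, OnCurve ν T u v ∧ OnCurve μ T v u := by
  obtain ⟨u, v, huv⟩ := hμν.exists_onCurve hν
  have hμ := IsInfNear.isPoint hν hμν.1.to_reflTransGen
  have hT' := huv.isQT hμ hq hT
  exact ⟨_, _, huv.next hμ hT', OnCurve.of_isQT hμ huv.params.symm hT'⟩

/-- A point on the exceptional curves of `ν` and of a point `μ` on the exceptional curve of `ν`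
is a quadratic transform of `μ`. -/
lemma LiesOnStrictTransform.isQuadraticTransform (hν : IsPoint ν)
    (hμν : LiesOnStrictTransform μ ν) (hTμ : LiesOnStrictTransform T μ)
    (hTν : LiesOnStrictTransform T ν) : IsQuadraticTransform μ T := by
  have hμ := IsInfNear.isPoint hν hμν.1.to_reflTransGen
  obtain ⟨T₂, hq, h2⟩ := Relation.TransGen.head'_iff.1 hTμ.1
  have hT₂ := hq.isPoint hμ
  have hle2 := IsInfNear.le hT₂ h2
  obtain ⟨u, v, hν', hμ'⟩ := hμν.exists_onCurve_onCurve hν hq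
    (fun z hz => hTν.2 (mem_of_le hle2 hz))
  rcases IsInfNear.eq_or h2 with rfl | h3
  · exact hq
  · exfalso
    obtain ⟨T₃, hq3, h3⟩ := Relation.TransGen.head'_iff.1 h3
    have hle3 := IsInfNear.le (hq3.isPoint hT₂) h3
    -- Blowing up T₂ separates the two transversal curves: at T₃ both u/v and v/u would be nonunits.
    have e1 := hν'.isQT hT₂ hq3 (fun z hz => hTν.2 (mem_of_le hle3 hz))
    have e2 := hμ'.isQT hT₂ hq3 (fun z hz => hTμ.2 (mem_of_le hle3 hz))
    have := mul_mem_mx (e1.div_mem_mx hν'.params.symm).1 (e2.div_mem_mx hμ'.params.symm)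
    rw [div_mul_div_cancel₀ hν'.params.ne_zero_right, div_self hν'.params.ne_zero_left] at this
    exact one_notMem_mx this

lemma LiesOnStrictTransform.eq_of_both (hν : IsPoint ν) (hμν : LiesOnStrictTransform μ ν)
    (hTμ : LiesOnStrictTransform T μ) (hTν : LiesOnStrictTransform T ν)
    (hTμ' : LiesOnStrictTransform T' μ) (hTν' : LiesOnStrictTransform T' ν) : T = T' :=
  hμν.next_unique hν (hμν.isQuadraticTransform hν hTμ hTν) (hμν.isQuadraticTransform hν hTμ' hTν')
    hTν.2 hTν'.2

/-- The points below T form a chain. The later of the two has its ring inside that of T, hence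
inside the valuation ring of the earlier. -/
lemma LiesOnStrictTransform.or_of_ne (hR : IsPoint R₀) (hμ : IsInfNear R₀ μ)
    (hν : IsInfNear R₀ ν) (hne : μ ≠ ν) (hTμ : LiesOnStrictTransform T μ)
    (hTν : LiesOnStrictTransform T ν) :
    LiesOnStrictTransform μ ν ∨ LiesOnStrictTransform ν μ := by
  have hμp := hμ.isPoint hR
  have hνp := hν.isPoint hR
  have h1 := (hTμ.1.lt hμp).le
  have h2 := (hTν.1.lt hνp).le
  rcases hμ.total hR hν h1 h2 with h | h
  · exact Or.inr (hTμ.of_le (h.eq_or.resolve_left hne) h2)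
  · exact Or.inl (hTν.of_le (h.eq_or.resolve_left hne.symm) h1)

lemma LiesOnStrictTransform.not_symm (hν : IsPoint ν) (h : LiesOnStrictTransform μ ν) :
    ¬ LiesOnStrictTransform ν μ := fun h' =>
  lt_asymm (h.1.lt hν) (h'.1.lt (IsInfNear.isPoint hν h.1.to_reflTransGen))

lemma LiesOnStrictTransform.ne (hν : IsPoint ν) (h : LiesOnStrictTransform μ ν) : μ ≠ ν :=
  (h.1.lt hν).ne'

/-- A quadratic transform of `p` lies on the exceptional curve of `p` and on at most one further
exceptional curve. -/
lemma IsQuadraticTransform.proximate_cases (hR : IsPoint R₀) {p : LocalSubring K}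
    (hp : IsInfNear R₀ p) (hq : IsQuadraticTransform p T) :
    (∀ τ, IsInfNear R₀ τ → LiesOnStrictTransform T τ → τ = p) ∨
    ∃ σ, IsInfNear R₀ σ ∧ σ ≠ p ∧ LiesOnStrictTransform p σ ∧ LiesOnStrictTransform T σ ∧
      ∀ τ, IsInfNear R₀ τ → LiesOnStrictTransform T τ → τ = p ∨ τ = σ := by
  have hpp := hp.isPoint hR
  have hprox : ∀ τ, IsInfNear R₀ τ → τ ≠ p → LiesOnStrictTransform T τ →
      LiesOnStrictTransform p τ := by
    intro τ hτ hne h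
    have := IsStrictlyInfNear.isInfNear_of_isQuadraticTransform hR hτ hp h.1 hq
    exact h.of_le (this.eq_or.resolve_left hne) (hq.le hpp)
  by_cases hex : ∃ σ, IsInfNear R₀ σ ∧ σ ≠ p ∧ LiesOnStrictTransform T σ
  · right
    obtain ⟨σ, hσ, hne, hTσ⟩ := hex
    refine ⟨σ, hσ, hne, hprox σ hσ hne hTσ, hTσ, fun τ hτ hTτ => ?_⟩
    -- The curves of τ and σ would meet at both p and T, but two exceptional curves have at most one
    -- common point among those over the later of their centres.
    by_contra! hc
    have h1 := hprox σ hσ hne hTσ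
    have h2 := hprox τ hτ hc.1 hTτ
    rcases LiesOnStrictTransform.or_of_ne hR hτ hσ hc.2 hTτ hTσ with h | h
    · exact hq.ne hpp (h.eq_of_both (hσ.isPoint hR) h2 h1 hTτ hTσ)
    · exact hq.ne hpp (h.eq_of_both (hτ.isPoint hR) h1 h2 hTσ hTτ)
  · left
    intro τ hτ hTτ
    by_contra hne
    exact hex ⟨τ, hτ, hne, hTτ⟩

end Proximity

end ExcTree

/-! ### Orders of elements and intersection multiplicities with an exceptional curve. -/

namespace ExcTree

open IsLocalRing Polynomial

variable {K : Type*} [Field K]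

open Classical in
/-- The order of an element of a local ring with respect to the maximal ideal. -/
noncomputable def ordAt (T : LocalSubring K) (z : K) : ℕ :=
  if h : ∃ n, z ∈ mpow T n ∧ z ∉ mpow T (n + 1) then h.choose else 0

lemma ordAt_spec {T : LocalSubring K} (hT : IsPoint T) {z : K} (hz : z ∈ T.toSubring)
    (h0 : z ≠ 0) : z ∈ mpow T (ordAt T z) ∧ z ∉ mpow T (ordAt T z + 1) := by
  have := hT.noeth
  have h := exists_notMem_mpow hz h0
  rw [ordAt, dif_pos h]
  exact h.choose_spec

lemma eq_of_mem_mpow {T : LocalSubring K} {z : K} {m n : ℕ} (hm : z ∈ mpow T m)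
    (hm' : z ∉ mpow T (m + 1)) (hn : z ∈ mpow T n) (hn' : z ∉ mpow T (n + 1)) : m = n := by
  rcases lt_trichotomy m n with h | h | h
  · exact absurd (mpow_anti h hn) hm'
  · exact h
  · exact absurd (mpow_anti h hm) hn'

lemma ordAt_eq {T : LocalSubring K} {z : K} {n : ℕ} (hn : z ∈ mpow T n)
    (hn' : z ∉ mpow T (n + 1)) : ordAt T z = n := by
  have h : ∃ n, z ∈ mpow T n ∧ z ∉ mpow T (n + 1) := ⟨n, hn, hn'⟩
  rw [ordAt, dif_pos h]
  exact eq_of_mem_mpow h.choose_spec.1 h.choose_spec.2 hn hn'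

lemma le_ordAt {T : LocalSubring K} (hT : IsPoint T) {z : K} {n : ℕ} (h0 : z ≠ 0)
    (hn : z ∈ mpow T n) : n ≤ ordAt T z := by
  by_contra hc
  exact (ordAt_spec hT hn.1 h0).2 (mpow_anti (by omega) hn)

/-- The residual part of `a` along the exceptional curve of `γ` has intersection multiplicity `J`
with this curve at `T`. -/
def HasMult (γ T : LocalSubring K) (a : K) (J : ℕ) : Prop :=
  ∃ u v, OnCurve γ T u v ∧ ∃ c ∈ T.toSubring, ∃ w ∈ T.toSubring, w ∉ mx T ∧
    a = u ^ ordAt γ a * (u * c + v ^ J * w)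

section HasMult

variable {R₀ γ σ T T' : LocalSubring K} {u v a : K} {J : ℕ}

lemma OnCurve.exists_eq (hγ : IsPoint γ) (hT : IsPoint T) (h : OnCurve γ T u v)
    (ha : a ∈ γ.toSubring) (h0 : a ≠ 0) :
    ∃ (J : ℕ), ∃ c ∈ T.toSubring, ∃ w ∈ T.toSubring, w ∉ mx T ∧
      a = u ^ ordAt γ a * (u * c + v ^ J * w) := by
  have := hT.noeth
  obtain ⟨h1, h2⟩ := ordAt_spec hγ ha h0
  obtain ⟨b, hb, e⟩ := (h.mem_mpow_iff _ a ha).1 h1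
  obtain ⟨m, c, hc, w, hw, hwm, e'⟩ := h.params.exists_eq_add_pow_mul hb (by
    rintro ⟨w, hw, e'⟩
    apply h2
    rw [h.mem_mpow_iff _ a ha]
    exact ⟨w, hw, by rw [pow_succ, mul_assoc, ← e', ← e]⟩)
  exact ⟨m, c, hc, w, hw, hwm, by rw [← e', ← e]⟩

/-- The multiplicity does not depend on the choice of the parameters. -/
lemma HasMult.eq_of_onCurve (hJ : HasMult γ T a J) (h : OnCurve γ T u v) {J' : ℕ} {c w : K}
    (hc : c ∈ T.toSubring) (hw : w ∈ T.toSubring) (hwm : w ∉ mx T)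
    (e : a = u ^ ordAt γ a * (u * c + v ^ J' * w)) : J = J' := by
  obtain ⟨u', v', h', c', hc', w', hw', hwm', e'⟩ := hJ
  have hloc : locAt T u = locAt T u' := by rw [← h.orderRing_eq, ← h'.orderRing_eq]
  obtain ⟨ε, hε, eε⟩ := h.params.dvd_of_locAt_eq hloc
  obtain ⟨δ, hδ, eδ⟩ := h'.params.dvd_of_locAt_eq hloc.symm
  have hu0 := h.params.ne_zero_left
  have hεδ : ε * δ = 1 := by
    apply mul_left_cancel₀ h'.params.ne_zero_left
    rw [← mul_assoc, ← eε, ← eδ, mul_one]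
  have hεm : ε ∉ mx T := fun hm => one_notMem_mx (hεδ ▸ mul_mem_mx' hm hδ)
  -- Modulo the curve, v is β times v' with β a unit, so both expressions measure order in the same
  -- discrete valuation ring.
  obtain ⟨α, hα, β, hβ, ev⟩ := h'.params.span v h.params.mem_right
  have hβm : β ∉ mx T := by
    intro hβm
    obtain ⟨a₁, ha₁, b₁, hb₁, ev'⟩ := h.params.span v' h'.params.mem_right
    have h1 := mul_mem_mx hb₁ hβm
    refine h'.params.pow_mul_unit_ne 1 (w := 1 - b₁ * β) (c := a₁ * ε + b₁ * α)
      (sub_mem (one_mem _) h1.1) (fun hm => ?_) (add_mem (mul_mem ha₁ hε) (mul_mem hb₁ hα)) ?_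
    · have := add_mem_mx hm h1
      rw [sub_add_cancel] at this
      exact one_notMem_mx this
    · rw [ev, eε] at ev'
      linear_combination ev'
  have hpow : ∃ d ∈ T.toSubring, v ^ J' = u' * d + β ^ J' * v' ^ J' := by
    have hdvd : (⟨v, h.params.mem_right.1⟩ : T.toSubring) - ⟨β, hβ⟩ * ⟨v', h'.params.mem_right.1⟩ ∣
        ⟨v, h.params.mem_right.1⟩ ^ J' - (⟨β, hβ⟩ * ⟨v', h'.params.mem_right.1⟩) ^ J' :=
      sub_dvd_pow_sub_pow _ _ _
    obtain ⟨d, hd⟩ := hdvd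
    have hd' : v ^ J' - (β * v') ^ J' = (v - β * v') * d := congrArg Subtype.val hd
    refine ⟨α * d, mul_mem hα d.2, ?_⟩
    rw [mul_pow] at hd'
    have : v - β * v' = α * u' := by rw [ev]; ring
    rw [this] at hd'
    linear_combination hd'
  obtain ⟨d, hd, ed⟩ := hpow
  have hpow0 : u' ^ ordAt γ a ≠ 0 := pow_ne_zero _ h'.params.ne_zero_left
  set n := ordAt γ a
  -- comparison of the two expressions modulo `u'`
  have key : v' ^ J * w' - v' ^ J' * (ε ^ n * β ^ J' * w) =
      u' * (ε ^ n * (ε * c + d * w) - c') := by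
    rw [e', eε, ed, mul_pow] at e
    have := mul_left_cancel₀ hpow0 (e.trans (mul_assoc _ _ _))
    linear_combination this
  have hun : ε ^ n * β ^ J' * w ∉ mx T := mul_notMem_mx (mul_mem (pow_mem hε _) (pow_mem hβ _)) hw
    (mul_notMem_mx (pow_mem hε _) (pow_mem hβ _) (pow_notMem_mx hε hεm _)
      (pow_notMem_mx hβ hβm _)) hwm
  have hunT : ε ^ n * β ^ J' * w ∈ T.toSubring := mul_mem (mul_mem (pow_mem hε _) (pow_mem hβ _)) hw
  have hrT : ε ^ n * (ε * c + d * w) - c' ∈ T.toSubring := sub_mem (mul_mem (pow_mem hε _)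
    (add_mem (mul_mem hε hc) (mul_mem hd hw))) hc'
  set w₂ := ε ^ n * β ^ J' * w
  have hv' := h'.params.mem_right
  rcases lt_trichotomy J J' with hlt | heq | hlt
  · exfalso
    have hm := mul_mem_mx' (pow_mem_mx_of_pos hv' (Nat.sub_pos_of_lt hlt)) hunT
    refine h'.params.pow_mul_unit_ne J (w := w' - v' ^ (J' - J) * w₂) (sub_mem hw' hm.1)
      (fun hc => hwm' ?_) hrT ?_
    · have := add_mem_mx hc hm
      rwa [sub_add_cancel] at this
    · rw [← key, mul_sub, ← mul_assoc, ← pow_add, Nat.add_sub_cancel' hlt.le]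
  · exact heq
  · exfalso
    have hm := mul_mem_mx' (pow_mem_mx_of_pos hv' (Nat.sub_pos_of_lt hlt)) hw'
    refine h'.params.pow_mul_unit_ne J' (w := w₂ - v' ^ (J - J') * w') (sub_mem hunT hm.1)
      (fun hc => hun ?_) (neg_mem hrT) ?_
    · have := add_mem_mx hc hm
      rwa [sub_add_cancel] at this
    · have hp : v' ^ J = v' ^ J' * v' ^ (J - J') := by
        rw [← pow_add, Nat.add_sub_cancel' hlt.le]
      linear_combination -key + w' * hp

lemma HasMult.unique {J' : ℕ} (hJ : HasMult γ T a J) (hJ' : HasMult γ T a J') : J = J' := by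
  obtain ⟨u, v, h, c, hc, w, hw, hwm, e⟩ := hJ'
  exact hJ.eq_of_onCurve h hc hw hwm e

lemma exists_hasMult (hγ : IsPoint γ) (h : LiesOnStrictTransform T γ)
    (ha : a ∈ γ.toSubring) (h0 : a ≠ 0) : ∃ J, HasMult γ T a J := by
  obtain ⟨u, v, huv⟩ := h.exists_onCurve hγ
  obtain ⟨J, hJ⟩ := huv.exists_eq hγ (IsInfNear.isPoint hγ h.1.to_reflTransGen) ha h0
  exact ⟨J, u, v, huv, hJ⟩

/-- Substitute u = (u/v) · v. The factor v to the power `ordAt γ a` no longer belongs to the curve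
and joins the residual part. -/
lemma HasMult.next (hT : IsPoint T) (hJ : HasMult γ T a J) (hq : IsQuadraticTransform T T')
    (hsub : (T'.toSubring : Set K) ⊆ orderRing γ) : HasMult γ T' a (J + ordAt γ a) := by
  obtain ⟨u, v, h, c, hc, w, hw, hwm, e⟩ := hJ
  have hT' := h.isQT hT hq hsub
  have hle := hq.le hT
  have hv0 := h.params.ne_zero_right
  refine ⟨_, _, h.next hT hT', v ^ ordAt γ a * (v * c), mul_mem (pow_mem (mem_of_le hle
    h.params.mem_right.1) _) (mul_mem (mem_of_le hle h.params.mem_right.1) (mem_of_le hle hc)),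
    w, mem_of_le hle hw, notMem_mx_of_le hle hw hwm, ?_⟩
  conv_lhs => rw [e]
  rw [div_pow, pow_add]
  field_simp

lemma dvd_cancel_pow {x y z : K} (h : IsParams T x y) (m n : ℕ) (hz : z ∈ T.toSubring)
    (hd : ∃ w ∈ T.toSubring, x ^ m * z = y ^ n * w) : ∃ w ∈ T.toSubring, z = y ^ n * w := by
  induction n with
  | zero => exact ⟨z, hz, by simp⟩
  | succ n ih =>
    obtain ⟨w, hw, e⟩ := hd
    obtain ⟨w', hw', e'⟩ := ih ⟨y * w, mul_mem h.mem_right.1 hw, by rw [e]; ring⟩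
    obtain ⟨w₁, hw₁, e₁⟩ := h.symm.dvd_of_dvd_pow_mul m hw' ⟨w, hw, by
      apply mul_left_cancel₀ (pow_ne_zero n h.ne_zero_right)
      rw [e'] at e
      linear_combination e⟩
    exact ⟨w₁, hw₁, by rw [e', e₁, pow_succ]; ring⟩

/-- Exceptional curves cross transversally: their equations form a system of parameters. -/
lemma exists_onCurve_onCurve (hR : IsPoint R₀) (hγ : IsInfNear R₀ γ) (hσ : IsInfNear R₀ σ)
    (hne : γ ≠ σ) (hTγ : LiesOnStrictTransform T γ) (hTσ : LiesOnStrictTransform T σ) :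
    ∃ u v, OnCurve γ T u v ∧ OnCurve σ T v u := by
  have hγp := hγ.isPoint hR
  have hσp := hσ.isPoint hR
  rcases LiesOnStrictTransform.or_of_ne hR hγ hσ hne hTγ hTσ with h | h
  · obtain ⟨u, v, h1, h2⟩ := h.exists_onCurve_onCurve hσp
      (h.isQuadraticTransform hσp hTγ hTσ) hTσ.2
    exact ⟨v, u, h2, h1⟩
  · exact h.exists_onCurve_onCurve hγp (h.isQuadraticTransform hγp hTσ hTγ) hTγ.2

/-- The equation v of the curve of σ divides a at least `ordAt σ a` times. Since u and v are
coprime, the residual part keeps these factors, and v restricts to a uniformizer on u = 0. -/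
lemma HasMult.ordAt_le (hR : IsPoint R₀) (hγ : IsInfNear R₀ γ) (hσ : IsInfNear R₀ σ)
    (hne : γ ≠ σ) (hTγ : LiesOnStrictTransform T γ) (hTσ : LiesOnStrictTransform T σ)
    (ha : a ∈ R₀.toSubring) (h0 : a ≠ 0) (hJ : HasMult γ T a J) : ordAt σ a ≤ J := by
  have hγp := hγ.isPoint hR
  have hσp := hσ.isPoint hR
  have hTp := IsInfNear.isPoint hγp hTγ.1.to_reflTransGen
  obtain ⟨u, v, h1, h2⟩ := exists_onCurve_onCurve hR hγ hσ hne hTγ hTσ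
  have haγ := mem_of_le (hγ.le hR) ha
  have haσ := mem_of_le (hσ.le hR) ha
  obtain ⟨J', c, hc, w, hw, hwm, e⟩ := h1.exists_eq hγp hTp haγ h0
  obtain rfl := hJ.eq_of_onCurve h1 hc hw hwm e
  obtain ⟨b, hb, eb⟩ := (h2.mem_mpow_iff _ a haσ).1 (ordAt_spec hσp haσ h0).1
  have hv := h1.params.mem_right
  obtain ⟨g, hg, eg⟩ := dvd_cancel_pow h1.params (ordAt γ a) (ordAt σ a)
    (add_mem (mul_mem h1.params.mem_left.1 hc) (mul_mem (pow_mem hv.1 J) hw))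
    ⟨b, hb, by rw [← e, ← eb]⟩
  by_contra! hlt
  have hm := mul_mem_mx' (pow_mem_mx_of_pos hv (Nat.sub_pos_of_lt hlt)) hg
  refine h1.params.pow_mul_unit_ne J (w := w - v ^ (ordAt σ a - J) * g) (sub_mem hw hm.1)
    (fun hc => hwm ?_) (neg_mem hc) ?_
  · have := add_mem_mx hc hm
    rwa [sub_add_cancel] at this
  · rw [mul_sub, ← mul_assoc, ← pow_add, Nat.add_sub_cancel' hlt.le]
    linear_combination eg

end HasMult

end ExcTree

/-! ### Intersection multiplicities as root multiplicities of the leading form. -/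

namespace ExcTree

open IsLocalRing Polynomial

variable {K : Type*} [Field K]

lemma sum_count_le_card {α : Type*} [DecidableEq α] (s : Finset α) (m : Multiset α) :
    ∑ a ∈ s, m.count a ≤ m.card := by
  rw [← Multiset.sum_count_eq_card (s := s ∪ m.toFinset) (m := m) (by
    intro a ha
    exact Finset.mem_union_right _ (Multiset.mem_toFinset.2 ha))]
  exact Finset.sum_le_sum_of_subset Finset.subset_union_left

section Directions

variable {γ T : LocalSubring K} {x y : K}

lemma IsQT.div_mem_of_mem_mx (h : IsParams γ x y) (hT : IsQT γ T x y) {s : K} (hs : s ∈ mx γ) :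
    s / x ∈ T.toSubring := by
  obtain ⟨a, ha, b, hb, e⟩ := h.span s hs
  have hx0 := h.ne_zero_left
  have : s / x = a + b * (y / x) := by rw [e]; field_simp
  rw [this]
  exact add_mem (hT.mem_base ha) (mul_mem (hT.mem_base hb) hT.div_mem)

/-- A direction that is avoided by finitely many given quadratic transforms. -/
lemma exists_common_chart (hγ : IsPoint γ) (B : Finset (LocalSubring K))
    (hB : ∀ T ∈ B, IsQuadraticTransform γ T) :
    ∃ x y, IsParams γ x y ∧ ∀ T ∈ B, ∃ c : γ.toSubring, IsQT γ T x (-(c : K) * x + 1 * y) := by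
  have := hγ.algClosed
  obtain ⟨X', Y', hXY⟩ := hγ.params
  choose! xT yT hxy hqt using fun T hT => exists_isQT_of_isQuadraticTransform hγ (hB T hT)
  -- A class l is bad for T when the direction of X' + lY' is that of T. Two bad classes would make
  -- X'/x and Y'/x both nonunits at T, although a combination of them is 1. The residue field is
  -- infinite, so some class is good for all of `B`.
  let bad : LocalSubring K → Set (ResidueField γ.toSubring) := fun T =>
    {r | ∃ l : γ.toSubring, residue _ l = r ∧ (1 * X' + l * Y') / xT T ∈ mx T}
  have hbad : ∀ T ∈ B, (bad T).Finite := by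
    intro T hT
    apply Set.Subsingleton.finite
    rintro r ⟨l, rfl, hl⟩ r' ⟨l', rfl, hl'⟩
    by_contra hne
    have hle := (hqt T hT).le (hxy T hT)
    have hx0 := (hxy T hT).ne_zero_left
    have hll : ((l - l' : γ.toSubring) : K) ∉ mx γ := by
      intro hc
      apply hne
      rw [← sub_eq_zero, ← map_sub, residue_eq_zero_iff]
      exact hc.2
    have hllT := notMem_mx_of_le hle (l - l').2 hll
    have hY : Y' / xT T ∈ mx T := by
      have h1 := sub_mem_mx hl hl'
      have h2 := mul_mem_mx (inv_mem_of_notMem_mx (mem_of_le hle (l - l').2) hllT) h1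
      have h3 := ne_zero_of_notMem_mx hllT
      have : ((l - l' : γ.toSubring) : K)⁻¹ * ((1 * X' + l * Y') / xT T -
          (1 * X' + l' * Y') / xT T) = Y' / xT T := by
        field_simp
        rw [AddSubgroupClass.coe_sub]
        ring
      rwa [this] at h2
    have hX : X' / xT T ∈ mx T := by
      have h1 := sub_mem_mx hl (mul_mem_mx (mem_of_le hle l.2) hY)
      have : (1 * X' + l * Y') / xT T - l * (Y' / xT T) = X' / xT T := by
        field_simp; ring
      rwa [this] at h1
    obtain ⟨a, ha, b, hb, e⟩ := hXY.span _ (hxy T hT).mem_left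
    apply one_notMem_mx (S := T)
    have h1 := add_mem_mx (mul_mem_mx (mem_of_le hle ha) hX) (mul_mem_mx (mem_of_le hle hb) hY)
    have : a * (X' / xT T) + b * (Y' / xT T) = 1 := by
      field_simp
      exact e.symm
    rwa [this] at h1
  have hfin : (⋃ T ∈ B, bad T).Finite := B.finite_toSet.biUnion hbad
  obtain ⟨r, hr⟩ := hfin.infinite_compl.nonempty
  obtain ⟨l, rfl⟩ := residue_surjective r
  have hpar : IsParams γ (1 * X' + l * Y') Y' :=
    hXY.change_left (one_mem _) one_notMem_mx l.2
  refine ⟨_, _, hpar, fun T hT => ?_⟩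
  set x := 1 * X' + l * Y' with hx
  have hle := (hqt T hT).le (hxy T hT)
  have hx0 := (hxy T hT).ne_zero_left
  have hx0' := hpar.ne_zero_left
  have hun : x / xT T ∉ mx T := by
    intro hc
    apply hr
    simp only [Set.mem_iUnion]
    exact ⟨T, hT, l, rfl, hc⟩
  have hxm := (hqt T hT).div_mem_of_mem_mx (hxy T hT) hpar.mem_left
  have hYx : Y' / x ∈ T.toSubring := by
    have := mul_mem ((hqt T hT).div_mem_of_mem_mx (hxy T hT) hXY.mem_right)
      (inv_mem_of_notMem_mx hxm hun)
    have e : Y' / xT T * (x / xT T)⁻¹ = Y' / x := by field_simp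
    rwa [e] at this
  obtain ⟨c, hc, hcm⟩ := (hqt T hT).exists_sub_mem_mx (hxy T hT) hYx
  refine ⟨⟨c, hc⟩, ?_⟩
  have hpar' : IsParams γ x (-c * x + 1 * Y') :=
    hpar.change_right (neg_mem hc) (one_mem _) one_notMem_mx
  have := hγ.noeth
  obtain ⟨T₀, hq₀, hT₀, -⟩ := hpar'.exists_isQT
  have hd : (-c * x + 1 * Y') / x ∈ mx T := by
    have : (-c * x + 1 * Y') / x = Y' / x - c := by field_simp; ring
    rwa [this]
  obtain rfl := hq₀.eq_of_le hγ (hB T hT) (hT₀.le_of_div_mem_mx hpar' hle hd) le_rfl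
  exact hT₀

/-- The multiplicities of `a` along the exceptional curve of `γ`, at different points of the
blowup of `γ`, add up to at most the order of `a`. -/
lemma sum_mult_le (hγ : IsPoint γ) {a : K} (ha : a ∈ γ.toSubring) (h0 : a ≠ 0)
    (B : Finset (LocalSubring K)) (hB : ∀ T ∈ B, IsQuadraticTransform γ T)
    (J : LocalSubring K → ℕ) (hJ : ∀ T ∈ B, HasMult γ T a (J T)) :
    ∑ T ∈ B, J T ≤ ordAt γ a := by
  classical
  obtain ⟨x, y, hxy, hc⟩ := exists_common_chart hγ B hB
  choose! c hqt using hc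
  have hx0 := hxy.ne_zero_left
  have hpar : ∀ d : γ.toSubring, IsParams γ x (-(d : K) * x + 1 * y) := fun d =>
    hxy.change_right (neg_mem d.2) (one_mem _) one_notMem_mx
  have hdiv : ∀ d : γ.toSubring, (-(d : K) * x + 1 * y) / x = y / x - d := fun d => by
    field_simp; ring
  have hmem : ∀ T ∈ B, y / x - c T ∈ mx T := by
    intro T hT
    have := (hqt T hT).div_mem_mx (hpar _)
    rwa [hdiv] at this
  have hinj : Set.InjOn (fun T => residue γ.toSubring (c T)) B := by
    intro T hT T' hT' e
    have hm : c T - c T' ∈ maximalIdeal γ.toSubring := by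
      rw [← residue_eq_zero_iff, map_sub, sub_eq_zero]; exact e
    have hle := (hqt T hT).le (hpar _)
    have hle' : T' ≤ T := by
      refine (hqt T' hT').le_of_div_mem_mx (hpar _) hle ?_
      rw [hdiv]
      have := add_mem_mx (hmem T hT) (mx_of_le hle (coe_mem_mx.2 hm))
      rw [AddSubgroupClass.coe_sub] at this
      have e : y / x - c T + ((c T : K) - c T') = y / x - c T' := by ring
      rwa [e] at this
    exact (hB T hT).eq_of_le hγ (hB T' hT') le_rfl hle'
  obtain ⟨h1, h2⟩ := ordAt_spec hγ ha h0
  obtain ⟨p, hp, ep, hp0⟩ := hxy.exists_leading h1 h2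
  set pb := p.map (residue γ.toSubring) with hpb
  -- The direction of T is the point c(T) of the affine line. Factoring (X − c) ^ m out of the
  -- reduced leading form leaves a unit at T, so J(T) is the multiplicity of this root.
  have hJm : ∀ T ∈ B, J T = pb.roots.count (residue _ (c T)) := by
    intro T hT
    rw [count_roots]
    set m := pb.rootMultiplicity (residue _ (c T)) with hm
    obtain ⟨qb, hqb, hnd⟩ := exists_eq_pow_rootMultiplicity_mul_and_not_dvd pb hp0
      (residue _ (c T))
    rw [← hm] at hqb
    obtain ⟨q, rfl⟩ := map_surjective _ residue_surjective qb
    have hz : (p - (X - C (c T)) ^ m * q).map (residue γ.toSubring) = 0 := by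
      rw [Polynomial.map_sub, Polynomial.map_mul, Polynomial.map_pow, Polynomial.map_sub, map_X,
        map_C, ← hpb, ← hqb, sub_self]
    obtain ⟨r, hr⟩ := hxy.exists_eq_mul_aeval hz
    have hle := (hqt T hT).le (hpar _)
    have hyx : y / x ∈ T.toSubring := by
      have := add_mem (hmem T hT).1 (mem_of_le hle (c T).2)
      rwa [sub_add_cancel] at this
    have hal : ∀ s : γ.toSubring[X], aeval (y / x) s ∈ T.toSubring := by
      intro s
      rw [aeval_eq_sum_range]
      refine sum_mem fun i _ => ?_
      rw [Algebra.smul_def]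
      exact mul_mem (mem_of_le hle (s.coeff i).2) (pow_mem hyx _)
    refine (hJ T hT).eq_of_onCurve (OnCurve.of_isQT hγ (hpar _) (hqt T hT)) (hal r) (hal q) ?_ ?_
    · intro hqm
      obtain ⟨s, hs⟩ := X_sub_C_dvd_sub_C_eval (a := c T) (p := q)
      have hs' : aeval (y / x) q = (y / x - c T) * aeval (y / x) s +
          ((q.eval (c T) : γ.toSubring) : K) := by
        have := congrArg (aeval (y / x)) hs
        rw [map_sub, map_mul, map_sub, aeval_X, aeval_C, aeval_C] at this
        exact eq_add_of_sub_eq this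
      have hqe : ((q.eval (c T) : γ.toSubring) : K) ∈ mx γ := by
        refine mem_mx_of_le hle (q.eval (c T)).2 ?_
        have := sub_mem_mx hqm (mul_mem_mx' (hmem T hT) (hal s))
        rwa [hs', add_sub_cancel_left] at this
      apply hnd
      rw [dvd_iff_isRoot, IsRoot, eval_map, eval₂_at_apply, residue_eq_zero_iff]
      exact hqe.2
    · rw [hdiv]
      conv_lhs => rw [ep]
      congr 1
      rw [map_sub, map_mul, map_pow, map_sub, aeval_X, aeval_C] at hr
      exact eq_add_of_sub_eq hr
  calc ∑ T ∈ B, J T = ∑ T ∈ B, pb.roots.count (residue _ (c T)) := Finset.sum_congr rfl hJm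
    _ = ∑ r ∈ B.image (fun T => residue γ.toSubring (c T)), pb.roots.count r := by
      rw [Finset.sum_image hinj]
    _ ≤ pb.roots.card := sum_count_le_card _ _
    _ ≤ pb.natDegree := card_roots' pb
    _ ≤ p.natDegree := natDegree_map_le
    _ ≤ ordAt γ a := hp

end Directions

end ExcTree

/-! ### The proximity inequality for one element. -/

namespace ExcTree

open IsLocalRing Polynomial

section Nef

variable {K : Type*} [Field K]
variable {R : Type*} [CommRing R] [IsLocalRing R] [Algebra R K] {C : Finset (LocalSubring K)}

lemma IsCluster.isPoint (hR : IsPoint (root R K)) (hC : IsCluster R C) {T : LocalSubring K}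
    (hT : T ∈ C) : IsPoint T := (hC T hT).1.isPoint hR

/-- The parent of a point of a cluster. -/
lemma IsCluster.exists_parent (hC : IsCluster R C)
    {γ T : LocalSubring K} (hT : T ∈ C) (hγ : IsInfNear (root R K) γ)
    (h : IsStrictlyInfNear γ T) :
    ∃ p ∈ C, IsQuadraticTransform p T ∧ IsInfNear γ p := by
  obtain ⟨p, hγp, hpT⟩ := Relation.TransGen.tail'_iff.1 h
  have hp : IsInfNear (root R K) p := hγ.trans hγp
  exact ⟨p, (hC T hT).2 p hp (Relation.TransGen.single hpT), hpT, hγp⟩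

lemma IsQuadraticTransform.parent_unique (hR : IsPoint (root R K)) {p p' T : LocalSubring K}
    (hp : IsInfNear (root R K) p) (hp' : IsInfNear (root R K) p')
    (h : IsQuadraticTransform p T) (h' : IsQuadraticTransform p' T) : p = p' :=
  le_antisymm
    (IsInfNear.le (hp.isPoint hR) (IsStrictlyInfNear.isInfNear_of_isQuadraticTransform hR hp hp'
      (Relation.TransGen.single h) h'))
    (IsInfNear.le (hp'.isPoint hR) (IsStrictlyInfNear.isInfNear_of_isQuadraticTransform hR hp' hp
      (Relation.TransGen.single h') h))

open Classical in
/-- The points of the cluster on whose exceptional curves `T` lies. -/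
noncomputable def below (C : Finset (LocalSubring K)) (T : LocalSubring K) :
    Finset (LocalSubring K) := C.filter fun σ => LiesOnStrictTransform T σ

open Classical in
/-- The points of the cluster that lie on the exceptional curve of `γ`. -/
noncomputable def above (C : Finset (LocalSubring K)) (γ : LocalSubring K) :
    Finset (LocalSubring K) := C.filter fun T => LiesOnStrictTransform T γ

lemma mem_below {T σ : LocalSubring K} : σ ∈ below C T ↔ σ ∈ C ∧ LiesOnStrictTransform T σ := by
  simp [below]

lemma mem_above {T γ : LocalSubring K} : T ∈ above C γ ↔ T ∈ C ∧ LiesOnStrictTransform T γ := by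
  simp [above]

open Classical in
/-- The structure of the set of points to which a point of a cluster is proximate. -/
lemma IsCluster.below_cases (hR : IsPoint (root R K)) (hC : IsCluster R C)
    {p T : LocalSubring K} (hp : p ∈ C) (hq : IsQuadraticTransform p T) :
    below C T = {p} ∨ ∃ σ ∈ C, σ ≠ p ∧ LiesOnStrictTransform p σ ∧
      LiesOnStrictTransform T σ ∧ below C T = {p, σ} := by
  have hpT := hq.liesOnStrictTransform (hC.isPoint hR hp)
  rcases hq.proximate_cases hR (hC p hp).1 with h | ⟨σ, hσ, hne, hpσ, hTσ, h⟩
  · left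
    ext τ
    rw [mem_below, Finset.mem_singleton]
    exact ⟨fun hτ => h τ (hC τ hτ.1).1 hτ.2, fun e => e ▸ ⟨hp, hpT⟩⟩
  · right
    have hσC := (hC p hp).2 σ hσ hpσ.1
    refine ⟨σ, hσC, hne, hpσ, hTσ, ?_⟩
    ext τ
    rw [mem_below, Finset.mem_insert, Finset.mem_singleton]
    refine ⟨fun hτ => h τ (hC τ hτ.1).1 hτ.2, ?_⟩
    rintro (rfl | rfl)
    · exact ⟨hp, hpT⟩
    · exact ⟨hσC, hTσ⟩

/-- The coefficients of `∑ f γ E_γ` with respect to the total transforms. -/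
noncomputable def excess (C : Finset (LocalSubring K)) (f : LocalSubring K → ℤ)
    (T : LocalSubring K) : ℤ := f T - ∑ σ ∈ below C T, f σ

open Classical in
/-- The point following `T` on the exceptional curve of `γ` is proximate to `T` and `γ` only. -/
lemma IsCluster.below_next (hR : IsPoint (root R K)) (hC : IsCluster R C)
    {γ T T' : LocalSubring K} (hγ : γ ∈ C) (hT : T ∈ C) (hTγ : LiesOnStrictTransform T γ)
    (hq : IsQuadraticTransform T T') (hT'γ : LiesOnStrictTransform T' γ) :
    below C T' = {T, γ} := by
  have hne : γ ≠ T := (hTγ.ne (hC.isPoint hR hγ)).symm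
  have hmem : γ ∈ below C T' := mem_below.2 ⟨hγ, hT'γ⟩
  rcases hC.below_cases hR hT hq with h | ⟨σ, -, -, -, -, h⟩
  · rw [h, Finset.mem_singleton] at hmem
    exact absurd hmem hne
  · rw [h, Finset.mem_insert, Finset.mem_singleton] at hmem
    rw [h, hmem.resolve_left hne]

/-- The proximity inequality for the multiplicities of a single element. -/
lemma sum_above_excess_le (hR : IsPoint (root R K)) (hC : IsCluster R C) {γ : LocalSubring K}
    (hγ : γ ∈ C) {a : K} (ha : a ∈ (root R K).toSubring) (h0 : a ≠ 0) :
    ∑ T ∈ above C γ, excess C (fun T => (ordAt T a : ℤ)) T ≤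
      excess C (fun T => (ordAt T a : ℤ)) γ := by
  classical
  have hγp := hC.isPoint hR hγ
  have hmemP : ∀ {T}, IsInfNear (root R K) T → a ∈ T.toSubring :=
    fun hT => mem_of_le (hT.le hR) ha
  have haγ := hmemP (hC γ hγ).1
  set e : LocalSubring K → ℤ := fun T => (ordAt T a : ℤ) with he
  choose! J hJ using fun T (hT : LiesOnStrictTransform T γ) => exists_hasMult hγp hT haγ h0
  choose! N hNq hNγ using fun T (hT : LiesOnStrictTransform T γ) => hT.exists_next hγp
  -- I(T) is the intersection number at T of E_γ with the strict transform of the divisor of a: the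
  -- other exceptional curve through T, if any, crosses E_γ once and is subtracted with its
  -- multiplicity.
  set I : LocalSubring K → ℤ := fun T => (J T : ℤ) - ∑ σ ∈ (below C T).erase γ, e σ with hI
  have hinf : ∀ T, LiesOnStrictTransform T γ → IsInfNear (root R K) T := fun T hT =>
    (hC γ hγ).1.trans hT.1.to_reflTransGen
  have hJN : ∀ T, LiesOnStrictTransform T γ → J (N T) = J T + ordAt γ a := fun T hT =>
    (hJ _ (hNγ T hT)).unique ((hJ T hT).next ((hinf T hT).isPoint hR) (hNq T hT) (hNγ T hT).2)
  have hIN : ∀ T ∈ above C γ, I (N T) = J T + e γ - e T := by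
    intro T hT
    obtain ⟨hTC, hTγ⟩ := mem_above.1 hT
    have hne : T ≠ γ := hTγ.ne hγp
    simp only [hI]
    rw [hC.below_next hR hγ hTC hTγ (hNq T hTγ) (hNγ T hTγ), hJN T hTγ,
      show ({T, γ} : Finset (LocalSubring K)).erase γ = {T} by
        rw [Finset.pair_comm, Finset.erase_insert (by simpa using hne.symm)],
      Finset.sum_singleton]
    push_cast
    ring
  -- Noether's formula with the smooth curve E_γ: blowing up T lowers the intersection number by the
  -- multiplicity at T.
  have hexc : ∀ T ∈ above C γ, excess C e T = I T - I (N T) := by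
    intro T hT
    obtain ⟨hTC, hTγ⟩ := mem_above.1 hT
    have hmem : γ ∈ below C T := mem_below.2 ⟨hγ, hTγ⟩
    rw [hIN T hT]
    simp only [hI, excess]
    rw [← Finset.add_sum_erase _ _ hmem]
    ring
  have hI0 : ∀ T, LiesOnStrictTransform T γ → 0 ≤ I T := by
    intro T hTγ
    obtain ⟨p, hγp', hpT⟩ := Relation.TransGen.tail'_iff.1 hTγ.1
    have hp : IsInfNear (root R K) p := (hC γ hγ).1.trans hγp'
    have hsub : ((below C T).erase γ : Set (LocalSubring K)).Subsingleton := by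
      intro τ hτ τ' hτ'
      simp only [Finset.coe_erase, Set.mem_sdiff, Finset.mem_coe, mem_below,
        Set.mem_singleton_iff] at hτ hτ'
      rcases hpT.proximate_cases hR hp with h | ⟨σ, -, -, -, -, h⟩
      · rw [h τ (hC τ hτ.1.1).1 hτ.1.2, h τ' (hC τ' hτ'.1.1).1 hτ'.1.2]
      · have h1 := h τ (hC τ hτ.1.1).1 hτ.1.2
        have h2 := h τ' (hC τ' hτ'.1.1).1 hτ'.1.2
        have h3 := h γ (hC γ hγ).1 hTγ
        have h4 := hτ.2
        have h5 := hτ'.2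
        grind
    simp only [hI]
    rcases ((below C T).erase γ).eq_empty_or_nonempty with h | ⟨σ, hσ⟩
    · rw [h, Finset.sum_empty]; simp
    · have : (below C T).erase γ = {σ} := by
        apply Finset.eq_singleton_iff_unique_mem.2
        exact ⟨hσ, fun τ hτ => hsub (by exact_mod_cast hτ) (by exact_mod_cast hσ)⟩
      rw [this, Finset.sum_singleton]
      obtain ⟨hne, hσ'⟩ := Finset.mem_erase.1 hσ
      obtain ⟨hσC, hTσ⟩ := mem_below.1 hσ'
      have := (hJ T hTγ).ordAt_le hR (hC γ hγ).1 (hC σ hσC).1 hne.symm hTγ hTσ ha h0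
      simp only [he]
      omega
  have hNinj : Set.InjOn N (above C γ) := by
    intro T hT T' hT' e
    have h1 := (mem_above.1 hT).2
    have h2 := (mem_above.1 hT').2
    exact IsQuadraticTransform.parent_unique hR (hinf T h1) (hinf T' h2) (hNq T h1)
      (e ▸ hNq T' h2)
  set A := above C γ with hA
  -- The sum telescopes along the chains of points on E_γ. Their ends are discarded because I is
  -- nonnegative; their beginnings are points of the first neighbourhood of γ.
  have hstep1 : ∑ T ∈ A, excess C e T ≤ ∑ T ∈ A \ A.image N, I T := by
    rw [Finset.sum_congr rfl hexc, Finset.sum_sub_distrib, ← Finset.sum_image hNinj,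
      ← Finset.sum_sdiff_sub_sum_sdiff, sub_le_self_iff]
    refine Finset.sum_nonneg fun T hT => ?_
    obtain ⟨S, hS, rfl⟩ := Finset.mem_image.1 (Finset.mem_sdiff.1 hT).1
    exact hI0 _ (hNγ S (mem_above.1 hS).2)
  have himm : ∀ T ∈ A \ A.image N, IsQuadraticTransform γ T := by
    intro T hT
    obtain ⟨hTA, hTN⟩ := Finset.mem_sdiff.1 hT
    obtain ⟨hTC, hTγ⟩ := mem_above.1 hTA
    obtain ⟨p, hpC, hpT, hγp'⟩ := hC.exists_parent hTC (hC γ hγ).1 hTγ.1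
    rcases hγp'.eq_or with rfl | hlt
    · exact hpT
    · exfalso
      have hpp := hC.isPoint hR hpC
      have hpγ : LiesOnStrictTransform p γ := hTγ.of_le hlt (hpT.le hpp)
      apply hTN
      rw [Finset.mem_image]
      exact ⟨p, mem_above.2 ⟨hpC, hpγ⟩, hpγ.next_unique hγp (hNq p hpγ) hpT (hNγ p hpγ).2 hTγ.2⟩
  -- The points where E_γ meets the older exceptional curves through γ are added, even if they are
  -- not in C. There the contribution of the older curves to the sum of the J is at least their
  -- order along γ.
  choose! M hMq hMσ using fun σ (hσ : σ ∈ below C γ) =>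
    (mem_below.1 hσ).2.exists_next (hC.isPoint hR (mem_below.1 hσ).1)
  set B := (A \ A.image N) ∪ (below C γ).image M with hB
  have hBq : ∀ T ∈ B, IsQuadraticTransform γ T := by
    intro T hT
    rcases Finset.mem_union.1 hT with hT | hT
    · exact himm T hT
    · obtain ⟨σ, hσ, rfl⟩ := Finset.mem_image.1 hT
      exact hMq σ hσ
  have hBγ : ∀ T ∈ B, LiesOnStrictTransform T γ := fun T hT =>
    (hBq T hT).liesOnStrictTransform hγp
  have hJB := sum_mult_le hγp haγ h0 B hBq J (fun T hT => hJ T (hBγ T hT))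
  have hlow : ∑ σ ∈ below C γ, e σ ≤ ∑ T ∈ B, ∑ σ ∈ (below C T).erase γ, e σ := by
    have hnn : ∀ σ, 0 ≤ e σ := fun σ => by simp [he]
    calc ∑ σ ∈ below C γ, e σ
        ≤ ∑ σ ∈ below C γ, ∑ T ∈ B, if σ ∈ (below C T).erase γ then e σ else 0 := by
          refine Finset.sum_le_sum fun σ hσ => ?_
          have hMB : M σ ∈ B := Finset.mem_union_right _ (Finset.mem_image_of_mem M hσ)
          have hσC := (mem_below.1 hσ).1
          have hmem : σ ∈ (below C (M σ)).erase γ := Finset.mem_erase.2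
            ⟨((mem_below.1 hσ).2.ne (hC.isPoint hR hσC)).symm, mem_below.2 ⟨hσC, hMσ σ hσ⟩⟩
          calc e σ = if σ ∈ (below C (M σ)).erase γ then e σ else 0 := by rw [if_pos hmem]
            _ ≤ _ := Finset.single_le_sum
              (f := fun T => if σ ∈ (below C T).erase γ then e σ else 0)
              (fun T _ => by split_ifs <;> simp [hnn]) hMB
      _ = ∑ T ∈ B, ∑ σ ∈ below C γ, if σ ∈ (below C T).erase γ then e σ else 0 :=
          Finset.sum_comm
      _ ≤ _ := by
          refine Finset.sum_le_sum fun T _ => ?_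
          rw [← Finset.sum_filter]
          refine Finset.sum_le_sum_of_subset_of_nonneg (fun σ hσ => (Finset.mem_filter.1 hσ).2)
            fun σ _ _ => hnn σ
  calc ∑ T ∈ A, excess C e T ≤ ∑ T ∈ A \ A.image N, I T := hstep1
    _ ≤ ∑ T ∈ B, I T := Finset.sum_le_sum_of_subset_of_nonneg Finset.subset_union_left
        fun T hT _ => hI0 T (hBγ T hT)
    _ = ((∑ T ∈ B, J T : ℕ) : ℤ) - ∑ T ∈ B, ∑ σ ∈ (below C T).erase γ, e σ := by
        simp only [hI]
        rw [Finset.sum_sub_distrib]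
        push_cast
        rfl
    _ ≤ e γ - ∑ σ ∈ below C γ, e σ := sub_le_sub (by simp only [he]; exact_mod_cast hJB) hlow
    _ = excess C e γ := rfl

end Nef

end ExcTree

/-! ### Orders of the ideal and positivity of its multiplicities. -/

namespace ExcTree

open IsLocalRing Polynomial

section IdealOrder

variable {K : Type*} [Field K]
variable {R : Type*} [CommRing R] [IsLocalRing R] [Algebra R K] {C : Finset (LocalSubring K)}
variable {𝔞 : Ideal R} {T : LocalSubring K}

lemma algebraMap_mem_root (a : R) : algebraMap R K a ∈ (root R K).toSubring := by
  rw [root, LocalSubring.range_toSubring]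
  exact ⟨a, rfl⟩

lemma extend_le_iff (hT : root R K ≤ T) {n : ℕ} :
    extend 𝔞 T ≤ maximalIdeal T.toSubring ^ n ↔ ∀ a ∈ 𝔞, algebraMap R K a ∈ mpow T n := by
  rw [extend, Ideal.span_le]
  constructor
  · intro h a ha
    exact ⟨mem_of_le hT (algebraMap_mem_root a), h ⟨a, ha, rfl⟩⟩
  · rintro h t ⟨a, ha, e⟩
    have := h a ha
    rw [e] at this
    exact coe_mem_mpow.1 this

/-- The order of an ideal at an infinitely near point. -/
noncomputable def idealOrd (𝔞 : Ideal R) (T : LocalSubring K) : ℕ :=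
  sSup {n : ℕ | extend 𝔞 T ≤ maximalIdeal T.toSubring ^ n}

lemma bddAbove_idealOrd (h𝔞 : 𝔞 ≠ ⊥) (hinj : Function.Injective (algebraMap R K))
    (hTp : IsPoint T) (hT : root R K ≤ T) :
    BddAbove {n : ℕ | extend 𝔞 T ≤ maximalIdeal T.toSubring ^ n} := by
  obtain ⟨a, ha, ha0⟩ := Submodule.exists_mem_ne_zero_of_ne_bot h𝔞
  have h0 : algebraMap R K a ≠ 0 := fun h => ha0 (hinj (by rw [h, map_zero]))
  exact ⟨ordAt T (algebraMap R K a), fun n hn =>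
    le_ordAt hTp h0 ((extend_le_iff hT).1 hn a ha)⟩

lemma mem_mpow_idealOrd (h𝔞 : 𝔞 ≠ ⊥) (hinj : Function.Injective (algebraMap R K))
    (hTp : IsPoint T) (hT : root R K ≤ T) {a : R} (ha : a ∈ 𝔞) :
    algebraMap R K a ∈ mpow T (idealOrd 𝔞 T) :=
  (extend_le_iff hT).1 (Nat.sSup_mem (s := {n : ℕ | extend 𝔞 T ≤ maximalIdeal T.toSubring ^ n})
    ⟨0, by simp⟩ (bddAbove_idealOrd h𝔞 hinj hTp hT)) a ha

lemma exists_ordAt_eq (h𝔞 : 𝔞 ≠ ⊥) (hinj : Function.Injective (algebraMap R K))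
    (hTp : IsPoint T) (hT : root R K ≤ T) :
    ∃ a ∈ 𝔞, algebraMap R K a ≠ 0 ∧ algebraMap R K a ∉ mpow T (idealOrd 𝔞 T + 1) ∧
      ordAt T (algebraMap R K a) = idealOrd 𝔞 T := by
  have : ∃ a ∈ 𝔞, algebraMap R K a ∉ mpow T (idealOrd 𝔞 T + 1) := by
    by_contra! hc
    have h1 := le_csSup (bddAbove_idealOrd h𝔞 hinj hTp hT) ((extend_le_iff hT).2 hc)
    exact absurd h1 (by rw [idealOrd]; omega)
  obtain ⟨a, ha, hn⟩ := this
  refine ⟨a, ha, fun h0 => hn ?_, hn, ordAt_eq (mem_mpow_idealOrd h𝔞 hinj hTp hT ha) hn⟩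
  rw [h0]
  exact ⟨zero_mem _, Ideal.zero_mem _⟩

lemma IsParams.pow_left_notMem_mpow {u v : K} (h : IsParams T u v) (n : ℕ) :
    u ^ n ∉ mpow T (n + 1) := by
  induction n with
  | zero =>
    rw [pow_zero, zero_add, mpow_one]
    exact one_notMem_mx
  | succ n ih =>
    rw [pow_succ]
    exact h.mul_notMem_mpow (pow_mem_mpow n h.mem_left) ih (by rw [mpow_one]; exact h.mem_left)
      h.left_notMem_mpow

/-- The exceptional part of the ideal at a point of the cluster. -/
lemma IsCluster.exists_exceptional_part (hR : IsPoint (root R K)) (hC : IsCluster R C)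
    (h𝔞 : 𝔞 ≠ ⊥) (hinj : Function.Injective (algebraMap R K)) (hT : T ∈ C) :
    ∃ g ∈ T.toSubring, g ∈ mpow T (∑ σ ∈ below C T, idealOrd 𝔞 σ) ∧
      g ∉ mpow T (∑ σ ∈ below C T, idealOrd 𝔞 σ + 1) ∧
      ∀ a ∈ 𝔞, ∃ w ∈ T.toSubring, algebraMap R K a = g * w := by
  classical
  have hroot : ∀ {S : LocalSubring K}, S ∈ C → root R K ≤ S := fun hS => (hC _ hS).1.le hR
  have hdvd : ∀ {σ : LocalSubring K} {u v : K}, σ ∈ C → OnCurve σ T u v → ∀ a ∈ 𝔞,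
      ∃ w ∈ T.toSubring, algebraMap R K a = u ^ idealOrd 𝔞 σ * w := by
    intro σ u v hσ h a ha
    exact (h.mem_mpow_iff _ _ (mem_of_le (hroot hσ) (algebraMap_mem_root a))).1
      (mem_mpow_idealOrd h𝔞 hinj (hC.isPoint hR hσ) (hroot hσ) ha)
  rcases (hC T hT).1.eq_or with h | h
  · have hb : below C T = ∅ := by
      rw [Finset.eq_empty_iff_forall_notMem]
      intro σ hσ
      obtain ⟨hσC, hTσ⟩ := mem_below.1 hσ
      have h1 := hTσ.1.lt (hC.isPoint hR hσC)
      rw [← h] at h1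
      exact absurd h1 (not_lt_of_ge (hroot hσC))
    rw [hb, Finset.sum_empty]
    refine ⟨1, one_mem _, by rw [mpow_zero]; exact one_mem _, by
      rw [zero_add, mpow_one]; exact one_notMem_mx, fun a _ => ⟨_, mem_of_le (hroot hT)
      (algebraMap_mem_root a), by rw [one_mul]⟩⟩
  · obtain ⟨p, hpC, hpT, -⟩ := hC.exists_parent hT Relation.ReflTransGen.refl h
    have hpp := hC.isPoint hR hpC
    have hTp := hpT.liesOnStrictTransform hpp
    -- One or two exceptional curves pass through T; g is the product of their equations, raised to
    -- the orders of the ideal along them.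
    rcases hC.below_cases hR hpC hpT with hb | ⟨σ, hσC, hne, hpσ, hTσ, hb⟩
    · obtain ⟨u, v, huv⟩ := hTp.exists_onCurve hpp
      rw [hb, Finset.sum_singleton]
      exact ⟨u ^ idealOrd 𝔞 p, pow_mem huv.params.mem_left.1 _,
        pow_mem_mpow _ huv.params.mem_left, huv.params.pow_left_notMem_mpow _, hdvd hpC huv⟩
    · obtain ⟨u, v, hu, hv⟩ := exists_onCurve_onCurve hR (hC p hpC).1 (hC σ hσC).1 hne.symm hTp hTσ
      rw [hb, Finset.sum_pair hne.symm]
      refine ⟨u ^ idealOrd 𝔞 p * v ^ idealOrd 𝔞 σ, mul_mem (pow_mem hu.params.mem_left.1 _)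
        (pow_mem hv.params.mem_left.1 _), mul_mem_mpow (pow_mem_mpow _ hu.params.mem_left)
        (pow_mem_mpow _ hv.params.mem_left), hu.params.mul_notMem_mpow
        (pow_mem_mpow _ hu.params.mem_left) (hu.params.pow_left_notMem_mpow _)
        (pow_mem_mpow _ hv.params.mem_left) (hv.params.pow_left_notMem_mpow _), fun a ha => ?_⟩
      obtain ⟨w, hw, e⟩ := hdvd hpC hu a ha
      obtain ⟨w', hw', e'⟩ := hdvd hσC hv a ha
      obtain ⟨w₁, hw₁, e₁⟩ := dvd_cancel_pow hu.params _ _ hw ⟨w', hw', by rw [← e, ← e']⟩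
      exact ⟨w₁, hw₁, by rw [e, e₁, mul_assoc]⟩

/-- If the residual part of the ideal is trivial at a point then the ideal is principal there. -/
lemma IsCluster.isPrincipal_of_excess_nonpos (hR : IsPoint (root R K)) (hC : IsCluster R C)
    (h𝔞 : 𝔞 ≠ ⊥) (hinj : Function.Injective (algebraMap R K)) (hT : T ∈ C)
    (h : excess C (fun σ => (idealOrd 𝔞 σ : ℤ)) T ≤ 0) : (extend 𝔞 T).IsPrincipal := by
  obtain ⟨g, hg, hgn, -, hdvd⟩ := hC.exists_exceptional_part hR h𝔞 hinj hT
  have hroot : root R K ≤ T := (hC T hT).1.le hR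
  obtain ⟨a, ha, ha0, han, hao⟩ := exists_ordAt_eq h𝔞 hinj (hC.isPoint hR hT) hroot
  obtain ⟨w, hw, e⟩ := hdvd a ha
  have hle : idealOrd 𝔞 T ≤ ∑ σ ∈ below C T, idealOrd 𝔞 σ := by
    simp only [excess] at h
    zify
    linarith
  -- The order of a at T does not exceed that of g, so the cofactor w is a unit and a generates the
  -- extended ideal.
  have hwm : w ∉ mx T := by
    intro hwm
    apply han
    rw [e]
    exact mpow_anti (Nat.succ_le_succ hle) (mul_mem_mpow hgn (by rw [mpow_one]; exact hwm))
  have haT := mem_of_le hroot (algebraMap_mem_root (K := K) a)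
  refine ⟨⟨⟨_, haT⟩, ?_⟩⟩
  rw [Ideal.submodule_span_eq]
  apply le_antisymm
  · rw [extend, Ideal.span_le]
    rintro t ⟨b, hb, eb⟩
    obtain ⟨w', hw', e'⟩ := hdvd b hb
    rw [SetLike.mem_coe, Ideal.mem_span_singleton]
    refine ⟨⟨w⁻¹ * w', mul_mem (inv_mem_of_notMem_mx hw hwm) hw'⟩, Subtype.ext ?_⟩
    change (t : K) = algebraMap R K a * (w⁻¹ * w')
    have hw0 := ne_zero_of_notMem_mx hwm
    rw [← eb, e', e]
    field_simp
  · rw [Ideal.span_singleton_le_iff_mem]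
    exact Ideal.subset_span ⟨a, ha, rfl⟩

lemma IsMinimalPrincipalization.ne_bot (hC : IsMinimalPrincipalization 𝔞 C) (hT : T ∈ C) :
    𝔞 ≠ ⊥ := by
  rintro rfl
  have h : IsPrincipalization (⊥ : Ideal R) (∅ : Finset (LocalSubring K)) := by
    refine ⟨fun S hS => by simp at hS, fun S _ => ?_⟩
    have : extend (⊥ : Ideal R) S = ⊥ := by
      rw [extend, Ideal.span_eq_bot]
      rintro t ⟨a, ha, e⟩
      rw [Ideal.mem_bot.1 ha, map_zero] at e
      exact Subtype.ext e.symm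
    rw [this]
    exact ⟨⟨0, by simp⟩⟩
  have := hC.2 h (Finset.empty_subset _) hT
  simp at this

/-- In a minimal principalization all the multiplicities of the ideal are positive. -/
lemma IsMinimalPrincipalization.excess_pos (hR : IsPoint (root R K))
    (hC : IsMinimalPrincipalization 𝔞 C) (hinj : Function.Injective (algebraMap R K))
    (hT : T ∈ C) : 0 < excess C (fun σ => (idealOrd 𝔞 σ : ℤ)) T := by
  classical
  by_contra! hn
  have hcl := hC.1.1
  have hpr := hcl.isPrincipal_of_excess_nonpos hR (hC.ne_bot hT) hinj hT hn
  -- Cut off T and everything over it. T becomes a closed point, where the ideal is already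
  -- principal; every other closed point was one before.
  set C' := C.filter fun S => ¬ IsInfNear T S with hC'
  have h : IsPrincipalization 𝔞 C' := by
    refine ⟨fun S hS => ?_, fun U hU => ?_⟩
    · obtain ⟨hSC, hST⟩ := Finset.mem_filter.1 hS
      refine ⟨(hcl S hSC).1, fun S' hS' hlt => Finset.mem_filter.2
        ⟨(hcl S hSC).2 S' hS' hlt, fun hc => hST (hc.trans hlt.to_reflTransGen)⟩⟩
    · obtain ⟨hU1, hU2, hU3⟩ := hU
      by_cases hUC : U ∈ C
      · have hTU : IsInfNear T U := by
          by_contra hc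
          exact hU2 (Finset.mem_filter.2 ⟨hUC, hc⟩)
        rcases hTU.eq_or with rfl | hlt
        · exact hpr
        · exact absurd Relation.ReflTransGen.refl
            (Finset.mem_filter.1 (hU3 T (hcl T hT).1 hlt)).2
      · exact hC.1.2 U ⟨hU1, hUC, fun S hS hlt => (Finset.mem_filter.1 (hU3 S hS hlt)).1⟩
  have := hC.2 h (Finset.filter_subset _ _) hT
  exact (Finset.mem_filter.1 this).2 Relation.ReflTransGen.refl

end IdealOrder

end ExcTree

/-! ### The intersection matrix, the dual graph and the canonical divisor. -/

namespace ExcTree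

open IsLocalRing Matrix

section Intersection

variable {K : Type*} [Field K]
variable {R : Type*} [CommRing R] [IsLocalRing R] [Algebra R K] {C : Finset (LocalSubring K)}

lemma proximityMatrix_self (μ : C) : proximityMatrix C μ μ = 1 := by simp [proximityMatrix]

lemma proximityMatrix_of_prox (hR : IsPoint (root R K)) (hC : IsCluster R C) {μ ν : C}
    (h : LiesOnStrictTransform μ.1 ν.1) : proximityMatrix C μ ν = -1 := by
  have hne : μ ≠ ν := fun e => h.ne (hC.isPoint hR ν.2) (congrArg Subtype.val e)
  simp [proximityMatrix, hne, h]

lemma proximityMatrix_of_not_prox {μ ν : C} (hne : μ ≠ ν)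
    (h : ¬ LiesOnStrictTransform μ.1 ν.1) : proximityMatrix C μ ν = 0 := by
  simp [proximityMatrix, hne, h]

lemma sum_below_eq (f : LocalSubring K → ℤ) (T : LocalSubring K) :
    ∑ σ ∈ below C T, f σ = ∑ ν : C, open Classical in
      if LiesOnStrictTransform T ν.1 then f ν.1 else 0 := by
  classical
  rw [below, Finset.sum_filter,
    Finset.sum_coe_sort C fun σ => if LiesOnStrictTransform T σ then f σ else 0]

lemma sum_above_eq (f : LocalSubring K → ℤ) (T : LocalSubring K) :
    ∑ σ ∈ above C T, f σ = ∑ ν : C, open Classical in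
      if LiesOnStrictTransform ν.1 T then f ν.1 else 0 := by
  classical
  rw [above, Finset.sum_filter,
    Finset.sum_coe_sort C fun σ => if LiesOnStrictTransform σ T then f σ else 0]

lemma proximityMatrix_mulVec (hR : IsPoint (root R K)) (hC : IsCluster R C)
    (f : LocalSubring K → ℤ) (μ : C) :
    (proximityMatrix C *ᵥ fun ν => f ν.1) μ = excess C f μ.1 := by
  classical
  rw [excess, sum_below_eq, Matrix.mulVec, dotProduct, ← Finset.add_sum_erase _ _
    (Finset.mem_univ μ), proximityMatrix_self, one_mul, ← Finset.add_sum_erase (a := μ)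
    (f := fun ν : C => if LiesOnStrictTransform μ.1 ν.1 then f ν.1 else 0) _
    (Finset.mem_univ μ), if_neg (fun h => h.ne (hC.isPoint hR μ.2) rfl), zero_add, sub_eq_add_neg,
    ← Finset.sum_neg_distrib]
  congr 1
  refine Finset.sum_congr rfl fun ν hν => ?_
  have hne := (Finset.ne_of_mem_erase hν).symm
  split_ifs with h
  · rw [proximityMatrix_of_prox hR hC h]; ring
  · rw [proximityMatrix_of_not_prox hne h]; ring

lemma proximityMatrix_transpose_mulVec (hR : IsPoint (root R K)) (hC : IsCluster R C)
    (g : LocalSubring K → ℤ) (γ : C) :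
    ((proximityMatrix C)ᵀ *ᵥ fun ν => g ν.1) γ = g γ.1 - ∑ T ∈ above C γ.1, g T := by
  classical
  rw [sum_above_eq, Matrix.mulVec, dotProduct, ← Finset.add_sum_erase _ _
    (Finset.mem_univ γ), Matrix.transpose_apply, proximityMatrix_self, one_mul,
    ← Finset.add_sum_erase (a := γ)
    (f := fun ν : C => if LiesOnStrictTransform ν.1 γ.1 then g ν.1 else 0) _
    (Finset.mem_univ γ), if_neg (fun h => h.ne (hC.isPoint hR γ.2) rfl), zero_add, sub_eq_add_neg,
    ← Finset.sum_neg_distrib]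
  congr 1
  refine Finset.sum_congr rfl fun ν hν => ?_
  have hne := Finset.ne_of_mem_erase hν
  rw [Matrix.transpose_apply]
  split_ifs with h
  · rw [proximityMatrix_of_prox hR hC h]; ring
  · rw [proximityMatrix_of_not_prox hne h]; ring

lemma intersectionMatrix_symm (μ ν : C) :
    intersectionMatrix C μ ν = intersectionMatrix C ν μ := by
  rw [intersectionMatrix, Matrix.neg_apply, Matrix.neg_apply, Matrix.mul_apply, Matrix.mul_apply]
  simp only [Matrix.transpose_apply]
  congr 1
  exact Finset.sum_congr rfl fun τ _ => mul_comm _ _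

/-- The intersection number of `∑ f ν E_ν` with `E_γ`. -/
lemma sum_mul_intersectionMatrix (hR : IsPoint (root R K)) (hC : IsCluster R C)
    (f : LocalSubring K → ℤ) (γ : C) :
    ∑ ν : C, f ν.1 * intersectionMatrix C ν γ =
      -(excess C f γ.1 - ∑ T ∈ above C γ.1, excess C f T) := by
  rw [← proximityMatrix_transpose_mulVec hR hC (excess C f) γ]
  have h1 : (fun ν : C => excess C f ν.1) = proximityMatrix C *ᵥ fun ν => f ν.1 :=
    funext fun ν => (proximityMatrix_mulVec hR hC f ν).symm
  rw [h1, Matrix.mulVec_mulVec, ← Pi.neg_apply, ← Matrix.neg_mulVec, Matrix.mulVec, dotProduct]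
  refine Finset.sum_congr rfl fun ν _ => ?_
  rw [intersectionMatrix_symm, mul_comm]
  rfl

/-- Immediately after μ is blown up, the two curves meet in a single point T. In the matrix product,
μ contributes −1 and T contributes +1 if it is blown up as well, which is precisely when the curves
are separated. -/
lemma intersectionMatrix_of_prox (hR : IsPoint (root R K)) (hC : IsCluster R C) {μ ν : C}
    (h : LiesOnStrictTransform μ.1 ν.1) :
    open Classical in
    intersectionMatrix C μ ν = if (dualGraph R C).Adj μ ν then 1 else 0 := by
  classical
  have hν := hC.isPoint hR ν.2
  have hμ := hC.isPoint hR μ.2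
  have hne : μ ≠ ν := fun e => h.ne hν (congrArg Subtype.val e)
  obtain ⟨T, hq, hTν⟩ := h.exists_next hν
  have hTμ := hq.liesOnStrictTransform hμ
  have hadj : (dualGraph R C).Adj μ ν ↔ T ∉ C := by
    constructor
    · rintro ⟨-, T', hT', h1, h2⟩
      rw [h.eq_of_both hν hTμ hTν h1 h2]
      exact hT'.2.1
    · intro hT
      refine ⟨hne, T, ⟨(hC _ μ.2).1.tail hq, hT, fun S hS hlt => ?_⟩, hTμ, hTν⟩
      rcases (IsStrictlyInfNear.isInfNear_of_isQuadraticTransform hR hS (hC _ μ.2).1 hlt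
        hq).eq_or with rfl | hlt'
      · exact μ.2
      · exact (hC _ μ.2).2 S hS hlt'
  rw [intersectionMatrix, Matrix.neg_apply, Matrix.mul_apply, ← Finset.add_sum_erase _ _
    (Finset.mem_univ μ)]
  simp only [Matrix.transpose_apply]
  rw [proximityMatrix_self, proximityMatrix_of_prox hR hC h]
  have hterm : ∀ τ ∈ Finset.univ.erase μ, proximityMatrix C τ μ * proximityMatrix C τ ν =
      if τ.1 = T then 1 else 0 := by
    intro τ hτ
    have hτμ := Finset.ne_of_mem_erase hτ
    by_cases h1 : LiesOnStrictTransform τ.1 μ.1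
    · have hτν : τ ≠ ν := by
        rintro rfl
        exact h.not_symm hν h1
      by_cases h2 : LiesOnStrictTransform τ.1 ν.1
      · rw [proximityMatrix_of_prox hR hC h1, proximityMatrix_of_prox hR hC h2,
          if_pos (h.eq_of_both hν h1 h2 hTμ hTν)]
        norm_num
      · rw [proximityMatrix_of_not_prox hτν h2, mul_zero, if_neg]
        rintro rfl
        exact h2 hTν
    · rw [proximityMatrix_of_not_prox hτμ h1, zero_mul, if_neg]
      rintro rfl
      exact h1 hTμ
  rw [Finset.sum_congr rfl hterm]
  by_cases hT : T ∈ C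
  · rw [if_neg (by rw [hadj]; exact not_not.2 hT), Finset.sum_eq_single ⟨T, hT⟩]
    · simp
    · intro b _ hb
      exact if_neg fun e => hb (Subtype.ext e)
    · intro hn
      exfalso
      apply hn
      rw [Finset.mem_erase]
      exact ⟨fun e => hTμ.ne hμ (congrArg Subtype.val e), Finset.mem_univ _⟩
  · rw [if_pos (hadj.2 hT), Finset.sum_eq_zero]
    · norm_num
    · intro τ _
      have : τ.1 ≠ T := fun e => hT (e ▸ τ.2)
      exact if_neg this

/-- Different exceptional curves meet transversally in at most one point. -/
lemma intersectionMatrix_of_ne (hR : IsPoint (root R K)) (hC : IsCluster R C) {μ ν : C}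
    (hne : μ ≠ ν) :
    open Classical in
    intersectionMatrix C μ ν = if (dualGraph R C).Adj μ ν then 1 else 0 := by
  classical
  have hν := hC.isPoint hR ν.2
  have hμ := hC.isPoint hR μ.2
  by_cases h1 : LiesOnStrictTransform μ.1 ν.1
  · exact intersectionMatrix_of_prox hR hC h1
  by_cases h2 : LiesOnStrictTransform ν.1 μ.1
  · rw [intersectionMatrix_symm, intersectionMatrix_of_prox hR hC h2]
    simp only [SimpleGraph.adj_comm]
  have hno : ∀ T, LiesOnStrictTransform T μ.1 → ¬ LiesOnStrictTransform T ν.1 := by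
    intro T hTμ hTν
    rcases LiesOnStrictTransform.or_of_ne hR (hC _ μ.2).1 (hC _ ν.2).1
      (fun e => hne (Subtype.ext e)) hTμ hTν with h | h
    · exact h1 h
    · exact h2 h
  rw [if_neg (by rintro ⟨-, T, -, h, h'⟩; exact hno T h h'), intersectionMatrix,
    Matrix.neg_apply, Matrix.mul_apply, neg_eq_zero]
  refine Finset.sum_eq_zero fun τ _ => ?_
  rw [Matrix.transpose_apply]
  rcases eq_or_ne τ μ with rfl | hτμ
  · rw [proximityMatrix_of_not_prox hne h1, mul_zero]
  rcases eq_or_ne τ ν with rfl | hτν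
  · rw [proximityMatrix_of_not_prox hne.symm h2, zero_mul]
  by_cases h : LiesOnStrictTransform τ.1 μ.1
  · rw [proximityMatrix_of_not_prox hτν (hno _ h), mul_zero]
  · rw [proximityMatrix_of_not_prox hτμ h, zero_mul]

lemma sum_mul_intersectionMatrix_eq (hR : IsPoint (root R K)) (hC : IsCluster R C)
    (f : C → ℤ) (γ : C) :
    ∑ ν : C, f ν * intersectionMatrix C ν γ =
      ∑ η ∈ neighbors R C γ, f η - weight C γ * f γ := by
  classical
  rw [← Finset.add_sum_erase _ _ (Finset.mem_univ γ), weight, neighbors, Finset.sum_filter,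
    ← Finset.add_sum_erase (a := γ) (f := fun η => if (dualGraph R C).Adj γ η then f η else 0) _
    (Finset.mem_univ γ), if_neg (SimpleGraph.irrefl _), zero_add]
  have : ∀ η ∈ Finset.univ.erase γ, f η * intersectionMatrix C η γ =
      if (dualGraph R C).Adj γ η then f η else 0 := by
    intro η hη
    rw [intersectionMatrix_symm, intersectionMatrix_of_ne hR hC (Finset.ne_of_mem_erase hη).symm]
    simp
  rw [Finset.sum_congr rfl this]
  ring

/-- E_γ is E*_γ minus the total transforms of the points proximate to γ, and each of these
contributes −1 to the self-intersection. -/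
lemma weight_eq (hR : IsPoint (root R K)) (hC : IsCluster R C) (γ : C) :
    weight C γ = 1 + (above C γ.1).card := by
  classical
  rw [weight, intersectionMatrix, Matrix.neg_apply, neg_neg, Matrix.mul_apply,
    ← Finset.add_sum_erase _ _ (Finset.mem_univ γ), Matrix.transpose_apply, proximityMatrix_self,
    Finset.card_eq_sum_ones]
  push_cast
  rw [sum_above_eq (fun _ => 1), ← Finset.add_sum_erase (a := γ)
    (f := fun ν : C => if LiesOnStrictTransform ν.1 γ.1 then (1 : ℤ) else 0) _
    (Finset.mem_univ γ), if_neg (fun h => h.ne (hC.isPoint hR γ.2) rfl), zero_add]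
  congr 1
  refine Finset.sum_congr rfl fun ν hν => ?_
  have hne := Finset.ne_of_mem_erase hν
  rw [Matrix.transpose_apply]
  split_ifs with h
  · rw [proximityMatrix_of_prox hR hC h]; ring
  · rw [proximityMatrix_of_not_prox hne h]; ring

/-- The proximity matrix is invertible. -/
lemma exists_proximityMatrix_mul_eq_one (hR : IsPoint (root R K)) (hC : IsCluster R C) :
    open Classical in
    ∃ B : Matrix C C ℤ, proximityMatrix C * B = 1 := by
  classical
  rw [← Matrix.mulVec_surjective_iff_exists_right_inverse]
  intro z
  -- Proximity refines strict domination, so the matrix is unitriangular and the system is solved by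
  -- well-founded recursion.
  let F : ∀ μ : C, (∀ ν : C, ν < μ → ℤ) → ℤ := fun μ f =>
    z μ + ∑ ν : C, if h : ν < μ ∧ LiesOnStrictTransform μ.1 ν.1 then f ν h.1 else 0
  let f : C → ℤ := (wellFounded_lt (α := C)).fix F
  have hf : ∀ μ, f μ = z μ + ∑ ν : C,
      if h : ν < μ ∧ LiesOnStrictTransform μ.1 ν.1 then f ν else 0 := fun μ =>
    (wellFounded_lt (α := C)).fix_eq F μ
  refine ⟨f, funext fun μ => ?_⟩
  let g : LocalSubring K → ℤ := fun T => if h : T ∈ C then f ⟨T, h⟩ else 0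
  have hg : (fun ν : C => g ν.1) = f := funext fun ν => by simp [g]
  rw [← hg, proximityMatrix_mulVec hR hC, excess, sum_below_eq]
  have : g μ.1 = z μ + ∑ ν : C, if LiesOnStrictTransform μ.1 ν.1 then g ν.1 else 0 := by
    rw [show g μ.1 = f μ from congrFun hg μ, hf μ]
    congr 1
    refine Finset.sum_congr rfl fun ν _ => ?_
    by_cases h : LiesOnStrictTransform μ.1 ν.1
    · have hlt : ν < μ := h.1.lt (hC.isPoint hR ν.2)
      rw [dif_pos ⟨hlt, h⟩, if_pos h]
      exact (congrFun hg ν).symm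
    · rw [dif_neg (fun hc => h hc.2), if_neg h]
  rw [this]
  ring

/-- The coefficients of the canonical divisor, extended by zero. -/
noncomputable def canonicalCoeff (C : Finset (LocalSubring K)) (T : LocalSubring K) : ℤ :=
  open Classical in if h : T ∈ C then kCoeff C ⟨T, h⟩ else 0

lemma canonicalCoeff_coe (γ : C) : canonicalCoeff C γ.1 = kCoeff C γ := by
  simp [canonicalCoeff]

/-- K is the sum of all total transforms, each with coefficient 1. This is the recursion k_T = 1 + Σ
k_σ over the σ to which T is proximate. -/
lemma excess_canonicalCoeff (hR : IsPoint (root R K)) (hC : IsCluster R C)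
    {T : LocalSubring K} (hT : T ∈ C) : excess C (canonicalCoeff C) T = 1 := by
  classical
  obtain ⟨B, hB⟩ := exists_proximityMatrix_mul_eq_one hR hC
  have hinv : proximityMatrix C * (proximityMatrix C)⁻¹ = 1 := by
    rw [Matrix.inv_eq_right_inv hB, hB]
  have h1 := proximityMatrix_mulVec hR hC (canonicalCoeff C) ⟨T, hT⟩
  rw [← h1]
  have : (fun ν : C => canonicalCoeff C ν.1) = (proximityMatrix C)⁻¹ *ᵥ 1 := by
    funext ν
    rw [canonicalCoeff_coe, kCoeff, Matrix.mulVec, dotProduct]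
    simp only [Pi.one_apply, mul_one]
  rw [this, Matrix.mulVec_mulVec, hinv, Matrix.one_mulVec]
  rfl

end Intersection

end ExcTree

/-! ### The base point. -/

namespace ExcTree

open IsLocalRing

section Root

variable {K : Type*} [Field K]

/-- Two generators of the maximal ideal of a two-dimensional Noetherian local domain form a
regular sequence. -/
lemma isParams_of_span_eq {S : LocalSubring K} [IsNoetherianRing S.toSubring]
    (hdim : ringKrullDim S.toSubring = 2) (x y : S.toSubring)
    (hxy : Ideal.span {x, y} = maximalIdeal S.toSubring) : IsParams S x y := by
  have hx : x ∈ maximalIdeal S.toSubring := hxy ▸ Ideal.subset_span (by simp)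
  have hy : y ∈ maximalIdeal S.toSubring := hxy ▸ Ideal.subset_span (by simp)
  have hspan : ∀ z ∈ mx S, ∃ a ∈ S.toSubring, ∃ b ∈ S.toSubring, z = a * (x : K) + b * y := by
    rintro z ⟨hz, hz'⟩
    rw [← hxy, Ideal.mem_span_pair] at hz'
    obtain ⟨a, b, e⟩ := hz'
    exact ⟨a, a.2, b, b.2, (congrArg Subtype.val e).symm⟩
  -- no power of one generator is divisible by the other one
  have hmin : ∀ u v : S.toSubring, u ∈ maximalIdeal S.toSubring →
      Ideal.span {u, v} = maximalIdeal S.toSubring → ∀ n, ¬ u ∣ v ^ n := by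
    intro u v hu huv n hd
    have hmem : maximalIdeal S.toSubring ∈ (Ideal.span {u}).minimalPrimes := by
      refine ⟨⟨inferInstance, (Ideal.span_singleton_le_iff_mem _).2 hu⟩, fun P hP _ => ?_⟩
      have := hP.1
      have huP : u ∈ P := (Ideal.span_singleton_le_iff_mem _).1 hP.2
      rw [← huv, Ideal.span_le, Set.insert_subset_iff, Set.singleton_subset_iff]
      exact ⟨huP, this.mem_of_pow_mem n (P.mem_of_dvd hd huP)⟩
    -- If u divided a power of v, the maximal ideal would be minimal over u, against Krull's
    -- principal ideal theorem in dimension two.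
    have h1 := Ideal.height_le_one_of_isPrincipal_of_mem_minimalPrimes _ _ hmem
    have h2 := maximalIdeal_height_eq_ringKrullDim (R := S.toSubring)
    rw [hdim] at h2
    have h3 : (maximalIdeal S.toSubring).height = 2 := WithBot.coe_inj.1 (h2.trans rfl)
    rw [h3] at h1
    exact absurd h1 (by decide)
  have hyx : Ideal.span {y, x} = maximalIdeal S.toSubring := by rw [Set.pair_comm, hxy]
  refine ⟨fun h0 => ?_, fun h0 => ?_, coe_mem_mx.2 hx, coe_mem_mx.2 hy, hspan, ?_⟩
  · exact hmin y x hy hyx 1 (by rw [show x = 0 from Subtype.ext h0]; simp)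
  · exact hmin x y hx hxy 1 (by rw [show y = 0 from Subtype.ext h0]; simp)
  · intro a ha b hb e
    by_contra hn
    obtain ⟨m, c, hc, w, hw, hwm, eb⟩ := exists_eq_add_pow_mul_of_span (coe_mem_mx.2 hx)
      (coe_mem_mx.2 hy) hspan hb (by
        rintro ⟨w, hw, ew⟩
        exact hn ⟨w, hw, by rw [ew, mul_comm]⟩)
    have hwi := inv_mem_of_notMem_mx hw hwm
    have hw0 := ne_zero_of_notMem_mx hwm
    -- From ax = by and b = xc + y ^ m w with w a unit, y ^ (m + 1) becomes a multiple of x.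
    refine hmin x y hx hxy (m + 1) ⟨(⟨a, ha⟩ - ⟨c, hc⟩ * y) * ⟨w⁻¹, hwi⟩, Subtype.ext ?_⟩
    change (y : K) ^ (m + 1) = x * ((a - c * y) * w⁻¹)
    rw [eb] at e
    field_simp
    linear_combination -e

open Polynomial in
lemma isAlgClosed_of_ringEquiv {k k' : Type*} [Field k] [Field k'] [IsAlgClosed k]
    (e : k ≃+* k') : IsAlgClosed k' := by
  refine IsAlgClosed.of_exists_root k' fun p _ hp => ?_
  have hdeg : (p.map (e.symm : k' →+* k)).degree ≠ 0 := by
    rw [degree_map]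
    exact hp.degree_pos.ne'
  obtain ⟨r, hr⟩ := IsAlgClosed.exists_root _ hdeg
  refine ⟨e r, e.symm.injective ?_⟩
  have h := eval₂_at_apply (p := p) (e.symm : k' →+* k) (e r)
  rw [RingEquiv.coe_toRingHom, e.symm_apply_apply, ← eval_map, hr.eq_zero] at h
  rw [map_zero, ← h]

lemma isPoint_root {R : Type*} [CommRing R] [IsRegularLocalRing R] [Algebra R K]
    (hinj : Function.Injective (algebraMap R K)) (hdim : ringKrullDim R = 2)
    (hres : IsAlgClosed (ResidueField R)) : IsPoint (root R K) := by
  let f : R →+* (root R K).toSubring := (algebraMap R K).codRestrict _ algebraMap_mem_root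
  have hf : Function.Bijective f := by
    refine ⟨fun a b h => hinj (congrArg Subtype.val h), ?_⟩
    rintro ⟨z, hz⟩
    rw [root, LocalSubring.range_toSubring] at hz
    obtain ⟨a, rfl⟩ := hz
    exact ⟨a, rfl⟩
  let e : R ≃+* (root R K).toSubring := RingEquiv.ofBijective f hf
  have hreg : IsRegularLocalRing (root R K).toSubring := IsRegularLocalRing.of_ringEquiv e
  have hd : ringKrullDim (root R K).toSubring = 2 := by
    rw [← ringKrullDim_eq_of_ringEquiv e, hdim]
  refine ⟨inferInstance, isAlgClosed_of_ringEquiv (ResidueField.mapEquiv e), ?_⟩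
  have h2 := hreg.spanFinrank_maximalIdeal
  rw [hd] at h2
  obtain ⟨s, hs, hs'⟩ := Submodule.FG.exists_span_finset_card_eq_spanFinrank
    (IsNoetherian.noetherian (maximalIdeal (root R K).toSubring))
  have hc : s.card = 2 := by
    rw [hs]
    exact_mod_cast h2
  classical
  obtain ⟨x, y, -, rfl⟩ := Finset.card_eq_two.1 hc
  refine ⟨x, y, isParams_of_span_eq hd x y ?_⟩
  rw [← hs', Finset.coe_pair]

end Root

/-! ### Inequalities between k and d, antinefness and adjunction. -/

section Discrepancy

variable {K : Type*} [Field K]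
variable {R : Type*} [CommRing R] [IsLocalRing R] [Algebra R K] {C : Finset (LocalSubring K)}

lemma IsCluster.induction (hR : IsPoint (root R K)) (hC : IsCluster R C)
    {motive : LocalSubring K → Prop}
    (step : ∀ T ∈ C, (∀ σ ∈ C, IsStrictlyInfNear σ T → motive σ) → motive T) :
    ∀ T ∈ C, motive T := by
  intro T hT
  have key : ∀ τ : C, motive τ.1 := by
    intro τ
    induction τ using (wellFounded_lt (α := C)).induction with
    | _ τ ih =>
      exact step τ.1 τ.2 fun σ hσ hlt => ih ⟨σ, hσ⟩ (hlt.lt (hC.isPoint hR hσ))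
  exact key ⟨T, hT⟩

section

variable {k d : LocalSubring K → ℤ}

lemma IsCluster.one_le_of_excess_eq (hR : IsPoint (root R K)) (hC : IsCluster R C)
    (hk : ∀ T ∈ C, excess C k T = 1) : ∀ T ∈ C, 1 ≤ k T := by
  refine hC.induction hR fun T hT ih => ?_
  have h1 := hk T hT
  have h2 : 0 ≤ ∑ σ ∈ below C T, k σ := Finset.sum_nonneg fun σ hσ =>
    zero_le_one.trans (ih σ (mem_below.1 hσ).1 (mem_below.1 hσ).2.1)
  rw [excess] at h1
  omega

lemma IsCluster.pos_of_excess_pos (hR : IsPoint (root R K)) (hC : IsCluster R C)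
    (hd : ∀ T ∈ C, 0 < excess C d T) : ∀ T ∈ C, 0 < d T := by
  refine hC.induction hR fun T hT ih => ?_
  have h1 := hd T hT
  have h2 : 0 ≤ ∑ σ ∈ below C T, d σ := Finset.sum_nonneg fun σ hσ =>
    (ih σ (mem_below.1 hσ).1 (mem_below.1 hσ).2.1).le
  rw [excess] at h1
  omega

/-- A quadratic transform of p is proximate to p, and the multiplicities are positive, so the
proximity inequality bounds each of them by that of p. -/
lemma IsCluster.excess_anti (hR : IsPoint (root R K)) (hC : IsCluster R C)
    (hd : ∀ T ∈ C, 0 < excess C d T)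
    (hnef : ∀ T ∈ C, ∑ σ ∈ above C T, excess C d σ ≤ excess C d T)
    {p η : LocalSubring K} (hp : p ∈ C) (hη : η ∈ C) (h : IsStrictlyInfNear p η) :
    excess C d η ≤ excess C d p := by
  have hstep : ∀ p ∈ C, ∀ η ∈ C, IsQuadraticTransform p η → excess C d η ≤ excess C d p := by
    intro p hp η hη h
    refine le_trans ?_ (hnef p hp)
    exact Finset.single_le_sum (f := excess C d) (fun σ hσ => (hd σ (mem_above.1 hσ).1).le)
      (mem_above.2 ⟨hη, h.liesOnStrictTransform (hC.isPoint hR hp)⟩)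
  induction h with
  | single h => exact hstep p hp _ hη h
  | @tail b c hpb hbc ih =>
    have hb : b ∈ C := (hC c hη).2 b ((hC p hp).1.trans hpb.to_reflTransGen)
      (Relation.TransGen.single hbc)
    exact (hstep b hb c hη hbc).trans (ih hb)

/-- With k_p = 1 + Σ k_σ and d_p = r_p + Σ d_σ, compare term by term: r_η ≤ r_p, and k_σ r_η ≤ d_σ
by induction, since η also lies over σ. -/
lemma IsCluster.mul_excess_le (hR : IsPoint (root R K)) (hC : IsCluster R C)
    (hk : ∀ T ∈ C, excess C k T = 1) (hd : ∀ T ∈ C, 0 < excess C d T)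
    (hnef : ∀ T ∈ C, ∑ σ ∈ above C T, excess C d σ ≤ excess C d T) :
    ∀ p ∈ C, ∀ η ∈ C, IsStrictlyInfNear p η → k p * excess C d η ≤ d p := by
  refine hC.induction hR fun p hp ih η hη hlt => ?_
  have h1 := hC.excess_anti hR hd hnef hp hη hlt
  have h2 : k p = 1 + ∑ σ ∈ below C p, k σ := by
    have := hk p hp
    rw [excess] at this
    omega
  have h3 : d p = excess C d p + ∑ σ ∈ below C p, d σ := by rw [excess]; ring
  rw [h2, h3, add_mul, one_mul, Finset.sum_mul]
  refine add_le_add h1 (Finset.sum_le_sum fun σ hσ => ?_)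
  obtain ⟨hσC, hσ'⟩ := mem_below.1 hσ
  exact ih σ hσC hσ'.1 η hη (hσ'.1.trans hlt)

/-- For two meeting exceptional curves, `k_q / d_q < (k_p + 1) / d_p`. -/
lemma IsCluster.mul_lt_mul_of_prox (hR : IsPoint (root R K)) (hC : IsCluster R C)
    (hk : ∀ T ∈ C, excess C k T = 1) (hd : ∀ T ∈ C, 0 < excess C d T)
    (hnef : ∀ T ∈ C, ∑ σ ∈ above C T, excess C d σ ≤ excess C d T) :
    ∀ η ∈ C, ∀ γ ∈ C, LiesOnStrictTransform η γ →
      k η * d γ < (k γ + 1) * d η ∧ k γ * d η < (k η + 1) * d γ := by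
  classical
  have hk1 := hC.one_le_of_excess_eq hR hk
  have hd0 := hC.pos_of_excess_pos hR hd
  refine hC.induction hR fun η hη ih γ hγ h => ?_
  obtain ⟨p, hpC, hpη, hγp⟩ := hC.exists_parent hη (hC γ hγ).1 h.1
  have hrη := hd η hη
  have hpη' := Relation.TransGen.single hpη
  have hkp := hk1 p hpC
  have hdp := hd0 p hpC
  have hkd := hC.mul_excess_le hR hk hd hnef p hpC η hη hpη'
  have hkη := hk η hη
  have hdη : excess C d η = d η - ∑ σ ∈ below C η, d σ := rfl
  have hmem : γ ∈ below C η := mem_below.2 ⟨hγ, h⟩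
  rw [excess] at hkη
  -- A free point is proximate to its parent alone: k_η = k_γ + 1 and d_η = d_γ + r_η, and k_γ r_η ≤
  -- d_γ suffices.
  rcases hC.below_cases hR hpC hpη with hb | ⟨σ, hσC, hne, hpσ, hησ, hb⟩
  · rw [hb, Finset.mem_singleton] at hmem
    subst hmem
    rw [hb, Finset.sum_singleton] at hkη hdη
    have e1 : k η = k γ + 1 := by omega
    have e2 : d η = d γ + excess C d η := by omega
    rw [e1, e2]
    constructor
    · nlinarith
    · nlinarith
  · rw [hb, Finset.sum_pair hne.symm] at hkη hdη
    rw [hb, Finset.mem_insert, Finset.mem_singleton] at hmem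
    have e1 : k η = k p + k σ + 1 := by omega
    have e2 : d η = d p + d σ + excess C d η := by omega
    -- A satellite point is proximate to p and σ, with p proximate to σ. After the common terms
    -- cancel, the inductive inequalities for this pair and k r_η ≤ d at p and σ remain.
    obtain ⟨i1, i2⟩ := ih p hpC hpη' σ hσC hpσ
    have hkσ := hk1 σ hσC
    have hdσ := hd0 σ hσC
    have hkdσ := hC.mul_excess_le hR hk hd hnef σ hσC η hη hησ.1
    rcases hmem with rfl | rfl
    · rw [e1, e2]
      constructor
      · nlinarith
      · nlinarith
    · rw [e1, e2]
      constructor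
      · nlinarith
      · nlinarith

end

variable {𝔞 : Ideal R}

lemma dHat_eq (hR : IsPoint (root R K)) (hC : IsCluster R C) (γ : C) :
    dHat 𝔞 γ = weight C γ * dCoeff 𝔞 γ - ∑ η ∈ neighbors R C γ, (dCoeff 𝔞 η : ℤ) := by
  rw [dHat, sum_mul_intersectionMatrix_eq hR hC (fun ν => (dCoeff 𝔞 ν : ℤ))]
  ring

lemma dHat_eq_excess (hR : IsPoint (root R K)) (hC : IsCluster R C) (γ : C) :
    dHat 𝔞 γ = excess C (fun σ => (idealOrd 𝔞 σ : ℤ)) γ.1 -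
      ∑ T ∈ above C γ.1, excess C (fun σ => (idealOrd 𝔞 σ : ℤ)) T := by
  have := sum_mul_intersectionMatrix hR hC (fun σ => (idealOrd 𝔞 σ : ℤ)) γ
  rw [← neg_eq_iff_eq_neg] at this
  exact this

/-- The divisor of an ideal is antinef. -/
lemma dHat_nonneg (hR : IsPoint (root R K)) (hC : IsCluster R C)
    (hinj : Function.Injective (algebraMap R K)) (h𝔞 : 𝔞 ≠ ⊥) (γ : C) : 0 ≤ dHat 𝔞 γ := by
  have hle : ∀ {T}, T ∈ C → root R K ≤ T := fun hT => (hC _ hT).1.le hR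
  -- Choose a of minimal order at γ. Its orders at the neighbours can only be larger than those of
  -- the ideal, so d̂_γ is at least the corresponding number for a, which is nonnegative.
  obtain ⟨a, ha, ha0, -, hao⟩ := exists_ordAt_eq h𝔞 hinj (hC.isPoint hR γ.2) (hle γ.2)
  have h1 := sum_above_excess_le hR hC γ.2 (algebraMap_mem_root a) ha0
  have h2 := sum_mul_intersectionMatrix hR hC (fun T => (ordAt T (algebraMap R K a) : ℤ)) γ
  rw [sum_mul_intersectionMatrix_eq hR hC (fun ν => (ordAt ν.1 (algebraMap R K a) : ℤ))] at h2
  have h3 : ∑ η ∈ neighbors R C γ, (dCoeff 𝔞 η : ℤ) ≤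
      ∑ η ∈ neighbors R C γ, (ordAt η.1 (algebraMap R K a) : ℤ) := by
    refine Finset.sum_le_sum fun η _ => ?_
    exact_mod_cast le_ordAt (hC.isPoint hR η.2) ha0
      (mem_mpow_idealOrd h𝔞 hinj (hC.isPoint hR η.2) (hle η.2) ha)
  have h4 : (dCoeff 𝔞 γ : ℤ) = ordAt γ.1 (algebraMap R K a) := by
    rw [hao]; rfl
  rw [dHat_eq hR hC, h4]
  linarith

/-- The adjunction formula. -/
lemma sum_neighbors_kCoeff (hR : IsPoint (root R K)) (hC : IsCluster R C) (γ : C) :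
    ∑ η ∈ neighbors R C γ, kCoeff C η = weight C γ * kCoeff C γ + weight C γ - 2 := by
  have h1 := sum_mul_intersectionMatrix hR hC (canonicalCoeff C) γ
  have h2 := sum_mul_intersectionMatrix_eq hR hC (fun ν => canonicalCoeff C ν.1) γ
  have h3 : ∑ T ∈ above C γ.1, excess C (canonicalCoeff C) T = (above C γ.1).card := by
    rw [Finset.sum_congr rfl fun T hT => excess_canonicalCoeff hR hC (mem_above.1 hT).1]
    simp
  rw [h1, h3, excess_canonicalCoeff hR hC γ.2] at h2
  simp only [canonicalCoeff_coe] at h2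
  have := weight_eq hR hC γ
  linarith

/-- Without neighbours, adjunction reads w(k + 1) = 2, so w = k = 1. Then no point of C is proximate
to γ, and γ to none, which leaves γ as the only point. -/
lemma neighbors_nonempty (hR : IsPoint (root R K)) (hC : IsCluster R C) (hcard : 1 < C.card)
    (γ : C) : (neighbors R C γ).Nonempty := by
  rw [Finset.nonempty_iff_ne_empty]
  intro he
  have hk := fun T hT => excess_canonicalCoeff hR hC (T := T) hT
  have hk1 := hC.one_le_of_excess_eq hR hk
  have h1 := sum_neighbors_kCoeff hR hC γ
  have hw := weight_eq hR hC γ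
  have hkγ := hk1 γ.1 γ.2
  rw [canonicalCoeff_coe] at hkγ
  rw [he, Finset.sum_empty] at h1
  have hw1 : weight C γ = 1 := by nlinarith
  have hkγ1 : kCoeff C γ = 1 := by rw [hw1] at h1; linarith
  have hab : above C γ.1 = ∅ := by
    rw [← Finset.card_eq_zero]
    omega
  have hbe : below C γ.1 = ∅ := by
    by_contra hne
    have h2 := hk γ.1 γ.2
    rw [excess, canonicalCoeff_coe, hkγ1] at h2
    obtain ⟨σ, hσ⟩ := Finset.nonempty_iff_ne_empty.2 hne
    have h3 := Finset.single_le_sum (f := canonicalCoeff C)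
      (fun τ hτ => zero_le_one.trans (hk1 τ (mem_below.1 hτ).1)) hσ
    have h4 := hk1 σ (mem_below.1 hσ).1
    omega
  have hroot : root R K = γ.1 := by
    rcases (hC γ.1 γ.2).1.eq_or with h | h
    · exact h
    · obtain ⟨p, hpC, hpγ, -⟩ := hC.exists_parent γ.2 Relation.ReflTransGen.refl h
      have : p ∈ below C γ.1 := mem_below.2
        ⟨hpC, hpγ.liesOnStrictTransform (hC.isPoint hR hpC)⟩
      rw [hbe] at this
      simp at this
  obtain ⟨T, hT, hne⟩ := Finset.exists_mem_ne hcard γ.1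
  have hlt : IsStrictlyInfNear γ.1 T := by
    have := (hC T hT).1
    rw [hroot] at this
    exact this.eq_or.resolve_left hne.symm
  obtain ⟨S, hγS, hST⟩ := Relation.TransGen.head'_iff.1 hlt
  have hSC : S ∈ C := by
    rcases IsInfNear.eq_or hST with rfl | h
    · exact hT
    · exact (hC T hT).2 S ((hC _ γ.2).1.tail hγS) h
  have : S ∈ above C γ.1 := mem_above.2 ⟨hSC, hγS.liesOnStrictTransform (hC.isPoint hR γ.2)⟩
  rw [hab] at this
  simp at this

end Discrepancy

end ExcTree

/-! ### Rounding rational lower bounds to natural numbers with prescribed sum. -/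

namespace ExcTree

section Rounding

variable {ι : Type*} {ρ : ι → ℚ}

lemma floor_sum_lt {N : Finset ι} {t : ℤ} (h : ∑ η ∈ N, ρ η + N.card < t + 1) :
    ∑ η ∈ N, (⌊ρ η⌋ + 1) ≤ t := by
  have h1 : ((∑ η ∈ N, (⌊ρ η⌋ + 1) : ℤ) : ℚ) ≤ ∑ η ∈ N, ρ η + N.card := by
    push_cast
    rw [Finset.sum_add_distrib, Finset.sum_const, nsmul_eq_mul, mul_one]
    exact add_le_add_left (Finset.sum_le_sum fun η _ => Int.floor_le _) _
  have h2 : ((∑ η ∈ N, (⌊ρ η⌋ + 1) : ℤ) : ℚ) < ((t + 1 : ℤ) : ℚ) := by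
    push_cast at h1 ⊢
    linarith
  have h3 : ∑ η ∈ N, (⌊ρ η⌋ + 1) < t + 1 := by exact_mod_cast h2
  omega

/-- One fractional part that does not vanish supplies the strictness needed to gain a unit by
integrality. -/
lemma floor_sum_lt_of_ne {N : Finset ι} {t : ℤ} {η₀ : ι} (h₀ : η₀ ∈ N)
    (hne : (⌊ρ η₀⌋ : ℚ) ≠ ρ η₀) (h : ∑ η ∈ N, ρ η + N.card ≤ t + 1) :
    ∑ η ∈ N, (⌊ρ η⌋ + 1) ≤ t := by
  have h1 : ((∑ η ∈ N, (⌊ρ η⌋ + 1) : ℤ) : ℚ) < ∑ η ∈ N, ρ η + N.card := by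
    push_cast
    rw [Finset.sum_add_distrib, Finset.sum_const, nsmul_eq_mul, mul_one]
    refine add_lt_add_left (Finset.sum_lt_sum (fun η _ => Int.floor_le _)
      ⟨η₀, h₀, lt_of_le_of_ne (Int.floor_le _) hne⟩) _
  have h2 : ((∑ η ∈ N, (⌊ρ η⌋ + 1) : ℤ) : ℚ) < ((t + 1 : ℤ) : ℚ) := by
    push_cast at h1 ⊢
    linarith
  have h3 : ∑ η ∈ N, (⌊ρ η⌋ + 1) < t + 1 := by exact_mod_cast h2
  omega

variable [DecidableEq ι] {N : Finset ι}

/-- Natural numbers with a given sum, each larger than a given rational number. -/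
lemma exists_sum_eq_of_floor_sum_le (hN : N.Nonempty) (hρ : ∀ η ∈ N, -1 < ρ η) {t : ℤ}
    (h : ∑ η ∈ N, (⌊ρ η⌋ + 1) ≤ t) :
    ∃ b : ι → ℕ, ∑ η ∈ N, (b η : ℤ) = t ∧ ∀ η ∈ N, ρ η < b η := by
  obtain ⟨η₀, h₀⟩ := hN
  have hfl : ∀ η ∈ N, 0 ≤ ⌊ρ η⌋ + 1 := by
    intro η hη
    have : -1 ≤ ⌊ρ η⌋ := Int.le_floor.2 (by push_cast; exact (hρ η hη).le)
    omega
  set s := t - ∑ η ∈ N, (⌊ρ η⌋ + 1) with hs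
  have hs0 : 0 ≤ s := by omega
  -- Take the least integer above each bound and give the whole surplus to η₀. The bounds exceed −1,
  -- so every value is nonnegative.
  set f : ι → ℤ := fun η => ⌊ρ η⌋ + 1 + if η = η₀ then s else 0 with hf
  have hf0 : ∀ η ∈ N, 0 ≤ f η := by
    intro η hη
    have := hfl η hη
    simp only [hf]
    split_ifs <;> omega
  refine ⟨fun η => (f η).toNat, ?_, fun η hη => ?_⟩
  · rw [Finset.sum_congr rfl fun η hη => Int.toNat_of_nonneg (hf0 η hη)]
    simp only [hf]
    rw [Finset.sum_add_distrib, Finset.sum_ite_eq' N η₀, if_pos h₀]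
    omega
  · have h1 : (((f η).toNat : ℤ) : ℚ) = (f η : ℚ) := by
      rw [Int.toNat_of_nonneg (hf0 η hη)]
    rw [Int.cast_natCast] at h1
    rw [h1]
    have h2 : ⌊ρ η⌋ + 1 ≤ f η := by
      simp only [hf]
      split_ifs <;> omega
    exact (Int.lt_floor_add_one _).trans_le (by exact_mod_cast h2)

variable {W : ℤ} {δ : ℚ}

/-- Completing a prescribed small value at one index. -/
lemma exists_extend_of_lt (hρ : ∀ η ∈ N, -1 < ρ η)
    (hsum : ∑ η ∈ N, ρ η = W + 2 - N.card - δ) (hN : 1 < N.card) {η₁ : ι} (h₁ : η₁ ∈ N) {c₁ : ℕ}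
    (hc : c₁ < ρ η₁ + δ) :
    ∃ b : ι → ℕ, b η₁ = c₁ ∧ W = ∑ η ∈ N, (b η : ℤ) ∧ ∀ η ∈ N, η ≠ η₁ → ρ η < b η := by
  have hcard : ((N.erase η₁).card : ℚ) = N.card - 1 := by
    rw [Finset.card_erase_of_mem h₁, Nat.cast_sub hN.le]; simp
  have hne : (N.erase η₁).Nonempty := by
    rw [← Finset.card_pos, Finset.card_erase_of_mem h₁]; omega
  rw [← Finset.add_sum_erase _ _ h₁] at hsum
  -- The remaining bounds plus their number add up to W + 1 − δ − ρ η₁, which is less than (W − c₁)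
  -- + 1 because c₁ < ρ η₁ + δ.
  obtain ⟨b, hb, hb'⟩ := exists_sum_eq_of_floor_sum_le hne
    (fun η hη => hρ η (Finset.mem_of_mem_erase hη)) (t := W - c₁)
    (floor_sum_lt (by rw [hcard]; push_cast; linarith))
  refine ⟨Function.update b η₁ c₁, by simp, ?_, fun η hη hne => ?_⟩
  · rw [← Finset.add_sum_erase _ _ h₁, Function.update_self,
      Finset.sum_congr rfl fun η hη => by rw [Function.update_of_ne (Finset.ne_of_mem_erase hη)],
      hb]
    ring
  · rw [Function.update_of_ne hne]
    exact hb' η (Finset.mem_erase.2 ⟨hne, hη⟩)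

/-- Completing prescribed exact values at two indices. -/
lemma exists_extend_of_eq_of_eq (hρ : ∀ η ∈ N, -1 < ρ η)
    (hsum : ∑ η ∈ N, ρ η = W + 2 - N.card - δ) (hδ : 0 ≤ δ) {η₁ η₂ : ι}
    (h₁ : η₁ ∈ N) (h₂ : η₂ ∈ N) (hne : η₂ ≠ η₁) {c₁ c₂ : ℕ} (hc₁ : c₁ = ρ η₁) (hc₂ : c₂ = ρ η₂) :
    ∃ b : ι → ℕ, b η₁ = c₁ ∧ (2 < N.card ∨ δ = 0 → b η₂ = c₂) ∧ W = ∑ η ∈ N, (b η : ℤ) ∧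
      ρ η₂ ≤ b η₂ ∧ ∀ η ∈ N, η ≠ η₁ → η ≠ η₂ → ρ η < b η := by
  have h₂' : η₂ ∈ N.erase η₁ := Finset.mem_erase.2 ⟨hne, h₂⟩
  set M := (N.erase η₁).erase η₂ with hM
  have hcM : M.card + 2 = N.card := by
    have h3 := Finset.card_erase_add_one h₁
    have h4 := Finset.card_erase_add_one h₂'
    rw [← hM] at h4
    omega
  have hcMq : (N.card : ℚ) = M.card + 2 := by exact_mod_cast hcM.symm
  have hsplit : ∀ f : ι → ℚ, ∑ η ∈ N, f η = f η₁ + (f η₂ + ∑ η ∈ M, f η) := fun f => by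
    rw [← Finset.add_sum_erase _ _ h₁, ← Finset.add_sum_erase _ _ h₂']
  have hsplitZ : ∀ f : ι → ℤ, ∑ η ∈ N, f η = f η₁ + (f η₂ + ∑ η ∈ M, f η) := fun f => by
    rw [← Finset.add_sum_erase _ _ h₁, ← Finset.add_sum_erase _ _ h₂']
  rw [hsplit, ← hc₁, ← hc₂, hcMq] at hsum
  have hmemM : ∀ {η}, η ∈ M ↔ η ≠ η₂ ∧ η ≠ η₁ ∧ η ∈ N := by
    intro η; rw [hM, Finset.mem_erase, Finset.mem_erase]
  -- With only two indices the value at η₂ is forced to be W − c₁ = c₂ + δ; this is c₂ only if δ =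
  -- 0. With a third index, the slack can be placed there.
  rcases M.eq_empty_or_nonempty with he | hMn
  · rw [he, Finset.sum_empty, Finset.card_empty] at hsum
    push_cast at hsum
    have hW : (c₂ : ℤ) ≤ W - c₁ := by
      have : (c₂ : ℚ) ≤ W - c₁ := by linarith
      exact_mod_cast this
    have hW0 : 0 ≤ W - c₁ := le_trans (by positivity) hW
    set b : ι → ℕ := Function.update (fun _ => (W - c₁).toNat) η₁ c₁ with hb
    have hb₁ : b η₁ = c₁ := by simp [hb]
    have hb₂ : (b η₂ : ℤ) = W - c₁ := by
      rw [hb, Function.update_of_ne hne, Int.toNat_of_nonneg hW0]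
    refine ⟨b, hb₁, fun h => ?_, ?_, ?_, fun η hη h3 h4 => ?_⟩
    · rcases h with h | h
      · rw [he, Finset.card_empty] at hcM
        omega
      · have : (c₂ : ℚ) = W - c₁ := by linarith
        have : (c₂ : ℤ) = W - c₁ := by exact_mod_cast this
        omega
    · rw [hsplitZ, he, Finset.sum_empty, hb₁, hb₂]
      ring
    · rw [← hc₂]
      have : (c₂ : ℤ) ≤ b η₂ := by omega
      exact_mod_cast this
    · have : η ∈ M := hmemM.2 ⟨h4, h3, hη⟩
      rw [he] at this
      simp at this
  · obtain ⟨b, hb, hb'⟩ := exists_sum_eq_of_floor_sum_le hMn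
      (fun η hη => hρ η (hmemM.1 hη).2.2) (t := W - c₁ - c₂)
      (floor_sum_lt (by push_cast; linarith))
    refine ⟨Function.update (Function.update b η₂ c₂) η₁ c₁, by simp, fun _ => ?_, ?_, ?_,
      fun η hη h3 h4 => ?_⟩
    · rw [Function.update_of_ne hne]; simp
    · rw [hsplitZ, Function.update_self, Function.update_of_ne hne, Function.update_self,
        Finset.sum_congr rfl fun η hη => by
          rw [Function.update_of_ne (hmemM.1 hη).2.1, Function.update_of_ne (hmemM.1 hη).1], hb]
      ring
    · rw [Function.update_of_ne hne, Function.update_self, hc₂]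
    · rw [Function.update_of_ne h3, Function.update_of_ne h4]
      exact hb' η (hmemM.2 ⟨h4, h3, hη⟩)

/-- Completing a prescribed exact value at one index. -/
lemma exists_extend_of_eq (hρ : ∀ η ∈ N, -1 < ρ η)
    (hsum : ∑ η ∈ N, ρ η = W + 2 - N.card - δ) (hδ : 0 ≤ δ) (hN : 1 < N.card)
    {η₁ : ι} (h₁ : η₁ ∈ N) {c₁ : ℕ} (hc₁ : c₁ = ρ η₁) :
    ∃ b : ι → ℕ, b η₁ = c₁ ∧ W = ∑ η ∈ N, (b η : ℤ) ∧
      (∀ η ∈ N, η ≠ η₁ → ρ η ≤ b η) ∧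
      {η | η ∈ N ∧ η ≠ η₁ ∧ ¬ ρ η < b η}.Subsingleton := by
  -- If some other bound is a natural number, meet it exactly and make the rest strict. Otherwise no
  -- other bound is an integer, as all exceed −1, and rounding up is strict everywhere.
  by_cases hex : ∃ η₂ ∈ N, η₂ ≠ η₁ ∧ ∃ c₂ : ℕ, (c₂ : ℚ) = ρ η₂
  · obtain ⟨η₂, h₂, hne, c₂, hc₂⟩ := hex
    obtain ⟨b, hb₁, -, hW, hb₂, hb⟩ := exists_extend_of_eq_of_eq hρ hsum hδ h₁ h₂ hne hc₁ hc₂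
    refine ⟨b, hb₁, hW, fun η hη h3 => ?_, ?_⟩
    · rcases eq_or_ne η η₂ with rfl | h4
      · exact hb₂
      · exact (hb η hη h3 h4).le
    · have : ∀ η, η ∈ N ∧ η ≠ η₁ ∧ ¬ ρ η < b η → η = η₂ := fun η ⟨hη, h3, h4⟩ => by
        by_contra h5
        exact h4 (hb η hη h3 h5)
      exact fun η hη η' hη' => (this η hη).trans (this η' hη').symm
  · obtain ⟨η₂, h₂, hne⟩ := Finset.exists_mem_ne hN η₁
    have hfl : (⌊ρ η₂⌋ : ℚ) ≠ ρ η₂ := by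
      intro e
      apply hex
      have h0 : -1 < ⌊ρ η₂⌋ := by
        have := hρ η₂ h₂
        rw [← e] at this
        exact_mod_cast this
      refine ⟨η₂, h₂, hne, ⌊ρ η₂⌋.toNat, ?_⟩
      rw [← e]
      have : ((⌊ρ η₂⌋.toNat : ℤ)) = ⌊ρ η₂⌋ := Int.toNat_of_nonneg (by omega)
      exact_mod_cast this
    have hcard : ((N.erase η₁).card : ℚ) = N.card - 1 := by
      rw [Finset.card_erase_of_mem h₁, Nat.cast_sub hN.le]; simp
    rw [← Finset.add_sum_erase _ _ h₁] at hsum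
    have hmem₂ : η₂ ∈ N.erase η₁ := Finset.mem_erase.2 ⟨hne, h₂⟩
    obtain ⟨b, hb, hb'⟩ := exists_sum_eq_of_floor_sum_le ⟨η₂, hmem₂⟩
      (fun η hη => hρ η (Finset.mem_of_mem_erase hη)) (t := W - c₁)
      (floor_sum_lt_of_ne hmem₂ hfl (by rw [hcard]; push_cast; linarith))
    have hstrict : ∀ η ∈ N, η ≠ η₁ → ρ η < Function.update b η₁ c₁ η := fun η hη h3 => by
      rw [Function.update_of_ne h3]
      exact hb' η (Finset.mem_erase.2 ⟨h3, hη⟩)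
    refine ⟨Function.update b η₁ c₁, by simp, ?_, fun η hη h3 => (hstrict η hη h3).le,
      fun η hη => absurd (hstrict η hη.1 hη.2.1) hη.2.2⟩
    rw [← Finset.add_sum_erase _ _ h₁, Function.update_self,
      Finset.sum_congr rfl fun η hη => by rw [Function.update_of_ne (Finset.ne_of_mem_erase hη)],
      hb]
    ring

/-- A distribution that violates at most one of the inequalities. -/
lemma exists_distribution (hρ : ∀ η ∈ N, -1 < ρ η)
    (hsum : ∑ η ∈ N, ρ η = W + 2 - N.card - δ) (hδ : 0 ≤ δ) (hW : 0 ≤ W) (hN : N.Nonempty) :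
    ∃ b : ι → ℕ, W = ∑ η ∈ N, (b η : ℤ) ∧ {η | η ∈ N ∧ ¬ ρ η ≤ b η}.Subsingleton := by
  -- A positive bound may be violated by the largest integer below it, leaving room for the others.
  -- If no bound is positive, or there is one index only, all of W can be put on one index.
  by_cases hex : 1 < N.card ∧ ∃ η₁ ∈ N, 0 < ρ η₁
  · obtain ⟨hN, η₁, h₁, hpos⟩ := hex
    have hceil : 0 < ⌈ρ η₁⌉ := Int.ceil_pos.2 hpos
    have hc : ((⌈ρ η₁⌉ - 1).toNat : ℚ) < ρ η₁ := by
      have e : (((⌈ρ η₁⌉ - 1).toNat : ℤ) : ℚ) = ((⌈ρ η₁⌉ - 1 : ℤ) : ℚ) := by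
        rw [Int.toNat_of_nonneg (by omega)]
      rw [Int.cast_natCast] at e
      rw [e]
      have := Int.ceil_lt_add_one (ρ η₁)
      push_cast
      linarith
    obtain ⟨b, -, hb, hb'⟩ := exists_extend_of_lt hρ hsum hN h₁ (hc.trans_le (by linarith))
    refine ⟨b, hb, ?_⟩
    have : ∀ η, η ∈ N ∧ ¬ ρ η ≤ b η → η = η₁ := fun η ⟨hη, h4⟩ => by
      by_contra h5
      exact h4 (hb' η hη h5).le
    exact fun η hη η' hη' => (this η hη).trans (this η' hη').symm
  · obtain ⟨η₁, h₁⟩ := hN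
    refine ⟨fun η => if η = η₁ then W.toNat else 0, ?_, ?_⟩
    · push_cast
      rw [Finset.sum_ite_eq' N η₁, if_pos h₁, Int.toNat_of_nonneg hW]
    · have : ∀ η, (η ∈ N ∧ ¬ ρ η ≤ ((if η = η₁ then W.toNat else 0 : ℕ) : ℚ)) → η = η₁ := by
        rintro η ⟨hη, h4⟩
        by_contra h5
        apply hex
        rw [if_neg h5] at h4
        exact ⟨Finset.one_lt_card.2 ⟨η, hη, η₁, h₁, h5⟩, η, hη, by simpa using h4⟩
      exact fun η hη η' hη' => (this η hη).trans (this η' hη').symm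

end Rounding

end ExcTree

/-! ### Reduction of the theorem to rounding. -/

theorem lemma3p6 {R K : Type*} [CommRing R] [IsRegularLocalRing R]
    [Field K] [Algebra R K] [IsFractionRing R K]
    (hdim : ringKrullDim R = 2) (hres : IsAlgClosed (IsLocalRing.ResidueField R))
    (𝔞 : Ideal R) (hcomplete : IsCompleteIdeal 𝔞) (hcolength : IsFiniteLength R (R ⧸ 𝔞))
    (C : Finset (LocalSubring K)) (hC : IsMinimalPrincipalization 𝔞 C)
    (γ : C) (a : ℕ) :
    -- the general choice; for a one-vertex graph there is no neighbour to choose integers for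
    (1 < C.card →
      ∃ b : C → ℕ,
        weight C γ * a = ∑ η ∈ neighbors R C γ, (b η : ℤ) ∧
        {η | η ∈ neighbors R C γ ∧ ¬ lam 𝔞 a γ ≤ lam 𝔞 (b η) η}.Subsingleton) ∧
    (1 < (neighbors R C γ).card →
      ∀ η₁ ∈ neighbors R C γ, ∀ c₁ : ℕ,
        -- 1)
        (lam 𝔞 c₁ η₁ = lam 𝔞 a γ →
          (∃ b : C → ℕ, b η₁ = c₁ ∧
            weight C γ * a = ∑ η ∈ neighbors R C γ, (b η : ℤ) ∧
            (∀ η ∈ neighbors R C γ, η ≠ η₁ → lam 𝔞 a γ ≤ lam 𝔞 (b η) η) ∧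
            {η | η ∈ neighbors R C γ ∧ η ≠ η₁ ∧ ¬ lam 𝔞 a γ < lam 𝔞 (b η) η}.Subsingleton) ∧
          (∀ η₂ ∈ neighbors R C γ, η₂ ≠ η₁ → ∀ c₂ : ℕ, lam 𝔞 c₂ η₂ = lam 𝔞 a γ →
            ∃ b : C → ℕ, b η₁ = c₁ ∧
              (2 < (neighbors R C γ).card ∨ dHat 𝔞 γ = 0 → b η₂ = c₂) ∧
              weight C γ * a = ∑ η ∈ neighbors R C γ, (b η : ℤ) ∧
              lam 𝔞 a γ ≤ lam 𝔞 (b η₂) η₂ ∧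
              ∀ η ∈ neighbors R C γ, η ≠ η₁ → η ≠ η₂ → lam 𝔞 a γ < lam 𝔞 (b η) η)) ∧
        -- 2)
        (lam 𝔞 c₁ η₁ < lam 𝔞 a γ ∨ (0 < dHat 𝔞 γ ∧ lam 𝔞 c₁ η₁ = lam 𝔞 a γ) →
          ∃ b : C → ℕ, b η₁ = c₁ ∧
            weight C γ * a = ∑ η ∈ neighbors R C γ, (b η : ℤ) ∧
            ∀ η ∈ neighbors R C γ, η ≠ η₁ → lam 𝔞 a γ < lam 𝔞 (b η) η)) := by
  classical
  have hinj : Function.Injective (algebraMap R K) := IsFractionRing.injective R K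
  have hR : IsPoint (root R K) := isPoint_root hinj hdim hres
  have hcl : IsCluster R C := hC.1.1
  have h𝔞 : 𝔞 ≠ ⊥ := hC.ne_bot γ.2
  set d : LocalSubring K → ℤ := fun σ => (idealOrd 𝔞 σ : ℤ) with hd
  have hr : ∀ T ∈ C, 0 < excess C d T := fun T hT => hC.excess_pos hR hinj hT
  have hk : ∀ T ∈ C, excess C (canonicalCoeff C) T = 1 := fun T hT =>
    excess_canonicalCoeff hR hcl hT
  have hnef : ∀ T ∈ C, ∑ σ ∈ above C T, excess C d σ ≤ excess C d T := by
    intro T hT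
    have h1 := dHat_nonneg hR hcl hinj h𝔞 ⟨T, hT⟩
    rw [dHat_eq_excess hR hcl] at h1
    linarith
  have hdpos : ∀ η : C, (0 : ℚ) < dCoeff 𝔞 η := by
    intro η
    have : (0 : ℤ) < (dCoeff 𝔞 η : ℤ) := hcl.pos_of_excess_pos hR hr η.1 η.2
    exact_mod_cast this
  have hkpos : ∀ η : C, 1 ≤ kCoeff C η := by
    intro η
    rw [← canonicalCoeff_coe]
    exact hcl.one_le_of_excess_eq hR hk η.1 η.2
  set l : ℚ := lam 𝔞 a γ with hl
  have hldef : l * dCoeff 𝔞 γ = a + kCoeff C γ + 1 := by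
    rw [hl, lam, div_mul_cancel₀ _ (hdpos γ).ne']
    push_cast
    rfl
  have hkγq : (1 : ℚ) ≤ kCoeff C γ := by exact_mod_cast hkpos γ
  have hlpos : 0 < l := by
    rw [hl, lam]
    refine div_pos ?_ (hdpos γ)
    push_cast
    positivity
  -- The value of c for which λ(c, η) would equal l.
  set ρ : C → ℚ := fun η => l * dCoeff 𝔞 η - kCoeff C η - 1 with hρdef
  have hle : ∀ (η : C) (c : ℕ), l ≤ lam 𝔞 c η ↔ ρ η ≤ c := by
    intro η c
    rw [lam, le_div_iff₀ (hdpos η)]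
    simp only [hρdef]
    push_cast
    constructor <;> intro h <;> linarith
  have hlt : ∀ (η : C) (c : ℕ), l < lam 𝔞 c η ↔ ρ η < c := by
    intro η c
    rw [lam, lt_div_iff₀ (hdpos η)]
    simp only [hρdef]
    push_cast
    constructor <;> intro h <;> linarith
  have heq : ∀ (η : C) (c : ℕ), lam 𝔞 c η = l → (c : ℚ) = ρ η := by
    intro η c h
    have h1 := (hle η c).1 h.ge
    have h2 := mt (hlt η c).2 (by rw [h]; exact lt_irrefl _)
    exact le_antisymm (not_lt.1 h2) h1
  have hρ : ∀ η ∈ neighbors R C γ, -1 < ρ η := by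
    intro η hη
    have hadj : (dualGraph R C).Adj γ η := by simpa [neighbors] using hη
    have key : kCoeff C η * (dCoeff 𝔞 γ : ℤ) < (kCoeff C γ + 1) * dCoeff 𝔞 η := by
      rw [← canonicalCoeff_coe, ← canonicalCoeff_coe]
      obtain ⟨hne, T, -, h1, h2⟩ := hadj
      rcases LiesOnStrictTransform.or_of_ne hR (hcl _ γ.2).1 (hcl _ η.2).1
        (fun e => hne (Subtype.ext e)) h1 h2 with h | h
      · exact (hcl.mul_lt_mul_of_prox hR hk hr hnef γ.1 γ.2 η.1 η.2 h).2
      · exact (hcl.mul_lt_mul_of_prox hR hk hr hnef η.1 η.2 γ.1 γ.2 h).1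
    have keyq : (kCoeff C η : ℚ) * dCoeff 𝔞 γ < (kCoeff C γ + 1) * dCoeff 𝔞 η := by
      exact_mod_cast key
    have h1 : (kCoeff C η : ℚ) * dCoeff 𝔞 γ < l * dCoeff 𝔞 η * dCoeff 𝔞 γ := by
      have e : l * dCoeff 𝔞 η * dCoeff 𝔞 γ = (a + kCoeff C γ + 1) * dCoeff 𝔞 η := by
        rw [← hldef]; ring
      rw [e]
      -- As l d_γ = a + k_γ + 1 is at least k_γ + 1, the discrepancy inequality gives l d_η > k_η.
      have : (0 : ℚ) ≤ a * dCoeff 𝔞 η := by positivity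
      linarith
    have h2 := lt_of_mul_lt_mul_right h1 (hdpos γ).le
    simp only [hρdef]
    linarith
  have hw : 0 ≤ weight C γ := by rw [weight_eq hR hcl]; positivity
  -- Adjunction contributes 2 − m. The defect δ of the rounding lemmas is l d̂_γ, so δ > 0 exactly
  -- when d̂_γ > 0.
  have hsum : ∑ η ∈ neighbors R C γ, ρ η =
      ((weight C γ * a : ℤ) : ℚ) + 2 - (neighbors R C γ).card - l * dHat 𝔞 γ := by
    have h1 : ((∑ η ∈ neighbors R C γ, kCoeff C η : ℤ) : ℚ) =
        weight C γ * kCoeff C γ + weight C γ - 2 := by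
      rw [sum_neighbors_kCoeff hR hcl]; push_cast; ring
    have h2 : (dHat 𝔞 γ : ℚ) = weight C γ * dCoeff 𝔞 γ -
        ∑ η ∈ neighbors R C γ, (dCoeff 𝔞 η : ℚ) := by
      rw [dHat_eq hR hcl]; push_cast; ring
    push_cast at h1 ⊢
    simp only [hρdef]
    rw [Finset.sum_sub_distrib, Finset.sum_sub_distrib, ← Finset.mul_sum, h1, h2,
      Finset.sum_const, nsmul_eq_mul, mul_one]
    linear_combination (weight C γ : ℚ) * hldef
  have hdhat := dHat_nonneg hR hcl hinj h𝔞 γ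
  have hδ : 0 ≤ l * (dHat 𝔞 γ : ℚ) := mul_nonneg hlpos.le (by exact_mod_cast hdhat)
  simp only [hle, hlt]
  refine ⟨fun hcard => ?_, fun hcard η₁ h₁ c₁ => ⟨fun hc₁ => ⟨?_, ?_⟩, fun hc₁ => ?_⟩⟩
  · exact exists_distribution hρ hsum hδ (mul_nonneg hw (by positivity))
      (neighbors_nonempty hR hcl hcard γ)
  · exact exists_extend_of_eq hρ hsum hδ hcard h₁ (heq _ _ hc₁)
  · intro η₂ h₂ hne c₂ hc₂
    obtain ⟨b, hb₁, hb₂, hb⟩ := exists_extend_of_eq_of_eq hρ hsum hδ h₁ h₂ hne (heq _ _ hc₁)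
      (heq _ _ hc₂)
    refine ⟨b, hb₁, fun h => hb₂ (h.imp_right fun h0 => ?_), hb⟩
    rw [h0]; simp
  · refine exists_extend_of_lt hρ hsum hcard h₁ ?_
    rcases hc₁ with hc₁ | ⟨hpos, hc₁⟩
    · have := mt (hle η₁ c₁).2 (not_le.2 hc₁)
      have := not_le.1 this
      linarith
    · rw [heq _ _ hc₁]
      have : 0 < l * (dHat 𝔞 γ : ℚ) := mul_pos hlpos (by exact_mod_cast hpos)
      linarith
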